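/- Let $G$ be a finite simple graph. If $G$ contains the complete bipartite graph $K_{3,4}$ as an induced minor (that is, a graph isomorphic to $K_{3,4}$ can be obtained from $G$ by repeatedly deleting vertices and contracting edges), then $G$ contains a triangle or a theta as an induced subgraph. Here a theta is a graph made of three internally vertex-disjoint chordless paths $P_1 = a\dots b$, $P_2 = a\dots b$, $P_3 = a\dots b$, with the same two ends $a$ and $b$, each of length at least two, such that no edges exist between the paths except the three edges incident to $a$ and the three edges incident to $b$. -/

import Mathlib

namespace SimpleGraph

/-- The graph obtained from `G` by contracting the edge `uv`: the vertex `v` is merged into `u`,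
which becomes adjacent to all former neighbours of `v`. Loops and parallel edges are discarded.
(Only used when `G.Adj u v` holds.) -/
def contractEdge {V : Type*} (G : SimpleGraph V) (u v : V) : SimpleGraph {x : V // x ≠ v} where
  Adj x y := x ≠ y ∧
    (G.Adj x.1 y.1 ∨ (x.1 = u ∧ G.Adj v y.1) ∨ (y.1 = u ∧ G.Adj x.1 v))
  symm := ⟨by
    rintro x y ⟨hne, h | ⟨hx, h⟩ | ⟨hy, h⟩⟩
    · exact ⟨hne.symm, Or.inl h.symm⟩
    · exact ⟨hne.symm, Or.inr (Or.inr ⟨hx, h.symm⟩)⟩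
    · exact ⟨hne.symm, Or.inr (Or.inl ⟨hy, h.symm⟩)⟩⟩
  loopless := ⟨fun _ h => h.1 rfl⟩

universe u in
/-- `ReducesTo G H`: the graph `H` is obtained from `G` by repeatedly deleting vertices and
contracting edges. -/
inductive ReducesTo : ∀ {V W : Type u}, SimpleGraph V → SimpleGraph W → Prop
  | refl {V : Type u} (G : SimpleGraph V) : ReducesTo G G
  | delete {V W : Type u} (G : SimpleGraph V) (H : SimpleGraph W) (v : V)
      (h : ReducesTo (G.induce {x : V | x ≠ v}) H) : ReducesTo G H
  | contract {V W : Type u} (G : SimpleGraph V) (H : SimpleGraph W) (u v : V) (huv : G.Adj u v)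
      (h : ReducesTo (G.contractEdge u v) H) : ReducesTo G H

universe u w in
/-- `H` is (up to isomorphism) an induced minor of `G`. -/
def IsInducedMinor {W : Type w} {V : Type u} (H : SimpleGraph W) (G : SimpleGraph V) : Prop :=
  ∃ (U : Type u) (K : SimpleGraph U), ReducesTo G K ∧ Nonempty (K ≃g H)

/-- `T` is a theta: it is made of three internally vertex-disjoint chordless paths with the same
two ends `a` and `b`, each of length at least two, with no other vertices and no other edges. -/
def IsTheta {V : Type*} (T : SimpleGraph V) : Prop :=
  ∃ (a b : V) (P : Fin 3 → T.Walk a b),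
    (∀ i, (P i).IsPath ∧ (P i).IsChordless ∧ 2 ≤ (P i).length) ∧
    (∀ i j, i ≠ j → ∀ x, x ∈ (P i).support → x ∈ (P j).support → x = a ∨ x = b) ∧
    (∀ x, ∃ i, x ∈ (P i).support) ∧
    (∀ e ∈ T.edgeSet, ∃ i, e ∈ (P i).edges)

/-- `G` contains a theta as an induced subgraph. -/
def ContainsInducedTheta {V : Type*} (G : SimpleGraph V) : Prop :=
  ∃ S : Set V, (G.induce S).IsTheta

end SimpleGraph

/-! Suppose that `G` has no triangle. The induced minor gives connected branch sets `A i` (three,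
pairwise anticomplete) and `B j` (four, pairwise anticomplete), every `A i` touching every `B j`.
Choose them with the total size of the `B j` minimum. Then every `B j` is an induced path: one of
the `A i` touches only its first vertex, another only its last vertex, and the remaining one, the
middle set, touches both ends (`Model.Minimal.exists_mid`). Call the path short if it has at most
two vertices, and long otherwise.

One principle produces all thetas: two vertices joined by three routes that are pairwise
anticomplete away from them are the ends of an induced theta, unless they are equal or adjacent
(`theta_of_conn`). Hence, in the absence of a theta, such vertices are close to each other, and this
closeness feeds the next construction. The vertices come from branching points. If `v` has
neighbours on an induced path, the branching point is its unique neighbour, or `v` itself when there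
are several, since triangle-freeness keeps the extreme ones apart (`exists_center`). Similarly,
three independent vertices attached to a connected set are the ends of a tripod inside it
(`exists_tripod`).

Two short paths give a theta directly (`theta_of_two_small`), so three paths are long. Suppose that
two of these have the same middle set `A₃`. Tripods in `A₁` and `A₂` joined by the three paths have
close centers. This is impossible if all three middle sets agree (`theta_of_three_same_mid`).
Otherwise the third path is cut down to one end vertex, the centers are at or next to that vertex,
and they form a hub for the two paths. A link through `A₃` between these paths then completes a
theta (`exists_link`, `Hub.theta`, `theta_of_two_same_mid`).

If the three long paths have distinct middle sets, the fourth path shares its middle set with one of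
them. By the previous case it is short, and `CrossConfig.theta` applies: connections between paths
with different middle sets are so restricted (`legs_of_two_mid`) that they contradict each other or
give another hub. -/

namespace SimpleGraph
namespace InducedTheta

variable {V : Type*} {G : SimpleGraph V}

/-! ### Connected sets, anticomplete sets and induced paths. -/

/-- `a` and `b` are joined by a walk of `G` all of whose vertices lie in `S`. -/
def Conn (G : SimpleGraph V) (S : Set V) (a b : V) : Prop :=
  a ∈ S ∧ Relation.ReflTransGen (fun u v => G.Adj u v ∧ v ∈ S) a b

/-- `S` is a nonempty set inducing a connected subgraph. -/
def ConnSet (G : SimpleGraph V) (S : Set V) : Prop :=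
  S.Nonempty ∧ ∀ a ∈ S, ∀ b ∈ S, Conn G S a b

/-- Outside of `X`, the sets `S` and `T` are disjoint and no edge joins them. -/
def Anti (G : SimpleGraph V) (X S T : Set V) : Prop :=
  ∀ a ∈ S, ∀ b ∈ T, a ∉ X → b ∉ X → a ≠ b ∧ ¬ G.Adj a b

/-- The vertex `v` has a neighbour in `S`. -/
def Att (G : SimpleGraph V) (S : Set V) (v : V) : Prop := ∃ a ∈ S, G.Adj a v

/-- `f 0, …, f n` is an induced path of `G`. -/
structure IPath (G : SimpleGraph V) (n : ℕ) (f : ℕ → V) : Prop where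
  inj : ∀ i j, i ≤ n → j ≤ n → f i = f j → i = j
  adj : ∀ i, i < n → G.Adj (f i) (f (i + 1))
  nadj : ∀ i j, i ≤ n → j ≤ n → G.Adj (f i) (f j) → j = i + 1 ∨ i = j + 1

/-- The set `{f a, …, f b}`. -/
def seg (f : ℕ → V) (a b : ℕ) : Set V := {v | ∃ i, a ≤ i ∧ i ≤ b ∧ f i = v}

lemma mem_seg {f : ℕ → V} {a b i : ℕ} (h1 : a ≤ i) (h2 : i ≤ b) : f i ∈ seg f a b :=
  ⟨i, h1, h2, rfl⟩

lemma seg_mono {f : ℕ → V} {a b a' b' : ℕ} (h1 : a' ≤ a) (h2 : b ≤ b') :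
    seg f a b ⊆ seg f a' b' := by
  rintro _ ⟨i, h, h', rfl⟩
  exact mem_seg (h1.trans h) (h'.trans h2)

namespace Conn

variable {S T : Set V} {a b c : V}

lemma left_mem (h : Conn G S a b) : a ∈ S := h.1

lemma right_mem (h : Conn G S a b) : b ∈ S := by
  obtain ⟨ha, h⟩ := h
  cases h with
  | refl => exact ha
  | tail _ h => exact h.2

lemma refl (h : a ∈ S) : Conn G S a a := ⟨h, .refl⟩

lemma trans (h : Conn G S a b) (h' : Conn G S b c) : Conn G S a c := ⟨h.1, h.2.trans h'.2⟩

lemma of_adj (ha : a ∈ S) (hb : b ∈ S) (h : G.Adj a b) : Conn G S a b := ⟨ha, .single ⟨h, hb⟩⟩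

lemma symm (h : Conn G S a b) : Conn G S b a := by
  obtain ⟨ha, h⟩ := h
  induction h with
  | refl => exact refl ha
  | @tail u v h1 h2 ih => exact trans (of_adj h2.2 ih.left_mem h2.1.symm) ih

lemma mono (hST : S ⊆ T) (h : Conn G S a b) : Conn G T a b :=
  ⟨hST h.1, Relation.ReflTransGen.mono (fun _ _ h => ⟨h.1, hST h.2⟩) _ _ h.2⟩

lemma seg_aux {f : ℕ → V} {n i : ℕ} (h : ∀ j, j < n → G.Adj (f j) (f (j + 1))) (d : ℕ)
    (hn : i + d ≤ n) : Conn G (seg f i (i + d)) (f i) (f (i + d)) := by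
  induction d with
  | zero => exact refl (mem_seg le_rfl le_rfl)
  | succ d ih =>
    refine ((ih (by omega)).mono (seg_mono le_rfl (by omega))).trans ?_
    exact of_adj (mem_seg (by omega) (by omega)) (mem_seg (by omega) (by omega))
      (h _ (by omega))

lemma seg_le {f : ℕ → V} {n i j : ℕ} (h : ∀ j, j < n → G.Adj (f j) (f (j + 1))) (hij : i ≤ j)
    (hn : j ≤ n) : Conn G (seg f i j) (f i) (f j) := by
  obtain ⟨d, rfl⟩ := Nat.exists_eq_add_of_le hij
  exact seg_aux h d hn

end Conn

lemma IPath.conn {n : ℕ} {f : ℕ → V} (h : IPath G n f) {a b i j : ℕ} (hb : b ≤ n)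
    (hi : a ≤ i) (hi' : i ≤ b) (hj : a ≤ j) (hj' : j ≤ b) : Conn G (seg f a b) (f i) (f j) := by
  rcases le_total i j with hij | hij
  · exact (Conn.seg_le h.adj hij (by omega)).mono (seg_mono hi hj')
  · exact ((Conn.seg_le h.adj hij (by omega)).mono (seg_mono hj hi')).symm

lemma IPath.connSet {n : ℕ} {f : ℕ → V} (h : IPath G n f) {a b : ℕ} (hab : a ≤ b) (hb : b ≤ n) :
    ConnSet G (seg f a b) := by
  refine ⟨⟨f a, mem_seg le_rfl hab⟩, ?_⟩
  rintro _ ⟨i, h1, h2, rfl⟩ _ ⟨j, h3, h4, rfl⟩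
  exact h.conn hb h1 h2 h3 h4

lemma IPath.reverse {n : ℕ} {f : ℕ → V} (h : IPath G n f) : IPath G n (fun i => f (n - i)) where
  inj i j hi hj hij := by
    have := h.inj _ _ (by omega) (by omega) hij
    omega
  adj i hi := by
    have := (h.adj (n - (i + 1)) (by omega)).symm
    rwa [show n - (i + 1) + 1 = n - i by omega] at this
  nadj i j hi hj hij := by
    have := h.nadj _ _ (by omega) (by omega) hij
    omega

lemma seg_reverse {n : ℕ} {f : ℕ → V} {a b : ℕ} (ha : a ≤ n) (hb : b ≤ n) :
    seg (fun i => f (n - i)) (n - b) (n - a) = seg f a b := by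
  ext v
  constructor
  · rintro ⟨i, h1, h2, rfl⟩
    exact ⟨n - i, by omega, by omega, rfl⟩
  · rintro ⟨i, h1, h2, rfl⟩
    refine ⟨n - i, by omega, by omega, ?_⟩
    simp only
    congr 1
    omega

lemma seg_zero_reverse {n : ℕ} {f : ℕ → V} : seg (fun i => f (n - i)) 0 n = seg f 0 n := by
  have := seg_reverse (f := f) (Nat.zero_le n) (le_refl n)
  simpa using this

namespace Anti

variable {X Y S S' T T' : Set V}

lemma symm (h : Anti G X S T) : Anti G X T S := fun a ha b hb ha' hb' =>
  ⟨(h b hb a ha hb' ha').1.symm, fun h' => (h b hb a ha hb' ha').2 h'.symm⟩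

lemma mono (hS : S ⊆ S') (hT : T ⊆ T') (h : Anti G X S' T') : Anti G X S T :=
  fun a ha b hb => h a (hS ha) b (hT hb)

lemma mono_off (hX : X ⊆ Y) (h : Anti G X S T) : Anti G Y S T :=
  fun a ha b hb ha' hb' => h a ha b hb (fun h => ha' (hX h)) (fun h => hb' (hX h))

lemma union_left (h : Anti G X S T) (h' : Anti G X S' T) : Anti G X (S ∪ S') T := by
  rintro a (ha | ha) b hb
  exacts [h a ha b hb, h' a ha b hb]

lemma union_right (h : Anti G X S T) (h' : Anti G X S T') : Anti G X S (T ∪ T') := by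
  rintro a ha b (hb | hb)
  exacts [h a ha b hb, h' a ha b hb]

lemma left_subset (h : S ⊆ X) : Anti G X S T := fun _ ha _ _ ha' => absurd (h ha) ha'

lemma right_subset (h : T ⊆ X) : Anti G X S T := fun _ _ _ hb _ hb' => absurd (h hb) hb'

end Anti

/-- A shortest walk in `S` between two sets is an induced path meeting them only in its ends. -/
lemma exists_path {S : Set V} {a b : V} (h : Conn G S a b) {X Y : V → Prop} (ha : X a)
    (hb : Y b) : ∃ n f, IPath G n f ∧ (∀ i, i ≤ n → f i ∈ S) ∧ X (f 0) ∧ Y (f n) ∧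
      (∀ i, i ≤ n → X (f i) → i = 0) ∧ (∀ i, i ≤ n → Y (f i) → i = n) := by
  classical
  have hex : ∃ n, ∃ f : ℕ → V, (∀ i, i < n → G.Adj (f i) (f (i + 1))) ∧
      (∀ i, i ≤ n → f i ∈ S) ∧ X (f 0) ∧ Y (f n) := by
    obtain ⟨haS, h⟩ := h
    have : ∃ n, ∃ f : ℕ → V, (∀ i, i < n → G.Adj (f i) (f (i + 1))) ∧
      (∀ i, i ≤ n → f i ∈ S) ∧ f 0 = a ∧ f n = b := by
      clear hb
      induction h with
      | refl => exact ⟨0, fun _ => a, by simp, by simpa, rfl, rfl⟩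
      | @tail u v _ huv ih =>
        obtain ⟨n, f, h1, h2, h3, h4⟩ := ih
        refine ⟨n + 1, fun i => if i ≤ n then f i else v, ?_, ?_, by simpa using h3, by simp⟩
        · intro i hi
          by_cases hin : i = n
          · subst hin
            simpa [h4] using huv.1
          · have : i + 1 ≤ n := by omega
            simpa [this, show i ≤ n by omega] using h1 i (by omega)
        · intro i hi
          by_cases hin : i ≤ n
          · simpa [hin] using h2 i hin
          · simpa [hin] using huv.2
    obtain ⟨n, f, h1, h2, rfl, rfl⟩ := this
    exact ⟨n, f, h1, h2, ha, hb⟩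
  obtain ⟨f, h1, h2, h3, h4⟩ := Nat.find_spec hex
  have hmin := fun m (hm : m < Nat.find hex) => Nat.find_min hex hm
  set n := Nat.find hex
  -- cutting out the part of the walk strictly between `i` and `j` gives a shorter walk
  have cut : ∀ i j, i < j → j ≤ n → i + 1 < j → ¬ G.Adj (f i) (f j) := by
    intro i j hij hj hij' hadj
    refine hmin (n - (j - i - 1)) (by omega)
      ⟨fun k => if k ≤ i then f k else f (k + (j - i - 1)), ?_, ?_, by simpa using h3, ?_⟩
    · intro k hk
      rcases lt_trichotomy k i with hki | rfl | hki
      · simpa [hki.le, show k + 1 ≤ i by omega] using h1 k (by omega)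
      · simpa [show k + 1 + (j - k - 1) = j by omega] using hadj
      · have := h1 (k + (j - i - 1)) (by omega)
        simpa [show ¬ k ≤ i by omega, show ¬ k + 1 ≤ i by omega,
          show k + 1 + (j - i - 1) = k + (j - i - 1) + 1 by omega] using this
    · intro k hk
      by_cases hki : k ≤ i
      · simpa [hki] using h2 k (by omega)
      · simpa [hki] using h2 _ (by omega)
    · simpa [show ¬ n - (j - i - 1) ≤ i by omega,
        show n - (j - i - 1) + (j - i - 1) = n by omega] using h4
  have cut' : ∀ i j, i < j → j ≤ n → f i ≠ f j := by
    intro i j hij hj heq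
    refine hmin (n - (j - i)) (by omega)
      ⟨fun k => if k ≤ i then f k else f (k + (j - i)), ?_, ?_, by simpa using h3, ?_⟩
    · intro k hk
      rcases lt_trichotomy k i with hki | rfl | hki
      · simpa [hki.le, show k + 1 ≤ i by omega] using h1 k (by omega)
      · simpa [show k + 1 + (j - k) = j + 1 by omega, heq] using h1 j (by omega)
      · have := h1 (k + (j - i)) (by omega)
        simpa [show ¬ k ≤ i by omega, show ¬ k + 1 ≤ i by omega,
          show k + 1 + (j - i) = k + (j - i) + 1 by omega] using this
    · intro k hk
      by_cases hki : k ≤ i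
      · simpa [hki] using h2 k (by omega)
      · simpa [hki] using h2 _ (by omega)
    -- If the removed closed piece reaches the end of the walk, then `j = n` and the shortened walk
    -- ends at `f i`, which is the same vertex as `f n`.
    · by_cases hni : n - (j - i) ≤ i
      · have : n - (j - i) = i := by omega
        have hjn : j = n := by omega
        simp only [this, le_refl, if_true]
        rw [heq, hjn]
        exact h4
      · simpa [hni, show n - (j - i) + (j - i) = n by omega] using h4
  refine ⟨n, f, ⟨?_, h1, ?_⟩, h2, h3, h4, ?_, ?_⟩
  · intro i j hi hj hij
    by_contra hne
    rcases Nat.lt_or_gt_of_ne hne with h | h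
    · exact cut' i j h hj hij
    · exact cut' j i h hi hij.symm
  · intro i j hi hj hij
    by_contra! hne
    rcases lt_trichotomy i j with h | rfl | h
    · exact cut i j h hj (by omega) hij
    · exact G.loopless.irrefl _ hij
    · exact cut j i h hi (by omega) hij.symm
  · intro i hi hX
    by_contra hne
    refine hmin (n - i) (by omega) ⟨fun k => f (k + i), ?_, ?_, by simpa using hX, ?_⟩
    · intro k hk
      have := h1 (k + i) (by omega)
      rwa [show k + i + 1 = k + 1 + i by omega] at this
    · intro k hk
      exact h2 _ (by omega)
    · simpa [show n - i + i = n by omega] using h4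
  · intro i hi hY
    by_contra hne
    exact hmin i (by omega) ⟨f, fun k hk => h1 k (by omega), fun k hk => h2 k (by omega), h3, hY⟩

/-- If a connected piece starting outside `Q` eventually meets or touches `Q`, then it touches `Q`
before entering it. -/
lemma Conn.exists_touch {S Q : Set V} {z s : V} (h : Conn G S z s) (hz : z ∉ Q)
    (hs : s ∈ Q ∨ Att G Q s) : ∃ a, Conn G (S \ Q) z a ∧ Att G Q a := by
  have key : Conn G (S \ Q) z s ∨ ∃ a, Conn G (S \ Q) z a ∧ Att G Q a := by
    obtain ⟨hzS, h⟩ := h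
    clear hs
    induction h with
    | refl => exact .inl (.refl ⟨hzS, hz⟩)
    | @tail u v _ huv ih =>
      rcases ih with ih | ih
      · by_cases hv : v ∈ Q
        · exact .inr ⟨u, ih, v, hv, huv.1.symm⟩
        · exact .inl (ih.trans (.of_adj ih.right_mem ⟨huv.2, hv⟩ huv.1))
      · exact .inr ih
  rcases key with key | key
  · rcases hs with hs | hs
    · exact absurd hs key.right_mem.2
    · exact ⟨s, key, hs⟩
  · exact key

lemma ConnSet.insert_vertex {S : Set V} (h : ConnSet G S) {v : V} (hv : Att G S v) :
    ConnSet G (insert v S) := by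
  obtain ⟨w, hw, hwv⟩ := hv
  have key : ∀ a ∈ insert v S, Conn G (insert v S) a w := by
    rintro a (rfl | ha)
    · exact .of_adj (.inl rfl) (.inr hw) hwv.symm
    · exact (h.2 a ha w hw).mono (Set.subset_insert _ _)
  exact ⟨⟨v, .inl rfl⟩, fun a ha b hb => (key a ha).trans (key b hb).symm⟩

lemma ConnSet.union {S T : Set V} (hS : ConnSet G S) (hT : ConnSet G T) {s t : V} (hs : s ∈ S)
    (ht : t ∈ T) (h : s = t ∨ G.Adj s t) : ConnSet G (S ∪ T) := by
  have hst : Conn G (S ∪ T) s t := by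
    rcases h with rfl | h
    · exact .refl (.inl hs)
    · exact .of_adj (.inl hs) (.inr ht) h
  have key : ∀ a ∈ S ∪ T, Conn G (S ∪ T) a s := by
    rintro a (ha | ha)
    · exact (hS.2 a ha s hs).mono Set.subset_union_left
    · exact ((hT.2 a ha t ht).mono Set.subset_union_right).trans hst.symm
  exact ⟨⟨s, .inl hs⟩, fun a ha b hb => (key a ha).trans (key b hb).symm⟩

lemma ConnSet.singleton (v : V) : ConnSet G {v} :=
  ⟨⟨v, rfl⟩, by rintro a rfl b rfl; exact .refl rfl⟩

/-- A connected proper subset can be avoided by a vertex whose deletion preserves connectivity. -/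
lemma ConnSet.exists_diff [Finite V] {S P : Set V} (hS : ConnSet G S) (hP : ConnSet G P)
    (hPS : P ⊂ S) : ∃ v ∈ S \ P, ConnSet G (S \ {v}) := by
  -- A maximal connected `Q` with `P ⊆ Q ⊂ S` misses exactly one vertex: adding a vertex of `S` that
  -- touches `Q` keeps it connected, so by maximality it fills `S`.
  obtain ⟨Q, hQ⟩ := (Set.toFinite {Q : Set V | P ⊆ Q ∧ Q ⊂ S ∧ ConnSet G Q}).exists_maximal
    ⟨P, subset_rfl, hPS, hP⟩
  obtain ⟨⟨hPQ, hQS, hQc⟩, hmax⟩ := hQ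
  obtain ⟨w, hwS, hwQ⟩ := Set.exists_of_ssubset hQS
  obtain ⟨q, hq⟩ := hQc.1
  obtain ⟨a, ha, haQ⟩ := (hS.2 w hwS q (hQS.1 hq)).exists_touch hwQ (.inl hq)
  have haS : a ∈ S \ Q := ha.right_mem
  have hins := hQc.insert_vertex haQ
  have hsub : insert a Q ⊆ S := Set.insert_subset haS.1 hQS.1
  have heq : insert a Q = S := by
    by_contra hne
    have := hmax (y := insert a Q) ⟨hPQ.trans (Set.subset_insert _ _),
      ⟨hsub, fun h => hne (hsub.antisymm h)⟩, hins⟩ (Set.subset_insert _ _)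
    exact haS.2 (this (.inl rfl))
  refine ⟨a, ⟨haS.1, fun h => haS.2 (hPQ h)⟩, ?_⟩
  have : S \ {a} = Q := by
    rw [← heq]
    ext v
    simp only [Set.mem_sdiff, Set.mem_insert_iff, Set.mem_singleton_iff]
    constructor
    · rintro ⟨rfl | h, h'⟩
      exacts [absurd rfl h', h]
    · intro h
      exact ⟨.inr h, fun h' => haS.2 (h' ▸ h)⟩
  rwa [this]

/-! ### From three connections to an induced theta. -/

lemma exists_walk {W : Type*} {T : SimpleGraph W} {n : ℕ} {g : ℕ → W}
    (h : ∀ i, i < n → T.Adj (g i) (g (i + 1))) :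
    ∃ w : T.Walk (g 0) (g n), w.length = n ∧ w.support = (List.range (n + 1)).map g ∧
      ∀ i, i < n → s(g i, g (i + 1)) ∈ w.edges := by
  induction n with
  | zero => exact ⟨.nil, rfl, by simp, by simp⟩
  | succ n ih =>
    obtain ⟨w, h1, h2, h3⟩ := ih fun i hi => h i (by omega)
    refine ⟨w.concat (h n (by omega)), by simp [h1], ?_, ?_⟩
    · rw [Walk.support_concat, h2, List.range_succ (n := n + 1)]
      simp
    · intro i hi
      rw [Walk.edges_concat]
      rcases Nat.lt_succ_iff_lt_or_eq.mp hi with hi | rfl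
      · simp [h3 i hi]
      · simp

/-- Three internally disjoint and pairwise non-adjacent connections between two distinct
non-adjacent vertices give an induced theta. -/
theorem theta_of_conn {x y : V} (hne : x ≠ y) (hxy : ¬ G.Adj x y) {K : Fin 3 → Set V}
    (hK : ∀ i, Conn G (K i) x y) (hanti : ∀ i j, i ≠ j → Anti G {x, y} (K i) (K j)) :
    G.ContainsInducedTheta := by
  have hp : ∀ i, ∃ n f, IPath G n f ∧ (∀ k, k ≤ n → f k ∈ K i) ∧ f 0 = x ∧ f n = y :=
    fun i => by
      obtain ⟨n, f, h1, h2, h3, h4, -⟩ := exists_path (hK i) (X := (· = x)) (Y := (· = y)) rfl rfl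
      exact ⟨n, f, h1, h2, h3, h4⟩
  choose n f hf hfK hf0 hfn using hp
  have hn : ∀ i, 2 ≤ n i := by
    intro i
    by_contra! hlt
    have h0 := hf0 i
    have h1 := hfn i
    interval_cases hi : n i
    · exact hne (h0.symm.trans h1)
    · have := (hf i).adj 0 (by omega)
      simp only [zero_add] at this
      rw [h0, h1] at this
      exact hxy this
  let S : Set V := {v | ∃ i, v ∈ seg (f i) 0 (n i)}
  have hS : ∀ i k, k ≤ n i → f i k ∈ S := fun i k hk => ⟨i, mem_seg (Nat.zero_le _) hk⟩
  have hxS : x ∈ S := hf0 0 ▸ hS 0 0 (Nat.zero_le _)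
  have hyS : y ∈ S := hfn 0 ▸ hS 0 (n 0) le_rfl
  -- Capping the index at `n i` makes every value of `g i` a vertex of `S`, including the values
  -- beyond the end of the path.
  let g : Fin 3 → ℕ → S := fun i k => ⟨f i (min k (n i)), hS i _ (min_le_right _ _)⟩
  have hg : ∀ i k, k ≤ n i → (g i k : V) = f i k := fun i k hk => by simp [g, hk]
  have hw := fun i => exists_walk (T := G.induce S) (n := n i) (g := g i) fun k hk => by
    have := (hf i).adj k hk
    rw [← hg i k (by omega), ← hg i (k + 1) (by omega)] at this
    exact this
  have hgx : ∀ i, g i 0 = ⟨x, hxS⟩ := fun i => Subtype.ext (by rw [hg i _ (by omega), hf0])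
  have hgy : ∀ i, g i (n i) = ⟨y, hyS⟩ := fun i => Subtype.ext (by rw [hg i _ le_rfl, hfn])
  have hw' : ∀ i, ∃ w : (G.induce S).Walk ⟨x, hxS⟩ ⟨y, hyS⟩, w.length = n i ∧
      w.support = (List.range (n i + 1)).map (g i) ∧
      ∀ k, k < n i → s(g i k, g i (k + 1)) ∈ w.edges := by
    intro i
    have := hw i
    rw [hgx i, hgy i] at this
    exact this
  choose w hlen hsupp hedge using hw'
  have hmem : ∀ i v, v ∈ (w i).support ↔ ∃ k, k ≤ n i ∧ (v : V) = f i k := by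
    intro i v
    rw [hsupp, List.mem_map]
    constructor
    · rintro ⟨k, hk, rfl⟩
      rw [List.mem_range] at hk
      exact ⟨k, by omega, hg i k (by omega)⟩
    · rintro ⟨k, hk, hv⟩
      exact ⟨k, by rw [List.mem_range]; omega, Subtype.ext ((hg i k hk).trans hv.symm)⟩
  -- an edge of `G` between two vertices of one of the paths is an edge of that path
  have hsame : ∀ i k l, k ≤ n i → l ≤ n i → ∀ u v : S, (u : V) = f i k → (v : V) = f i l →
      G.Adj u v → s(u, v) ∈ (w i).edges := by
    intro i k l hk hl u v hu hv huv
    have hu' : u = g i k := Subtype.ext (hu.trans (hg i k hk).symm)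
    have hv' : v = g i l := Subtype.ext (hv.trans (hg i l hl).symm)
    rw [hu, hv] at huv
    rcases (hf i).nadj k l hk hl huv with rfl | rfl
    · rw [hu', hv']
      exact hedge i k (by omega)
    · rw [hu', hv', Sym2.eq_swap]
      exact hedge i l (by omega)
  refine ⟨S, ⟨x, hxS⟩, ⟨y, hyS⟩, w, fun i => ⟨?_, ?_, ?_⟩, ?_, ?_, ?_⟩
  · rw [Walk.isPath_def, hsupp]
    refine List.Nodup.map_on ?_ List.nodup_range
    intro a ha b hb hab
    rw [List.mem_range] at ha hb
    refine (hf i).inj a b (by omega) (by omega) ?_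
    rw [← hg i a (by omega), ← hg i b (by omega), hab]
  · rw [Walk.isChordless_iff_forall_mem_edges]
    intro u v hu hv huv
    obtain ⟨k, hk, hu⟩ := (hmem i u).1 hu
    obtain ⟨l, hl, hv⟩ := (hmem i v).1 hv
    exact hsame i k l hk hl u v hu hv huv
  · rw [hlen]
    exact hn i
  · intro i j hij v hvi hvj
    obtain ⟨k, hk, hv⟩ := (hmem i v).1 hvi
    obtain ⟨l, hl, hv'⟩ := (hmem j v).1 hvj
    by_contra! hcon
    have h1 : (v : V) ≠ x := fun h => hcon.1 (Subtype.ext h)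
    have h2 : (v : V) ≠ y := fun h => hcon.2 (Subtype.ext h)
    refine (hanti i j hij v (hv ▸ hfK i k hk) v (hv' ▸ hfK j l hl) ?_ ?_).1 rfl <;>
    · rintro (h | h)
      exacts [h1 h, h2 h]
  · rintro ⟨v, i, k, -, hk, rfl⟩
    exact ⟨i, (hmem i _).2 ⟨k, hk, rfl⟩⟩
  · intro e he
    induction e using Sym2.ind with
    | _ u v =>
      have huv : G.Adj u v := he
      obtain ⟨i, k, -, hk, hu⟩ := u.2
      obtain ⟨j, l, -, hl, hv⟩ := v.2
      -- The ends `x` and `y` lie on all three paths. An edge between vertices taken from different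
      -- paths has `x` or `y` as an end, by anticompleteness, so both its ends lie on one common
      -- path.
      have hend : ∀ z : V, z ∈ ({x, y} : Set V) → ∀ i, ∃ k, k ≤ n i ∧ z = f i k := by
        rintro z (rfl | rfl) i
        exacts [⟨0, by omega, (hf0 i).symm⟩, ⟨n i, le_rfl, (hfn i).symm⟩]
      by_cases hij : i = j
      · subst hij
        exact ⟨i, hsame i k l hk hl u v hu.symm hv.symm huv⟩
      by_cases hux : (u : V) ∈ ({x, y} : Set V)
      · obtain ⟨k', hk', hu'⟩ := hend _ hux j
        exact ⟨j, hsame j k' l hk' hl u v hu' hv.symm huv⟩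
      by_cases hvx : (v : V) ∈ ({x, y} : Set V)
      · obtain ⟨l', hl', hv'⟩ := hend _ hvx i
        exact ⟨i, hsame i k l' hk hl' u v hu.symm hv' huv⟩
      exact absurd huv (hanti i j hij u (hu ▸ hfK i k hk) v (hv ▸ hfK j l hl) hux hvx).2

theorem theta_of_conn₃ {x y : V} (hne : x ≠ y) (hxy : ¬ G.Adj x y) {K₁ K₂ K₃ : Set V}
    (h₁ : Conn G K₁ x y) (h₂ : Conn G K₂ x y) (h₃ : Conn G K₃ x y)
    (h₁₂ : Anti G {x, y} K₁ K₂) (h₁₃ : Anti G {x, y} K₁ K₃) (h₂₃ : Anti G {x, y} K₂ K₃) :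
    G.ContainsInducedTheta := by
  refine theta_of_conn hne hxy (K := ![K₁, K₂, K₃]) (fun i => ?_) (fun i j hij => ?_)
  · fin_cases i
    exacts [h₁, h₂, h₃]
  · fin_cases i <;> fin_cases j <;> first | exact absurd rfl hij | skip
    exacts [h₁₂, h₁₃, h₁₂.symm, h₂₃, h₁₃.symm, h₂₃.symm]

/-! ### Branching points in triangle-free graphs: centers and tripods. -/

/-- `G` has no triangle. -/
def NoTriangle (G : SimpleGraph V) : Prop := ∀ a b c, G.Adj a b → G.Adj b c → ¬ G.Adj a c

/-- The neighbours of `v` on the path `x 0, …, x n` lie between `x a` and `x b`; the vertex `c` is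
`v` itself if there is more than one of them, and the unique neighbour otherwise. -/
structure Center (G : SimpleGraph V) (n : ℕ) (x : ℕ → V) (v c : V) (a b : ℕ) : Prop where
  path : IPath G n x
  not_mem : ∀ l, l ≤ n → x l ≠ v
  le : a ≤ b
  le_len : b ≤ n
  bound : ∀ l, l ≤ n → G.Adj v (x l) → a ≤ l ∧ l ≤ b
  adj_left : G.Adj v (x a)
  adj_right : G.Adj v (x b)
  cases : (c = v ∧ a + 2 ≤ b) ∨ (c = x a ∧ a = b)

/-- Take the first and the last neighbour of `v` on the path. If they coincide, this vertex is the
branching point. They cannot be consecutive, since they would form a triangle with `v`; otherwise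
their distance along the path is at least two and `v` itself branches. Either way the two outer
parts of the path are anticomplete away from `c`. -/
lemma exists_center (hG : NoTriangle G) {n : ℕ} {x : ℕ → V} (hx : IPath G n x) {v : V}
    (hv : ∀ l, l ≤ n → x l ≠ v) {l : ℕ} (hl : l ≤ n) (hvl : G.Adj v (x l)) :
    ∃ c a b, Center G n x v c a b := by
  classical
  have hex : ∃ l, l ≤ n ∧ G.Adj v (x l) := ⟨l, hl, hvl⟩
  have hex' : ∃ k, k ≤ n ∧ G.Adj v (x (n - k)) := ⟨n - l, by omega, by rwa [Nat.sub_sub_self hl]⟩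
  obtain ⟨ha1, ha2⟩ := Nat.find_spec hex
  obtain ⟨hb1, hb2⟩ := Nat.find_spec hex'
  have hamin := fun m (hm : m < Nat.find hex) => Nat.find_min hex hm
  have hbmin := fun m (hm : m < Nat.find hex') => Nat.find_min hex' hm
  set a := Nat.find hex
  set k := Nat.find hex'
  have hbound : ∀ l, l ≤ n → G.Adj v (x l) → a ≤ l ∧ l ≤ n - k := by
    intro l hl hvl
    constructor
    · by_contra! h
      exact hamin l h ⟨hl, hvl⟩
    · by_contra! h
      exact hbmin (n - l) (by omega) ⟨by omega, by rwa [Nat.sub_sub_self hl]⟩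
  have hab := (hbound a ha1 ha2).2
  rcases hab.eq_or_lt with heq | hlt
  · exact ⟨x a, a, n - k, hx, hv, hab, by omega, hbound, ha2, hb2, .inr ⟨rfl, heq⟩⟩
  · refine ⟨v, a, n - k, hx, hv, hab, by omega, hbound, ha2, hb2, .inl ⟨rfl, ?_⟩⟩
    by_contra! h
    have hab' : n - k = a + 1 := by omega
    rw [hab'] at hb2
    exact hG _ _ _ ha2 (hx.adj a (by omega)) hb2

namespace Center

variable {n : ℕ} {x : ℕ → V} {v c : V} {a b : ℕ}

lemma left (h : Center G n x v c a b) : Conn G (seg x 0 a ∪ {c}) c (x 0) := by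
  have h1 : Conn G (seg x 0 a ∪ {c}) (x a) (x 0) :=
    (h.path.conn (h.le.trans h.le_len) (Nat.zero_le _) le_rfl le_rfl (Nat.zero_le _)).mono
      Set.subset_union_left
  rcases h.cases with ⟨h2, -⟩ | ⟨h2, -⟩
  · exact (Conn.of_adj (.inr rfl) h1.left_mem (h2 ▸ h.adj_left)).trans h1
  · rw [h2] at h1 ⊢
    exact h1

lemma right (h : Center G n x v c a b) : Conn G (seg x b n ∪ {c}) c (x n) := by
  have h1 : Conn G (seg x b n ∪ {c}) (x b) (x n) :=
    (h.path.conn le_rfl le_rfl h.le_len h.le_len le_rfl).mono Set.subset_union_left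
  rcases h.cases with ⟨h2, -⟩ | ⟨h2, h3⟩
  · exact (Conn.of_adj (.inr rfl) h1.left_mem (h2 ▸ h.adj_right)).trans h1
  · rw [← h3, ← h2] at h1
    rw [← h3]
    exact h1

lemma stem (h : Center G n x v c a b) : c = v ∨ G.Adj c v := by
  rcases h.cases with ⟨h2, -⟩ | ⟨h2, -⟩
  · exact .inl h2
  · exact .inr (h2 ▸ h.adj_left.symm)

lemma conn_stem (h : Center G n x v c a b) {S : Set V} (hv : v ∈ S) (hc : c ∈ S) :
    Conn G S c v := by
  rcases h.stem with rfl | h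
  · exact .refl hv
  · exact .of_adj hc hv h

lemma anti (h : Center G n x v c a b) {i j : ℕ} (hi : i ≤ a) (hj : b ≤ j)
    (hic : x i ≠ c) (hjc : x j ≠ c) : i + 2 ≤ j := by
  rcases h.cases with ⟨-, h3⟩ | ⟨h2, h3⟩
  · omega
  · have : i ≠ a := by rintro rfl; exact hic h2.symm
    have : j ≠ a := by rintro rfl; exact hjc h2.symm
    omega

lemma anti' (h : Center G n x v c a b) {i j : ℕ} (hi : i ≤ a) (hj : b ≤ j) (hjn : j ≤ n)
    (hic : x i ≠ c) (hjc : x j ≠ c) : x i ≠ x j ∧ ¬ G.Adj (x i) (x j) := by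
  have := h.anti hi hj hic hjc
  constructor
  · intro heq
    have := h.path.inj i j (by omega) hjn heq
    omega
  · intro hadj
    have := h.path.nadj i j (by omega) hjn hadj
    omega

lemma eq_of_adj (h : Center G n x v c a b) {l : ℕ} (hl : l ≤ n) (hvl : G.Adj v (x l)) :
    v = c ∨ x l = c := by
  rcases h.cases with ⟨h2, -⟩ | ⟨h2, h3⟩
  · exact .inl h2.symm
  · have := h.bound l hl hvl
    have : l = a := by omega
    exact .inr (this ▸ h2.symm)

end Center

/-- A vertex `c` joined to `z 0`, `z 1`, `z 2` through three subsets of `A ∪ {z 0, z 1, z 2}` that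
are pairwise anticomplete away from `c`. -/
structure Tripod (G : SimpleGraph V) (A : Set V) (z : Fin 3 → V) (c : V) (T : Fin 3 → Set V) :
    Prop where
  center : c ∈ A ∨ ∃ j, c = z j
  sub : ∀ j, T j ⊆ insert (z j) A
  mem : ∀ j, z j ∈ T j
  conn : ∀ j, Conn G (T j ∪ {c}) c (z j)
  anti : ∀ i j, i ≠ j → Anti G {c} (T i) (T j)

/-- Start from an induced path of `A` between the unique neighbours `v₁` and `v₂` of `z₁` and `z₂`.
If `z₃` has neighbours on it, branch at the center of `z₃`. Otherwise `hp₃` places the unique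
neighbour of `z₃` outside the path; an induced path leading to it, of which only the first vertex
touches the first path, is the third leg, and the center of that first vertex is the branching
point. Uniqueness of the neighbours excludes unwanted edges at the `z`'s. -/
lemma tripod_of_private [Finite V] (hG : NoTriangle G) {A : Set V} (hA : ConnSet G A)
    {z₁ z₂ z₃ v₁ v₂ : V} (hz₁ : z₁ ∉ A) (hz₂ : z₂ ∉ A) (hz₃ : z₃ ∉ A)
    (h₁₂ : z₁ ≠ z₂ ∧ ¬ G.Adj z₁ z₂) (h₁₃ : z₁ ≠ z₃ ∧ ¬ G.Adj z₁ z₃)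
    (h₂₃ : z₂ ≠ z₃ ∧ ¬ G.Adj z₂ z₃) (hv₁ : v₁ ∈ A) (hv₂ : v₂ ∈ A)
    (ha₁ : G.Adj v₁ z₁) (ha₂ : G.Adj v₂ z₂) (ha₃ : Att G A z₃)
    (hp₁ : ∀ a ∈ A, G.Adj a z₁ → a = v₁) (hp₂ : ∀ a ∈ A, G.Adj a z₂ → a = v₂)
    (hp₃ : ∀ P ⊂ A, ConnSet G P → v₁ ∈ P → v₂ ∈ P →
      ∃ v₃ ∈ A \ P, G.Adj v₃ z₃ ∧ ∀ a ∈ A, G.Adj a z₃ → a = v₃) :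
    ∃ (c : V) (T₁ T₂ T₃ : Set V), (c ∈ A ∨ c = z₃) ∧ T₁ ⊆ insert z₁ A ∧ T₂ ⊆ insert z₂ A ∧
      T₃ ⊆ insert z₃ A ∧ z₁ ∈ T₁ ∧ z₂ ∈ T₂ ∧ z₃ ∈ T₃ ∧ Conn G (T₁ ∪ {c}) c z₁ ∧
      Conn G (T₂ ∪ {c}) c z₂ ∧ Conn G (T₃ ∪ {c}) c z₃ ∧ Anti G {c} T₁ T₂ ∧ Anti G {c} T₁ T₃ ∧
      Anti G {c} T₂ T₃ := by
  obtain ⟨k, p, hp, hpA, hp0, hpk, -, -⟩ :=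
    exists_path (hA.2 v₁ hv₁ v₂ hv₂) (X := (· = v₁)) (Y := (· = v₂)) rfl rfl
  have hleg₁ : ∀ {c u : V} {a b : ℕ}, Center G k p u c a b →
      Conn G ((seg p 0 a ∪ {z₁}) ∪ {c}) c z₁ := fun {c u a b} h => by
    refine (h.left.mono ?_).trans (Conn.of_adj ?_ ?_ (hp0 ▸ ha₁))
    · exact Set.union_subset_union_left _ Set.subset_union_left
    · exact .inl (.inl (mem_seg le_rfl (Nat.zero_le _)))
    · exact .inl (.inr rfl)
  have hleg₂ : ∀ {c u : V} {a b : ℕ}, Center G k p u c a b →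
      Conn G ((seg p b k ∪ {z₂}) ∪ {c}) c z₂ := fun {c u a b} h => by
    refine (h.right.mono ?_).trans (Conn.of_adj ?_ ?_ (hpk ▸ ha₂))
    · exact Set.union_subset_union_left _ Set.subset_union_left
    · exact .inl (.inl (mem_seg h.le_len le_rfl))
    · exact .inl (.inr rfl)
  have hsub : ∀ {a b : ℕ} {z : V}, b ≤ k → seg p a b ∪ {z} ⊆ insert z A := fun {a b z} hb => by
    rintro v (⟨i, -, hi, rfl⟩ | rfl)
    exacts [.inr (hpA i (by omega)), .inl rfl]
  have hcA : ∀ {c u : V} {a b : ℕ}, Center G k p u c a b → c = u ∨ c ∈ A := fun {c u a b} hc => by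
    rcases hc.cases with ⟨h, -⟩ | ⟨h, -⟩
    · exact .inl h
    · exact .inr (h ▸ hpA a (hc.le.trans hc.le_len))
  have hanti : ∀ {c u : V} {a b : ℕ}, Center G k p u c a b →
      Anti G {c} (seg p 0 a ∪ {z₁}) (seg p b k ∪ {z₂}) := fun {c u a b} h => by
    rintro _ (⟨i, -, hi, rfl⟩ | rfl) _ (⟨j, hj, hjk, rfl⟩ | rfl) hic hjc
    · exact h.anti' hi hj hjk hic hjc
    · have hik : i ≤ k := by have := h.le; have := h.le_len; omega
      refine ⟨fun h => hz₂ (h ▸ hpA i hik), fun hadj => ?_⟩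
      have h1 := hp.inj i k hik le_rfl ((hp₂ _ (hpA i hik) hadj).trans hpk.symm)
      have : a = k ∧ b = k := by have := h.le; have := h.le_len; omega
      rcases h.cases with h2 | h2
      · omega
      · exact hic (by rw [h1, h2.1, this.1]; rfl)
    · refine ⟨fun h => hz₁ (h ▸ hpA j hjk), fun hadj => ?_⟩
      have h1 := hp.inj j 0 hjk (by omega) ((hp₁ _ (hpA j hjk) hadj.symm).trans hp0.symm)
      rcases h.cases with h2 | h2
      · omega
      · exact hjc (by rw [h2.1, show j = a by omega]; rfl)
    · exact h₁₂
  by_cases hz : ∃ i, i ≤ k ∧ G.Adj z₃ (p i)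
  · obtain ⟨i, hi, hzi⟩ := hz
    obtain ⟨c, a, b, hc⟩ := exists_center hG hp (fun l hl h => hz₃ (by rw [← h]; exact hpA l hl)) hi hzi
    have hbk := hc.le_len
    have hab := hc.le
    refine ⟨c, seg p 0 a ∪ {z₁}, seg p b k ∪ {z₂}, {z₃}, (hcA hc).symm, hsub (by omega),
      hsub le_rfl, by rintro v rfl; exact .inl rfl, .inr rfl, .inr rfl, rfl, hleg₁ hc, hleg₂ hc,
      hc.conn_stem (.inl rfl) (.inr rfl), hanti hc, ?_, ?_⟩
    · rintro _ (⟨i, -, hi, rfl⟩ | rfl) _ rfl hic hjc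
      · refine ⟨fun h => hz₃ (h ▸ hpA i (by omega)), fun hadj => ?_⟩
        rcases hc.eq_of_adj (by omega) hadj.symm with h | h
        exacts [hjc h, hic h]
      · exact h₁₃
    · rintro _ (⟨i, -, hi, rfl⟩ | rfl) _ rfl hic hjc
      · refine ⟨fun h => hz₃ (h ▸ hpA i (by omega)), fun hadj => ?_⟩
        rcases hc.eq_of_adj (by omega) hadj.symm with h | h
        exacts [hjc h, hic h]
      · exact h₂₃
  · push Not at hz
    have hPA : seg p 0 k ⊂ A := by
      refine ⟨?_, fun hle => ?_⟩
      · rintro _ ⟨i, -, hi, rfl⟩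
        exact hpA i hi
      · obtain ⟨a, ha, haz⟩ := ha₃
        obtain ⟨i, -, hi, rfl⟩ := hle ha
        exact hz i hi haz.symm
    obtain ⟨v₃, hv₃, hvz₃, hpr₃⟩ := hp₃ _ hPA (hp.connSet (Nat.zero_le _) le_rfl)
      (hp0 ▸ mem_seg le_rfl (Nat.zero_le _)) (hpk ▸ mem_seg (Nat.zero_le _) le_rfl)
    obtain ⟨w, hw, hwP⟩ := (hA.2 v₃ hv₃.1 v₁ hv₁).exists_touch hv₃.2
      (.inl (hp0 ▸ mem_seg le_rfl (Nat.zero_le _)))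
    obtain ⟨m, r, hr, hrA, hr0, hrm, hrX, -⟩ := exists_path hw.symm (X := Att G (seg p 0 k))
      (Y := (· = v₃)) hwP rfl
    obtain ⟨_, ⟨i, -, hi, rfl⟩, hpr⟩ := hr0
    have hrp : ∀ j, j ≤ m → ∀ l, l ≤ k → p l ≠ r j := fun j hj l hl h =>
      (hrA j hj).2 (h ▸ mem_seg (Nat.zero_le _) hl)
    obtain ⟨c, a, b, hc⟩ := exists_center hG hp (hrp 0 (by omega)) hi hpr.symm
    have hbk := hc.le_len
    have hab := hc.le
    have hpR : ∀ i, i ≤ k → ∀ j, j ≤ m → p i ≠ c → r j ≠ c → p i ≠ r j ∧ ¬ G.Adj (p i) (r j) := by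
      intro i hi j hj hic hjc
      refine ⟨hrp j hj i hi, fun hadj => ?_⟩
      have := hrX j hj ⟨_, mem_seg (Nat.zero_le _) hi, hadj⟩
      subst this
      rcases hc.eq_of_adj hi hadj.symm with h | h
      exacts [hjc h, hic h]
    have hpz : ∀ i, i ≤ k → p i ≠ z₃ ∧ ¬ G.Adj (p i) z₃ := fun i hi =>
      ⟨fun h => hz₃ (h ▸ hpA i hi), fun h => hz i hi h.symm⟩
    refine ⟨c, seg p 0 a ∪ {z₁}, seg p b k ∪ {z₂}, seg r 0 m ∪ {z₃}, ?_, hsub (by omega),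
      hsub le_rfl, ?_, .inr rfl, .inr rfl, .inr rfl, hleg₁ hc, hleg₂ hc, ?_, hanti hc, ?_, ?_⟩
    · rcases hcA hc with h | h
      · exact .inl (h ▸ (hrA 0 (by omega)).1)
      · exact .inl h
    · rintro _ (⟨j, -, hj, rfl⟩ | rfl)
      exacts [.inr (hrA j hj).1, .inl rfl]
    · have h1 : Conn G (seg r 0 m ∪ {z₃} ∪ {c}) c (r 0) :=
        hc.conn_stem (.inl (.inl (mem_seg le_rfl (Nat.zero_le _)))) (.inr rfl)
      have h2 : Conn G (seg r 0 m ∪ {z₃} ∪ {c}) (r 0) (r m) :=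
        (hr.conn le_rfl (Nat.zero_le _) (Nat.zero_le _) (Nat.zero_le _) le_rfl).mono
          (Set.subset_union_left.trans Set.subset_union_left)
      exact (h1.trans h2).trans (.of_adj h2.right_mem (.inl (.inr rfl)) (hrm ▸ hvz₃))
    · rintro _ (⟨i, -, hi, rfl⟩ | rfl) _ (⟨j, -, hj, rfl⟩ | rfl) hic hjc
      · exact hpR i (by omega) j hj hic hjc
      · exact hpz i (by omega)
      · refine ⟨fun h => hz₁ (h ▸ (hrA j hj).1), fun hadj => (hrA j hj).2 ?_⟩
        rw [hp₁ _ (hrA j hj).1 hadj.symm, ← hp0]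
        exact mem_seg le_rfl (Nat.zero_le _)
      · exact h₁₃
    · rintro _ (⟨i, -, hi, rfl⟩ | rfl) _ (⟨j, -, hj, rfl⟩ | rfl) hic hjc
      · exact hpR i (by omega) j hj hic hjc
      · exact hpz i (by omega)
      · refine ⟨fun h => hz₂ (h ▸ (hrA j hj).1), fun hadj => (hrA j hj).2 ?_⟩
        rw [hp₂ _ (hrA j hj).1 hadj.symm, ← hpk]
        exact mem_seg (Nat.zero_le _) le_rfl
      · exact h₂₃

/-- In a triangle-free graph, any three pairwise non-adjacent vertices with neighbours in a
connected set `A` are the ends of a tripod. -/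
theorem exists_tripod [Finite V] (hG : NoTriangle G) {A : Set V} (hA : ConnSet G A) {z : Fin 3 → V}
    (hz : ∀ j, z j ∉ A) (hzz : ∀ i j, i ≠ j → z i ≠ z j ∧ ¬ G.Adj (z i) (z j))
    (hatt : ∀ j, Att G A (z j)) : ∃ c T, Tripod G A z c T := by
  classical
  obtain ⟨A', hA'⟩ := (Set.toFinite {Q : Set V | Q ⊆ A ∧ ConnSet G Q ∧
    ∀ j, Att G Q (z j)}).exists_minimal ⟨A, subset_rfl, hA, hatt⟩
  obtain ⟨⟨hsub, hconn, hatt'⟩, hmin⟩ := hA'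
  suffices ∃ c T, Tripod G A' z c T by
    obtain ⟨c, T, h⟩ := this
    exact ⟨c, T, h.center.imp_left (fun h => hsub h), fun j => (h.sub j).trans
      (Set.insert_subset_insert hsub), h.mem, h.conn, h.anti⟩
  replace hz : ∀ j, z j ∉ A' := fun j h => hz j (hsub h)
  -- Otherwise `A' \ {v}` would still be connected and attached to every `z j`, against the
  -- minimality of `A'`.
  have hpriv : ∀ v ∈ A', ConnSet G (A' \ {v}) →
      ∃ j, G.Adj v (z j) ∧ ∀ a ∈ A', G.Adj a (z j) → a = v := by
    intro v hv hc
    by_contra! hcon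
    have := hmin (y := A' \ {v}) ⟨Set.sdiff_subset.trans hsub, hc, fun j => ?_⟩ Set.sdiff_subset
    · exact (this hv).2 rfl
    · obtain ⟨a, ha, haz⟩ := hatt' j
      by_cases hav : a = v
      · obtain ⟨b, hb, hbz, hbv⟩ := hcon j (hav ▸ haz)
        exact ⟨b, ⟨hb, hbv⟩, hbz⟩
      · exact ⟨a, ⟨ha, hav⟩, haz⟩
  obtain ⟨v, hv⟩ := hconn.1
  by_cases hsing : A' = {v}
  · have hvz : ∀ j, G.Adj v (z j) := fun j => by
      obtain ⟨a, ha, haz⟩ := hatt' j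
      rw [hsing] at ha
      exact ha ▸ haz
    refine ⟨v, fun j => {z j}, .inl hv, ?_, fun j => rfl, fun j => ?_, ?_⟩
    · rintro j _ rfl
      exact .inl rfl
    · exact .of_adj (.inr rfl) (.inl rfl) (hvz j)
    · rintro i j hij _ rfl _ rfl - -
      exact hzz i j hij
  have hss : ∀ u ∈ A', ({u} : Set V) ⊂ A' := by
    intro u hu
    refine ⟨Set.singleton_subset_iff.2 hu, fun hle => hsing ?_⟩
    have : v = u := hle hv
    subst this
    exact hle.antisymm (Set.singleton_subset_iff.2 hu)
  obtain ⟨v₁, hv₁, hc₁⟩ := hconn.exists_diff (.singleton v) (hss v hv)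
  obtain ⟨v₂, hv₂, hc₂⟩ := hconn.exists_diff (.singleton v₁) (hss v₁ hv₁.1)
  obtain ⟨j₁, hj₁, hp₁⟩ := hpriv v₁ hv₁.1 hc₁
  obtain ⟨j₂, hj₂, hp₂⟩ := hpriv v₂ hv₂.1 hc₂
  have hj₁₂ : j₁ ≠ j₂ := by
    rintro rfl
    exact hv₂.2 (hp₁ v₂ hv₂.1 hj₂)
  obtain ⟨j₃, hj₃₁, hj₃₂, hall⟩ : ∃ j₃ : Fin 3, j₃ ≠ j₁ ∧ j₃ ≠ j₂ ∧
      ∀ j, j = j₁ ∨ j = j₂ ∨ j = j₃ := by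
    have : ∀ a b : Fin 3, a ≠ b → ∃ c, c ≠ a ∧ c ≠ b ∧ ∀ j, j = a ∨ j = b ∨ j = c := by decide
    exact this _ _ hj₁₂
  obtain ⟨c, T₁, T₂, T₃, hc, hT₁, hT₂, hT₃, hm₁, hm₂, hm₃, hl₁, hl₂, hl₃, h₁₂, h₁₃, h₂₃⟩ :=
    tripod_of_private hG hconn (hz j₁) (hz j₂) (hz j₃) (hzz _ _ hj₁₂) (hzz _ _ hj₃₁.symm)
      (hzz _ _ hj₃₂.symm) hv₁.1 hv₂.1 hj₁ hj₂ (hatt' j₃) hp₁ hp₂ (by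
        -- A removable vertex outside `P` is the only neighbour of some `z j`. This cannot be `z j₁`
        -- or `z j₂`, whose only neighbours lie in `P`.
        intro P hP hPc h1 h2
        obtain ⟨v₃, hv₃, hc₃⟩ := hconn.exists_diff hPc hP
        obtain ⟨j, hj, hp⟩ := hpriv v₃ hv₃.1 hc₃
        rcases hall j with rfl | rfl | rfl
        · exact absurd (hp₁ v₃ hv₃.1 hj ▸ h1) hv₃.2
        · exact absurd (hp₂ v₃ hv₃.1 hj ▸ h2) hv₃.2
        · exact ⟨v₃, hv₃, hj, hp⟩)
  let T : Fin 3 → Set V := fun j => if j = j₁ then T₁ else if j = j₂ then T₂ else T₃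
  have e₁ : T j₁ = T₁ := by simp [T]
  have e₂ : T j₂ = T₂ := by simp [T, hj₁₂.symm]
  have e₃ : T j₃ = T₃ := by simp [T, hj₃₁, hj₃₂]
  refine ⟨c, T, hc.imp_right fun h => ⟨j₃, h⟩, ?_, ?_, ?_, ?_⟩
  · intro j
    rcases hall j with rfl | rfl | rfl
    exacts [e₁ ▸ hT₁, e₂ ▸ hT₂, e₃ ▸ hT₃]
  · intro j
    rcases hall j with rfl | rfl | rfl
    exacts [e₁ ▸ hm₁, e₂ ▸ hm₂, e₃ ▸ hm₃]
  · intro j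
    rcases hall j with rfl | rfl | rfl
    exacts [e₁ ▸ hl₁, e₂ ▸ hl₂, e₃ ▸ hl₃]
  · intro i j hij
    rcases hall i with rfl | rfl | rfl <;> rcases hall j with rfl | rfl | rfl <;>
      first | exact absurd rfl hij | skip
    · rw [e₁, e₂]; exact h₁₂
    · rw [e₁, e₃]; exact h₁₃
    · rw [e₁, e₂]; exact h₁₂.symm
    · rw [e₂, e₃]; exact h₂₃
    · rw [e₁, e₃]; exact h₁₃.symm
    · rw [e₂, e₃]; exact h₂₃.symm

/-! ### Paths with a middle set, and tripods facing each other. -/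

/-- An induced path `t 0, …, t n` outside of `A₁ ∪ A₂ ∪ A₃` both of whose ends have neighbours in
`A₃`, while `A₁` is attached exactly to `t 0` and `A₂` exactly to `t n`. -/
structure Mid (G : SimpleGraph V) (A₁ A₂ A₃ : Set V) (n : ℕ) (t : ℕ → V) : Prop where
  path : IPath G n t
  not_mem₁ : ∀ l, l ≤ n → t l ∉ A₁
  not_mem₂ : ∀ l, l ≤ n → t l ∉ A₂
  not_mem₃ : ∀ l, l ≤ n → t l ∉ A₃
  eq₁ : ∀ l, l ≤ n → Att G A₁ (t l) → l = 0
  eq₂ : ∀ l, l ≤ n → Att G A₂ (t l) → l = n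
  att₁ : Att G A₁ (t 0)
  att₂ : Att G A₂ (t n)
  att₃ : Att G A₃ (t 0)
  att₃' : Att G A₃ (t n)

lemma Mid.reverse {A₁ A₂ A₃ : Set V} {n : ℕ} {t : ℕ → V} (h : Mid G A₁ A₂ A₃ n t) :
    Mid G A₂ A₁ A₃ n (fun i => t (n - i)) where
  path := h.path.reverse
  not_mem₁ l _ := h.not_mem₂ _ (by omega)
  not_mem₂ l _ := h.not_mem₁ _ (by omega)
  not_mem₃ l _ := h.not_mem₃ _ (by omega)
  eq₁ l hl ha := by have := h.eq₂ _ (by omega) ha; omega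
  eq₂ l hl ha := by have := h.eq₁ _ (by omega) ha; omega
  att₁ := by simpa using h.att₂
  att₂ := by simpa using h.att₁
  att₃ := by simpa using h.att₃'
  att₃' := by simpa using h.att₃

/-- Three connected sets without edges between them. -/
structure Tri (G : SimpleGraph V) (A₁ A₂ A₃ : Set V) : Prop where
  conn₁ : ConnSet G A₁
  conn₂ : ConnSet G A₂
  conn₃ : ConnSet G A₃
  anti₁₂ : Anti G ∅ A₁ A₂
  anti₁₃ : Anti G ∅ A₁ A₃
  anti₂₃ : Anti G ∅ A₂ A₃

namespace Tri

variable {A₁ A₂ A₃ : Set V}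

lemma swap₁₂ (h : Tri G A₁ A₂ A₃) : Tri G A₂ A₁ A₃ :=
  ⟨h.conn₂, h.conn₁, h.conn₃, h.anti₁₂.symm, h.anti₂₃, h.anti₁₃⟩

lemma swap₂₃ (h : Tri G A₁ A₂ A₃) : Tri G A₁ A₃ A₂ :=
  ⟨h.conn₁, h.conn₃, h.conn₂, h.anti₁₃, h.anti₁₂, h.anti₂₃.symm⟩

end Tri

lemma Anti.apply {S T : Set V} (h : Anti G ∅ S T) {a b : V} (ha : a ∈ S) (hb : b ∈ T) :
    a ≠ b ∧ ¬ G.Adj a b := h a ha b hb (fun h => h) (fun h => h)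

lemma Anti.off {S T X : Set V} (h : Anti G ∅ S T) : Anti G X S T := h.mono_off (Set.empty_subset _)

/-- The centers of two tripods joined by three paths coincide or are adjacent. -/
theorem tripod_centers_close {A₁ A₂ : Set V} (hA : Anti G ∅ A₁ A₂) {n : Fin 3 → ℕ}
    {b : Fin 3 → ℕ → V} (hb : ∀ j, IPath G (n j) (b j))
    (hbb : ∀ i j, i ≠ j → Anti G ∅ (seg (b i) 0 (n i)) (seg (b j) 0 (n j)))
    (h1 : ∀ j l, l ≤ n j → b j l ∉ A₁) (h2 : ∀ j l, l ≤ n j → b j l ∉ A₂)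
    (ha1 : ∀ j l, l ≤ n j → Att G A₁ (b j l) → l = 0)
    (ha2 : ∀ j l, l ≤ n j → Att G A₂ (b j l) → l = n j)
    {p q : V} {T₁ T₂ : Fin 3 → Set V} (hp : Tripod G A₁ (fun j => b j 0) p T₁)
    (hq : Tripod G A₂ (fun j => b j (n j)) q T₂) (hth : ¬ G.ContainsInducedTheta) :
    p = q ∨ G.Adj p q := by
  by_contra! hcon
  -- Route `j` follows a leg of the first tripod, then `b j`, then a leg of the second tripod. The
  -- legs are intersected with `A₁` and `A₂` because their only other possible vertices are the ends
  -- of `b j`, already counted in the middle piece.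
  refine hth (theta_of_conn hcon.1 hcon.2
    (K := fun j => {p, q} ∪ (T₁ j ∩ A₁) ∪ seg (b j) 0 (n j) ∪ (T₂ j ∩ A₂)) ?_ ?_)
  · intro j
    have hl : T₁ j ∪ {p} ⊆ {p, q} ∪ (T₁ j ∩ A₁) ∪ seg (b j) 0 (n j) ∪ (T₂ j ∩ A₂) := by
      rintro v (hv | rfl)
      · rcases hp.sub j hv with h | h
        · exact .inl (.inr (h ▸ mem_seg le_rfl (Nat.zero_le _)))
        · exact .inl (.inl (.inr ⟨hv, h⟩))
      · exact .inl (.inl (.inl (.inl rfl)))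
    have hr : T₂ j ∪ {q} ⊆ {p, q} ∪ (T₁ j ∩ A₁) ∪ seg (b j) 0 (n j) ∪ (T₂ j ∩ A₂) := by
      rintro v (hv | rfl)
      · rcases hq.sub j hv with h | h
        · exact .inl (.inr (h ▸ mem_seg (Nat.zero_le _) le_rfl))
        · exact .inr ⟨hv, h⟩
      · exact .inl (.inl (.inl (.inr rfl)))
    exact ((hp.conn j).mono hl).trans ((((hb j).conn le_rfl (Nat.zero_le _) (Nat.zero_le _)
      (Nat.zero_le _) le_rfl).mono (Set.subset_union_right.trans Set.subset_union_left)).trans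
      ((hq.conn j).mono hr).symm)
  · have hp' : ∀ i j, i ≠ j → Anti G {p, q} (T₁ i ∩ A₁) (T₁ j ∩ A₁) := fun i j hij =>
      ((hp.anti i j hij).mono Set.inter_subset_left Set.inter_subset_left).mono_off (by simp)
    have hq' : ∀ i j, i ≠ j → Anti G {p, q} (T₂ i ∩ A₂) (T₂ j ∩ A₂) := fun i j hij =>
      ((hq.anti i j hij).mono Set.inter_subset_left Set.inter_subset_left).mono_off (by simp)
    have hpq : ∀ i j, Anti G {p, q} (T₁ i ∩ A₁) (T₂ j ∩ A₂) := fun i j =>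
      hA.off.mono Set.inter_subset_right Set.inter_subset_right
    have hpb : ∀ i j, i ≠ j → Anti G {p, q} (T₁ i ∩ A₁) (seg (b j) 0 (n j)) := by
      rintro i j hij u ⟨hu, huA⟩ _ ⟨l, -, hl, rfl⟩ hu' hl'
      refine ⟨fun h => h1 j l hl (h ▸ huA), fun hadj => ?_⟩
      have := ha1 j l hl ⟨u, huA, hadj⟩
      subst this
      exact (hp.anti i j hij u hu _ (hp.mem j) (fun h => hu' (.inl h)) (fun h => hl' (.inl h))).2
        hadj
    have hqb : ∀ i j, i ≠ j → Anti G {p, q} (T₂ i ∩ A₂) (seg (b j) 0 (n j)) := by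
      rintro i j hij u ⟨hu, huA⟩ _ ⟨l, -, hl, rfl⟩ hu' hl'
      refine ⟨fun h => h2 j l hl (h ▸ huA), fun hadj => ?_⟩
      have := ha2 j l hl ⟨u, huA, hadj⟩
      subst this
      exact (hq.anti i j hij u hu _ (hq.mem j) (fun h => hu' (.inr h)) (fun h => hl' (.inr h))).2
        hadj
    intro i j hij
    refine .union_left (.union_left (.union_left (.left_subset subset_rfl) ?_) ?_) ?_ <;>
      refine .union_right (.union_right (.union_right (.right_subset subset_rfl) ?_) ?_) ?_
    exacts [hp' i j hij, hpb i j hij, hpq i j, (hpb j i hij.symm).symm, (hbb i j hij).off,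
      (hqb j i hij.symm).symm, (hpq j i).symm, hqb i j hij, hq' i j hij]

/-! ### Two paths with the same middle set: links and hubs. -/

/-- Two vertices `d` and `e`, equal or adjacent, such that `d` is a vertex of the path `x` or a
vertex of `A` with several neighbours on `x`, and `e` is similarly related to the path `y`. -/
structure Link (G : SimpleGraph V) (A : Set V) (n : ℕ) (x : ℕ → V) (m : ℕ) (y : ℕ → V) (d e : V)
    (a b a' b' : ℕ) : Prop where
  le : a ≤ b
  le_len : b ≤ n
  le' : a' ≤ b'
  le_len' : b' ≤ m
  left : (d ∈ A ∧ a + 2 ≤ b ∧ G.Adj d (x a) ∧ G.Adj d (x b)) ∨ (d = x a ∧ a = b)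
  right : (e ∈ A ∧ a' + 2 ≤ b' ∧ G.Adj e (y a') ∧ G.Adj e (y b')) ∨ (e = y a' ∧ a' = b')
  close : d = e ∨ G.Adj d e
  mem : d ∈ A ∨ e ∈ A
  left_nadj : d ∈ A → e ∈ A → d ≠ e → ∀ l, l ≤ m → ¬ G.Adj d (y l)
  right_nadj : d ∈ A → e ∈ A → d ≠ e → ∀ l, l ≤ n → ¬ G.Adj e (x l)

namespace Link

variable {A : Set V} {n m : ℕ} {x y : ℕ → V} {d e : V} {a b a' b' : ℕ}

lemma symm (h : Link G A n x m y d e a b a' b') : Link G A m y n x e d a' b' a b where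
  le := h.le'
  le_len := h.le_len'
  le' := h.le
  le_len' := h.le_len
  left := h.right
  right := h.left
  close := h.close.imp Eq.symm Adj.symm
  mem := h.mem.symm
  left_nadj h1 h2 h3 := h.right_nadj h2 h1 h3.symm
  right_nadj h1 h2 h3 := h.left_nadj h2 h1 h3.symm

lemma reverse (h : Link G A n x m y d e a b a' b') :
    Link G A n (fun i => x (n - i)) m (fun i => y (m - i)) d e (n - b) (n - a) (m - b')
      (m - a') where
  le := by have := h.le; omega
  le_len := by omega
  le' := by have := h.le'; omega
  le_len' := by omega
  left := by
    have h1 := h.le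
    have h2 := h.le_len
    rw [Nat.sub_sub_self h2, Nat.sub_sub_self (h1.trans h2)]
    rcases h.left with ⟨h3, h4, h5, h6⟩ | ⟨h3, h4⟩
    · exact .inl ⟨h3, by omega, h6, h5⟩
    · exact .inr ⟨h4 ▸ h3, by omega⟩
  right := by
    have h1 := h.le'
    have h2 := h.le_len'
    rw [Nat.sub_sub_self h2, Nat.sub_sub_self (h1.trans h2)]
    rcases h.right with ⟨h3, h4, h5, h6⟩ | ⟨h3, h4⟩
    · exact .inl ⟨h3, by omega, h6, h5⟩
    · exact .inr ⟨h4 ▸ h3, by omega⟩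
  close := h.close
  mem := h.mem
  left_nadj h1 h2 h3 _ _ := h.left_nadj h1 h2 h3 _ (by omega)
  right_nadj h1 h2 h3 _ _ := h.right_nadj h1 h2 h3 _ (by omega)

end Link

/-- Joining two paths through a set `A` attached to `x 0` and `y 0`. -/
lemma conn_through {A K : Set V} (hA : ConnSet G A) {u v : V} (hu : Att G A u) (hv : Att G A v)
    (huK : u ∈ K) (hvK : v ∈ K) (hAK : A ⊆ K) : Conn G K u v := by
  obtain ⟨s, hs, hsu⟩ := hu
  obtain ⟨t, ht, htv⟩ := hv
  exact (Conn.of_adj huK (hAK hs) hsu.symm).trans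
    (((hA.2 s hs t ht).mono hAK).trans (.of_adj (hAK ht) hvK htv))

/-- Let `f` be a shortest path of `A₃` from the neighbourhood of `x` to that of `y`, with centers
`d` on `x` and `e` on `y`. These are joined by three routes: along `f`, and along the outer parts of
`x` and `y` through `A₁` and through `A₂`. Without a theta they are equal or adjacent, and since `x`
and `y` are anticomplete, one of them lies in `A₃`. -/
theorem exists_link (hG : NoTriangle G) (hth : ¬ G.ContainsInducedTheta) {A₁ A₂ A₃ : Set V}
    (hA : Tri G A₁ A₂ A₃) {n m : ℕ} {x y : ℕ → V} (hx : Mid G A₁ A₂ A₃ n x)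
    (hy : Mid G A₁ A₂ A₃ m y) (hxy : Anti G ∅ (seg x 0 n) (seg y 0 m)) :
    ∃ d e a b a' b', Link G A₃ n x m y d e a b a' b' := by
  obtain ⟨s, hs, hsx⟩ := hx.att₃
  obtain ⟨t, ht, hty⟩ := hy.att₃
  obtain ⟨h, f, hf, hfA, hf0, hfh, hfX, hfY⟩ := exists_path (hA.conn₃.2 s hs t ht)
    (X := fun v => ∃ l, l ≤ n ∧ G.Adj v (x l)) (Y := fun v => ∃ l, l ≤ m ∧ G.Adj v (y l))
    ⟨0, Nat.zero_le _, hsx⟩ ⟨0, Nat.zero_le _, hty⟩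
  obtain ⟨i, hi, hfi⟩ := hf0
  obtain ⟨j, hj, hfj⟩ := hfh
  have hxA : ∀ l, l ≤ n → ∀ k, k ≤ h → x l ≠ f k := fun l hl k hk h =>
    hx.not_mem₃ l hl (h ▸ hfA k hk)
  have hyA : ∀ l, l ≤ m → ∀ k, k ≤ h → y l ≠ f k := fun l hl k hk h =>
    hy.not_mem₃ l hl (h ▸ hfA k hk)
  obtain ⟨d, a, b, hd⟩ := exists_center hG hx.path (fun l hl => hxA l hl 0 (Nat.zero_le _)) hi hfi
  obtain ⟨e, a', b', he⟩ := exists_center hG hy.path (fun l hl => hyA l hl h le_rfl) hj hfj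
  have hab := hd.le
  have hbn := hd.le_len
  have hab' := he.le
  have hbm := he.le_len
  have hxy' : ∀ k, k ≤ n → ∀ l, l ≤ m → x k ≠ y l ∧ ¬ G.Adj (x k) (y l) := fun k hk l hl =>
    hxy.apply (mem_seg (Nat.zero_le _) hk) (mem_seg (Nat.zero_le _) hl)
  have hclose : d = e ∨ G.Adj d e := by
    by_contra! hcon
    refine hth (theta_of_conn₃ hcon.1 hcon.2
      (K₁ := {d, e} ∪ seg x 0 a ∪ A₁ ∪ seg y 0 a') (K₂ := {d, e} ∪ seg x b n ∪ A₂ ∪ seg y b' m)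
      (K₃ := {d, e} ∪ seg f 0 h) ?_ ?_ ?_ ?_ ?_ ?_)
    · refine (hd.left.mono ?_).trans (Conn.trans ?_ (he.left.mono ?_).symm)
      · rintro v (hv | rfl)
        exacts [.inl (.inl (.inr hv)), .inl (.inl (.inl (.inl rfl)))]
      · exact conn_through hA.conn₁ hx.att₁ hy.att₁
          (.inl (.inl (.inr (mem_seg le_rfl (Nat.zero_le _)))))
          (.inr (mem_seg le_rfl (Nat.zero_le _))) (fun v hv => .inl (.inr hv))
      · rintro v (hv | rfl)
        exacts [.inr hv, .inl (.inl (.inl (.inr rfl)))]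
    · refine (hd.right.mono ?_).trans (Conn.trans ?_ (he.right.mono ?_).symm)
      · rintro v (hv | rfl)
        exacts [.inl (.inl (.inr hv)), .inl (.inl (.inl (.inl rfl)))]
      · exact conn_through hA.conn₂ hx.att₂ hy.att₂
          (.inl (.inl (.inr (mem_seg hbn le_rfl))))
          (.inr (mem_seg hbm le_rfl)) (fun v hv => .inl (.inr hv))
      · rintro v (hv | rfl)
        exacts [.inr hv, .inl (.inl (.inl (.inr rfl)))]
    · have h0 : f 0 ∈ {d, e} ∪ seg f 0 h := .inr (mem_seg le_rfl (Nat.zero_le _))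
      have h1 : f h ∈ {d, e} ∪ seg f 0 h := .inr (mem_seg (Nat.zero_le _) le_rfl)
      exact (hd.conn_stem h0 (.inl (.inl rfl))).trans (((hf.conn le_rfl (Nat.zero_le _)
        (Nat.zero_le _) (Nat.zero_le _) le_rfl).mono Set.subset_union_right).trans
        (he.conn_stem h1 (.inl (.inr rfl))).symm)
    · refine .union_left (.union_left (.union_left (.left_subset subset_rfl) ?_) ?_) ?_ <;>
        refine .union_right (.union_right (.union_right (.right_subset subset_rfl) ?_) ?_) ?_
      · rintro _ ⟨k, -, hk, rfl⟩ _ ⟨l, hl, hl', rfl⟩ h1 h2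
        exact hd.anti' hk hl hl' (fun h => h1 (.inl h)) (fun h => h2 (.inl h))
      · rintro _ ⟨k, -, hk, rfl⟩ v hv h1 h2
        refine ⟨fun h => hx.not_mem₂ k (by omega) (h ▸ hv), fun hadj => ?_⟩
        have := hx.eq₂ k (by omega) ⟨v, hv, hadj.symm⟩
        rcases hd.cases with h3 | h3
        · omega
        · exact h1 (.inl (by rw [h3.1, show k = a by omega]))
      · rintro _ ⟨k, -, hk, rfl⟩ _ ⟨l, hl, hl', rfl⟩ h1 h2
        exact hxy' k (by omega) l hl'
      · rintro v hv _ ⟨k, hk, hk', rfl⟩ h1 h2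
        refine ⟨fun h => hx.not_mem₁ k (by omega) (h ▸ hv), fun hadj => ?_⟩
        have := hx.eq₁ k (by omega) ⟨v, hv, hadj⟩
        rcases hd.cases with h3 | h3
        · omega
        · exact h2 (.inl (by rw [h3.1, show k = a by omega]))
      · exact hA.anti₁₂.off
      · rintro v hv _ ⟨k, hk, hk', rfl⟩ h1 h2
        refine ⟨fun h => hy.not_mem₁ k (by omega) (h ▸ hv), fun hadj => ?_⟩
        have := hy.eq₁ k (by omega) ⟨v, hv, hadj⟩
        rcases he.cases with h3 | h3
        · omega
        · exact h2 (.inr (by rw [h3.1, show k = a' by omega]; rfl))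
      · rintro _ ⟨k, -, hk, rfl⟩ _ ⟨l, hl, hl', rfl⟩ h1 h2
        have := hxy' l hl' k (by omega)
        exact ⟨this.1.symm, fun h => this.2 h.symm⟩
      · rintro _ ⟨k, -, hk, rfl⟩ v hv h1 h2
        refine ⟨fun h => hy.not_mem₂ k (by omega) (h ▸ hv), fun hadj => ?_⟩
        have := hy.eq₂ k (by omega) ⟨v, hv, hadj.symm⟩
        rcases he.cases with h3 | h3
        · omega
        · exact h1 (.inr (by rw [h3.1, show k = a' by omega]; rfl))
      · rintro _ ⟨k, -, hk, rfl⟩ _ ⟨l, hl, hl', rfl⟩ h1 h2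
        exact he.anti' hk hl hl' (fun h => h1 (.inr h)) (fun h => h2 (.inr h))
    all_goals
      have hxf : ∀ {r s}, s ≤ n → Anti G {d, e} (seg x r s) (seg f 0 h) := by
        rintro r s hs _ ⟨k, -, hk, rfl⟩ _ ⟨l, -, hl, rfl⟩ h1 h2
        refine ⟨hxA k (by omega) l hl, fun hadj => ?_⟩
        have := hfX l hl ⟨k, by omega, hadj.symm⟩
        subst this
        rcases hd.eq_of_adj (by omega) hadj.symm with h3 | h3
        exacts [h2 (.inl h3), h1 (.inl h3)]
      have hyf : ∀ {r s}, s ≤ m → Anti G {d, e} (seg y r s) (seg f 0 h) := by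
        rintro r s hs _ ⟨k, -, hk, rfl⟩ _ ⟨l, -, hl, rfl⟩ h1 h2
        refine ⟨hyA k (by omega) l hl, fun hadj => ?_⟩
        have := hfY l hl ⟨k, by omega, hadj.symm⟩
        subst this
        rcases he.eq_of_adj (by omega) hadj.symm with h3 | h3
        exacts [h2 (.inr h3), h1 (.inr h3)]
      have hfs : seg f 0 h ⊆ A₃ := by
        rintro _ ⟨k, -, hk, rfl⟩
        exact hfA k hk
      refine .union_right (.right_subset subset_rfl) (.union_left (.union_left (.union_left
        (.left_subset subset_rfl) ?_) ?_) ?_)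
    · exact hxf (hab.trans hbn)
    · exact hA.anti₁₃.off.mono subset_rfl hfs
    · exact hyf (hab'.trans hbm)
    · exact hxf le_rfl
    · exact hA.anti₂₃.off.mono subset_rfl hfs
    · exact hyf le_rfl
  have hdl : (d ∈ A₃ ∧ a + 2 ≤ b ∧ G.Adj d (x a) ∧ G.Adj d (x b)) ∨ (d = x a ∧ a = b) := by
    rcases hd.cases with ⟨rfl, h1⟩ | h1
    · exact .inl ⟨hfA 0 (Nat.zero_le _), h1, hd.adj_left, hd.adj_right⟩
    · exact .inr h1
  have her : (e ∈ A₃ ∧ a' + 2 ≤ b' ∧ G.Adj e (y a') ∧ G.Adj e (y b')) ∨ (e = y a' ∧ a' = b') := by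
    rcases he.cases with ⟨rfl, h1⟩ | h1
    · exact .inl ⟨hfA h le_rfl, h1, he.adj_left, he.adj_right⟩
    · exact .inr h1
  have hd' : d ∈ A₃ → d = f 0 := fun h1 => by
    rcases hd.cases with h2 | h2
    · exact h2.1
    · exact absurd (h2.1 ▸ h1) (hx.not_mem₃ a (by omega))
  have he' : e ∈ A₃ → e = f h := fun h1 => by
    rcases he.cases with h2 | h2
    · exact h2.1
    · exact absurd (h2.1 ▸ h1) (hy.not_mem₃ a' (by omega))
  refine ⟨d, e, a, b, a', b', hab, hbn, hab', hbm, hdl, her, hclose, ?_, ?_, ?_⟩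
  · rcases hdl with h1 | h1
    · exact .inl h1.1
    rcases her with h2 | h2
    · exact .inr h2.1
    rw [h1.1, h2.1] at hclose
    have := hxy' a (by omega) a' (by omega)
    exact absurd hclose (by simp [this])
  -- When both lie in `A₃`, `d` and `e` are the first and last vertices of `f`. By minimality of `f`
  -- only the last vertex has neighbours on `y`, and only the first has neighbours on `x`.
  · intro h1 h2 h3 l hl hadj
    rw [hd' h1] at hadj
    have := hfY 0 (Nat.zero_le _) ⟨l, hl, hadj⟩
    exact h3 ((hd' h1).trans (this ▸ (he' h2).symm))
  · intro h1 h2 h3 l hl hadj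
    rw [he' h2] at hadj
    have := hfX h le_rfl ⟨l, hl, hadj⟩
    exact h3 ((hd' h1).trans (this ▸ (he' h2).symm))

/-- Two vertices `p` and `q`, equal or adjacent, from which the ends of the paths `x` and `y` can be
reached independently inside `A₁` and `A₂` respectively. -/
structure Hub (G : SimpleGraph V) (A₁ A₂ A₃ : Set V) (n : ℕ) (x : ℕ → V) (m : ℕ) (y : ℕ → V)
    (p q : V) (X₁ Y₁ X₂ Y₂ : Set V) : Prop where
  subx₁ : X₁ ⊆ insert (x 0) A₁
  suby₁ : Y₁ ⊆ insert (y 0) A₁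
  subx₂ : X₂ ⊆ insert (x n) A₂
  suby₂ : Y₂ ⊆ insert (y m) A₂
  memx₁ : x 0 ∈ X₁
  memy₁ : y 0 ∈ Y₁
  memx₂ : x n ∈ X₂
  memy₂ : y m ∈ Y₂
  connx₁ : Conn G (X₁ ∪ {p}) p (x 0)
  conny₁ : Conn G (Y₁ ∪ {p}) p (y 0)
  connx₂ : Conn G (X₂ ∪ {q}) q (x n)
  conny₂ : Conn G (Y₂ ∪ {q}) q (y m)
  anti₁ : Anti G {p, q} X₁ Y₁
  anti₂ : Anti G {p, q} X₂ Y₂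
  not_mem₁ : p ∉ A₃ ∧ ¬ Att G A₃ p
  not_mem₂ : q ∉ A₃ ∧ ¬ Att G A₃ q
  cases : p = q ∨
    (G.Adj p q ∧ ∀ v ∈ seg x 0 n ∪ seg y 0 m ∪ X₁ ∪ Y₁, v ≠ p → q ≠ v ∧ ¬ G.Adj q v) ∨
    (G.Adj p q ∧ ∀ v ∈ seg x 0 n ∪ seg y 0 m ∪ X₂ ∪ Y₂, v ≠ q → p ≠ v ∧ ¬ G.Adj p v)

namespace Hub

variable {A₁ A₂ A₃ : Set V} {n m : ℕ} {x y : ℕ → V} {p q d e : V} {X₁ Y₁ X₂ Y₂ : Set V}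
  {a b a' b' : ℕ}

lemma symm (h : Hub G A₁ A₂ A₃ n x m y p q X₁ Y₁ X₂ Y₂) :
    Hub G A₁ A₂ A₃ m y n x p q Y₁ X₁ Y₂ X₂ where
  subx₁ := h.suby₁
  suby₁ := h.subx₁
  subx₂ := h.suby₂
  suby₂ := h.subx₂
  memx₁ := h.memy₁
  memy₁ := h.memx₁
  memx₂ := h.memy₂
  memy₂ := h.memx₂
  connx₁ := h.conny₁
  conny₁ := h.connx₁
  connx₂ := h.conny₂
  conny₂ := h.connx₂
  anti₁ := h.anti₁.symm
  anti₂ := h.anti₂.symm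
  not_mem₁ := h.not_mem₁
  not_mem₂ := h.not_mem₂
  cases := by
    have key : ∀ S T U W : Set V, S ∪ T ∪ U ∪ W = T ∪ S ∪ W ∪ U := fun S T U W => by
      rw [Set.union_comm S T, Set.union_right_comm]
    rw [key, key _ _ Y₂]
    exact h.cases

lemma reverse (h : Hub G A₁ A₂ A₃ n x m y p q X₁ Y₁ X₂ Y₂) :
    Hub G A₂ A₁ A₃ n (fun i => x (n - i)) m (fun i => y (m - i)) q p X₂ Y₂ X₁ Y₁ where
  subx₁ := h.subx₂
  suby₁ := h.suby₂
  subx₂ := by simpa using h.subx₁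
  suby₂ := by simpa using h.suby₁
  memx₁ := h.memx₂
  memy₁ := h.memy₂
  memx₂ := by simpa using h.memx₁
  memy₂ := by simpa using h.memy₁
  connx₁ := h.connx₂
  conny₁ := h.conny₂
  connx₂ := by simpa using h.connx₁
  conny₂ := by simpa using h.conny₁
  anti₁ := Set.pair_comm p q ▸ h.anti₂
  anti₂ := Set.pair_comm p q ▸ h.anti₁
  not_mem₁ := h.not_mem₂
  not_mem₂ := h.not_mem₁
  cases := by
    rw [seg_zero_reverse, seg_zero_reverse]
    rcases h.cases with h | h | h
    exacts [.inl h.symm, .inr (.inr ⟨h.1.symm, h.2⟩), .inr (.inl ⟨h.1.symm, h.2⟩)]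

/-- The theta has ends `p` and `e`. They are distinct and non-adjacent because `e ∈ A₃` while `p`
has no contact with `A₃`. Since `e` has neighbours `y a'` and `y b'` with `a' + 2 ≤ b'`, two routes
arrive along the two ends of `y`, one through `Y₁` and the other through `q` and `Y₂`. The third
passes through `X₁`, the beginning of `x`, and `d`. -/
lemma theta_aux (hA : Tri G A₁ A₂ A₃) (hx : Mid G A₁ A₂ A₃ n x) (hy : Mid G A₁ A₂ A₃ m y)
    (hxy : Anti G ∅ (seg x 0 n) (seg y 0 m)) (h : Hub G A₁ A₂ A₃ n x m y p q X₁ Y₁ X₂ Y₂)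
    (hl : Link G A₃ n x m y d e a b a' b') (he : e ∈ A₃)
    (hq : p = q ∨
      (G.Adj p q ∧ ∀ v ∈ seg x 0 n ∪ seg y 0 m ∪ X₁ ∪ Y₁, v ≠ p → q ≠ v ∧ ¬ G.Adj q v)) :
    G.ContainsInducedTheta := by
  have hab := hl.le
  have hbn := hl.le_len
  have hbm := hl.le_len'
  have hey : a' + 2 ≤ b' ∧ G.Adj e (y a') ∧ G.Adj e (y b') := by
    rcases hl.right with h1 | h1
    · exact h1.2
    · exact absurd (h1.1 ▸ he) (hy.not_mem₃ a' (by omega))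
  have hd : d ∈ A₃ ∧ G.Adj d (x a) ∨ d = x a := by
    rcases hl.left with h1 | h1
    exacts [.inl ⟨h1.1, h1.2.2.1⟩, .inr h1.1]
  have hpe : p ≠ e := fun h' => h.not_mem₁.1 (h' ▸ he)
  have hpe' : ¬ G.Adj p e := fun h' => h.not_mem₁.2 ⟨e, he, h'.symm⟩
  have hxy' : ∀ k, k ≤ n → ∀ l, l ≤ m → x k ≠ y l ∧ ¬ G.Adj (x k) (y l) := fun k hk l hl =>
    hxy.apply (mem_seg (Nat.zero_le _) hk) (mem_seg (Nat.zero_le _) hl)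
  -- `A₁` and `A₂` against the two paths
  have hAx₁ : ∀ {v l}, v ∈ A₁ → l ≤ n → v ≠ x l ∧ (G.Adj v (x l) → l = 0) := fun {v l} hv hl =>
    ⟨fun h => hx.not_mem₁ l hl (h ▸ hv), fun h => hx.eq₁ l hl ⟨v, hv, h⟩⟩
  have hAx₂ : ∀ {v l}, v ∈ A₂ → l ≤ n → v ≠ x l ∧ (G.Adj v (x l) → l = n) := fun {v l} hv hl =>
    ⟨fun h => hx.not_mem₂ l hl (h ▸ hv), fun h => hx.eq₂ l hl ⟨v, hv, h⟩⟩
  have hAy₁ : ∀ {v l}, v ∈ A₁ → l ≤ m → v ≠ y l ∧ (G.Adj v (y l) → l = 0) := fun {v l} hv hl =>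
    ⟨fun h => hy.not_mem₁ l hl (h ▸ hv), fun h => hy.eq₁ l hl ⟨v, hv, h⟩⟩
  have hAy₂ : ∀ {v l}, v ∈ A₂ → l ≤ m → v ≠ y l ∧ (G.Adj v (y l) → l = m) := fun {v l} hv hl =>
    ⟨fun h => hy.not_mem₂ l hl (h ▸ hv), fun h => hy.eq₂ l hl ⟨v, hv, h⟩⟩
  have hyy : ∀ {k l}, k + 2 ≤ l → l ≤ m → y k ≠ y l ∧ ¬ G.Adj (y k) (y l) := by
    intro k l hkl hl
    constructor
    · intro h'
      have := hy.path.inj k l (by omega) hl h'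
      omega
    · intro h'
      have := hy.path.nadj k l (by omega) hl h'
      omega
  -- `d` against the rest
  have hdy : ∀ l, l ≤ m → d ≠ e → d ≠ y l ∧ ¬ G.Adj d (y l) := by
    intro l hlm hde
    rcases hd with h1 | h1
    · exact ⟨fun h' => hy.not_mem₃ l hlm (h' ▸ h1.1), hl.left_nadj h1.1 he hde l hlm⟩
    · exact h1 ▸ hxy' a (by omega) l hlm
  have hq' : ∀ v ∈ seg x 0 n ∪ seg y 0 m ∪ X₁ ∪ Y₁ ∪ {d}, q ≠ p → v ≠ p → q ≠ v ∧ ¬ G.Adj q v := by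
    rintro v (hv | rfl) hqp hvp
    · rcases hq with h1 | h1
      · exact absurd h1.symm hqp
      · exact h1.2 v hv hvp
    · rcases hd with h1 | h1
      · exact ⟨fun h' => h.not_mem₂.1 (h' ▸ h1.1), fun h' => h.not_mem₂.2 ⟨_, h1.1, h'.symm⟩⟩
      · rcases hq with h2 | h2
        · exact absurd h2.symm hqp
        · exact h2.2 _ (.inl (.inl (.inl ⟨a, Nat.zero_le _, by omega, h1.symm⟩))) hvp
  have hqx : ∀ l, l ≤ n → q ≠ p → x l ≠ p → q ≠ x l ∧ ¬ G.Adj q (x l) := fun l hl hqp hlp =>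
    hq' _ (.inl (.inl (.inl (.inl (mem_seg (Nat.zero_le _) hl))))) hqp hlp
  have hqy : ∀ l, l ≤ m → q ≠ p → y l ≠ p → q ≠ y l ∧ ¬ G.Adj q (y l) := fun l hl hqp hlp =>
    hq' _ (.inl (.inl (.inl (.inr (mem_seg (Nat.zero_le _) hl))))) hqp hlp
  -- the legs against the path `x`
  have hY₁x : ∀ v ∈ Y₁, ∀ l, l ≤ n → v ≠ p → x l ≠ p → v ≠ q → v ≠ x l ∧ ¬ G.Adj v (x l) := by
    intro v hv l hl hvp hlp hvq
    rcases h.suby₁ hv with rfl | hvA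
    · have := hxy' l hl 0 (Nat.zero_le _)
      exact ⟨this.1.symm, fun h => this.2 h.symm⟩
    · refine ⟨(hAx₁ hvA hl).1, fun hadj => ?_⟩
      have := (hAx₁ hvA hl).2 hadj
      subst this
      have hxq : x 0 ≠ q := fun h' => by
        have : q ≠ p := fun h'' => hlp (h'.trans h'')
        exact (hqx 0 hl this hlp).1 h'.symm
      exact (h.anti₁ _ h.memx₁ v hv (by simp [hlp, hxq]) (by simp [hvp, hvq])).2 hadj.symm
  have hY₂x : ∀ v ∈ Y₂, ∀ l, l ≤ n → v ≠ p → x l ≠ p → v ≠ q → v ≠ x l ∧ ¬ G.Adj v (x l) := by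
    intro v hv l hl hvp hlp hvq
    rcases h.suby₂ hv with rfl | hvA
    · have := hxy' l hl m le_rfl
      exact ⟨this.1.symm, fun h => this.2 h.symm⟩
    · refine ⟨(hAx₂ hvA hl).1, fun hadj => ?_⟩
      have hln := (hAx₂ hvA hl).2 hadj
      have hxq : x l ≠ q := fun h' => by
        have : q ≠ p := fun h'' => hlp (h'.trans h'')
        exact (hqx l hl this hlp).1 h'.symm
      exact (h.anti₂ _ (hln ▸ h.memx₂) v hv (by simp [hlp, hxq]) (by simp [hvp, hvq])).2
        hadj.symm
  have hY₁q : ∀ v ∈ Y₁, v ≠ p → v ≠ q := fun v hv hvp hvq => by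
    rcases hq with h1 | h1
    · exact hvp (hvq.trans h1.symm)
    · exact (h1.2 v (.inr hv) hvp).1 hvq.symm
  -- The vertex `q` is split off from `Y₂` because different facts control it: `hq'` for `q`, and
  -- `anti₂` with the position of `A₂` for the rest.
  refine theta_of_conn₃ hpe hpe' (K₁ := {p, e} ∪ Y₁ ∪ seg y 0 a')
    (K₂ := {p, e} ∪ {q} ∪ (Y₂ \ {q}) ∪ seg y b' m) (K₃ := {p, e} ∪ X₁ ∪ seg x 0 a ∪ {d})
    ?_ ?_ ?_ ?_ ?_ ?_
  · refine (h.conny₁.mono ?_).trans (((hy.path.conn (by omega) (Nat.zero_le _) (Nat.zero_le _)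
      (Nat.zero_le _) (le_refl a')).mono Set.subset_union_right).trans (.of_adj (.inr (mem_seg
      (Nat.zero_le _) le_rfl)) (.inl (.inl (.inr rfl))) hey.2.1.symm))
    rintro v (hv | rfl)
    exacts [.inl (.inr hv), .inl (.inl (.inl rfl))]
  · have hc : Conn G ({p, e} ∪ {q} ∪ (Y₂ \ {q}) ∪ seg y b' m) p q := by
      rcases hq with h1 | h1
      · subst h1
        exact .refl (.inl (.inl (.inl (.inl rfl))))
      · exact .of_adj (.inl (.inl (.inl (.inl rfl)))) (.inl (.inl (.inr rfl))) h1.1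
    refine hc.trans ((h.conny₂.mono ?_).trans (((hy.path.conn le_rfl hbm le_rfl
      le_rfl hbm).mono Set.subset_union_right).trans (.of_adj (.inr (mem_seg
      le_rfl hbm)) (.inl (.inl (.inl (.inr rfl)))) hey.2.2.symm)))
    rintro v (hv | rfl)
    · by_cases hvq : v = q
      exacts [.inl (.inl (.inr hvq)), .inl (.inr ⟨hv, hvq⟩)]
    · exact .inl (.inl (.inr rfl))
  · have hmem : ∀ l, l ≤ a → x l ∈ {p, e} ∪ X₁ ∪ seg x 0 a ∪ {d} := fun l hl =>
      .inl (.inr (mem_seg (Nat.zero_le _) hl))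
    have hc : Conn G ({p, e} ∪ X₁ ∪ seg x 0 a ∪ {d}) (x a) d := by
      rcases hd with h1 | h1
      · exact .of_adj (hmem a le_rfl) (.inr rfl) h1.2.symm
      · rw [← h1]
        exact .refl (.inr rfl)
    have hc' : Conn G ({p, e} ∪ X₁ ∪ seg x 0 a ∪ {d}) d e := by
      rcases hl.close with h1 | h1
      · rw [← h1]
        exact .refl (.inr rfl)
      · exact .of_adj (.inr rfl) (.inl (.inl (.inl (.inr rfl)))) h1
    refine (h.connx₁.mono ?_).trans (Conn.trans ?_ (hc.trans hc'))
    · rintro v (hv | rfl)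
      exacts [.inl (.inl (.inr hv)), .inl (.inl (.inl (.inl rfl)))]
    · exact (hx.path.conn (hab.trans hbn) (Nat.zero_le _) (Nat.zero_le _)
        (Nat.zero_le _) le_rfl).mono (Set.subset_union_right.trans Set.subset_union_left)
  · refine .union_left (.union_left (.left_subset subset_rfl) ?_) ?_ <;>
      refine .union_right (.union_right (.union_right (.right_subset subset_rfl) ?_) ?_) ?_
    · rintro v hv _ rfl h1 h2
      have := hq' v (.inl (.inr hv)) (fun h => h2 (.inl h)) (fun h => h1 (.inl h))
      exact ⟨this.1.symm, fun h => this.2 h.symm⟩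
    · rintro v hv w ⟨hw, -⟩ - -
      rcases h.suby₁ hv with rfl | hv <;> rcases h.suby₂ hw with rfl | hw
      · exact hyy (by omega) le_rfl
      · refine ⟨(hAy₂ hw (Nat.zero_le _)).1.symm, fun h' => ?_⟩
        have := (hAy₂ hw (Nat.zero_le _)).2 h'.symm
        omega
      · refine ⟨(hAy₁ hv le_rfl).1, fun h' => ?_⟩
        have := (hAy₁ hv le_rfl).2 h'
        omega
      · exact hA.anti₁₂.apply hv hw
    · rintro v hv _ ⟨l, hl, hlm, rfl⟩ - -
      rcases h.suby₁ hv with rfl | hv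
      · exact hyy (by omega) hlm
      · refine ⟨(hAy₁ hv hlm).1, fun h' => ?_⟩
        have := (hAy₁ hv hlm).2 h'
        omega
    · rintro _ ⟨l, -, hl, rfl⟩ _ rfl h1 h2
      have := hqy l (by omega) (fun h => h2 (.inl h)) (fun h => h1 (.inl h))
      exact ⟨this.1.symm, fun h => this.2 h.symm⟩
    · rintro _ ⟨l, -, hl, rfl⟩ w ⟨hw, -⟩ - -
      rcases h.suby₂ hw with rfl | hw
      · exact hyy (by omega) le_rfl
      · refine ⟨(hAy₂ hw (by omega)).1.symm, fun h' => ?_⟩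
        have := (hAy₂ hw (by omega)).2 h'.symm
        omega
    · rintro _ ⟨k, -, hk, rfl⟩ _ ⟨l, hl, hlm, rfl⟩ - -
      exact hyy (by omega) hlm
  · refine .union_left (.union_left (.left_subset subset_rfl) ?_) ?_ <;>
      refine .union_right (.union_right (.union_right (.right_subset subset_rfl) ?_) ?_) ?_
    · rintro v hv w hw h1 h2
      have hvp : v ≠ p := fun h => h1 (.inl h)
      have hwp : w ≠ p := fun h => h2 (.inl h)
      have hwq : w ≠ q := by
        rcases hq with h3 | h3
        · exact h3 ▸ hwp
        · exact (h3.2 w (.inl (.inr hw)) hwp).1.symm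
      have := h.anti₁ w hw v hv (by simp [hwp, hwq]) (by simp [hvp, hY₁q v hv hvp])
      exact ⟨this.1.symm, fun h => this.2 h.symm⟩
    · rintro v hv _ ⟨l, -, hl, rfl⟩ h1 h2
      have hvp : v ≠ p := fun h => h1 (.inl h)
      exact hY₁x v hv l (by omega) hvp (fun h => h2 (.inl h)) (hY₁q v hv hvp)
    · rintro v hv _ rfl h1 h2
      have hvp : v ≠ p := fun h => h1 (.inl h)
      rcases hd with h3 | h3
      · rcases h.suby₁ hv with rfl | hv
        · have := hdy 0 (Nat.zero_le _) (fun h => h2 (.inr h))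
          exact ⟨this.1.symm, fun h => this.2 h.symm⟩
        · exact hA.anti₁₃.apply hv h3.1
      · subst h3
        exact hY₁x v hv a (by omega) hvp (fun h => h2 (.inl h)) (hY₁q v hv hvp)
    · rintro _ ⟨l, -, hl, rfl⟩ w hw h1 h2
      rcases h.subx₁ hw with rfl | hw
      · have := hxy' 0 (Nat.zero_le _) l (by omega)
        exact ⟨this.1.symm, fun h => this.2 h.symm⟩
      · refine ⟨(hAy₁ hw (by omega)).1.symm, fun hadj => ?_⟩
        have := (hAy₁ hw (by omega)).2 hadj.symm
        subst this
        have h1' : y 0 ≠ p := fun h => h1 (.inl h)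
        have h2' : w ≠ p := fun h => h2 (.inl h)
        have hwq : w ≠ q := by
          rcases hq with h3 | h3
          · exact h3 ▸ h2'
          · exact (h3.2 w (.inl (.inr ‹_›)) h2').1.symm
        exact (h.anti₁ w ‹_› _ h.memy₁ (by simp [h2', hwq])
          (by simp [h1', hY₁q _ h.memy₁ h1'])).2 hadj.symm
    · rintro _ ⟨k, -, hk, rfl⟩ _ ⟨l, -, hl, rfl⟩ - -
      have := hxy' l (by omega) k (by omega)
      exact ⟨this.1.symm, fun h => this.2 h.symm⟩
    · rintro _ ⟨k, -, hk, rfl⟩ _ rfl h1 h2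
      have := hdy k (by omega) (fun h => h2 (.inr h))
      exact ⟨this.1.symm, fun h => this.2 h.symm⟩
  · refine .union_left (.union_left (.union_left (.left_subset subset_rfl) ?_) ?_) ?_ <;>
      refine .union_right (.union_right (.union_right (.right_subset subset_rfl) ?_) ?_) ?_
    · rintro _ rfl w hw h1 h2
      exact hq' w (.inl (.inl (.inr hw))) (fun h => h1 (.inl h)) (fun h => h2 (.inl h))
    · rintro _ rfl _ ⟨l, -, hl, rfl⟩ h1 h2
      exact hqx l (by omega) (fun h => h1 (.inl h)) (fun h => h2 (.inl h))
    · rintro _ rfl _ rfl h1 h2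
      exact hq' _ (.inr rfl) (fun h => h1 (.inl h)) (fun h => h2 (.inl h))
    · rintro v ⟨hv, hvq⟩ w hw h1 h2
      rcases h.subx₁ hw with rfl | hwA
      · exact hY₂x v hv 0 (Nat.zero_le _) (fun h => h1 (.inl h)) (fun h => h2 (.inl h)) hvq
      rcases h.suby₂ hv with rfl | hvA
      · refine ⟨(hAy₁ hwA le_rfl).1.symm, fun h' => ?_⟩
        have := (hAy₁ hwA le_rfl).2 h'.symm
        omega
      · exact hA.anti₁₂.symm.apply hvA hwA
    · rintro v ⟨hv, hvq⟩ _ ⟨l, -, hl, rfl⟩ h1 h2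
      exact hY₂x v hv l (by omega) (fun h => h1 (.inl h)) (fun h => h2 (.inl h)) hvq
    · rintro v ⟨hv, hvq⟩ _ rfl h1 h2
      rcases hd with h3 | h3
      · rcases h.suby₂ hv with rfl | hv
        · have := hdy m le_rfl (fun h => h2 (.inr h))
          exact ⟨this.1.symm, fun h => this.2 h.symm⟩
        · exact hA.anti₂₃.apply hv h3.1
      · subst h3
        exact hY₂x v hv a (by omega) (fun h => h1 (.inl h)) (fun h => h2 (.inl h)) hvq
    · rintro _ ⟨l, hl, hlm, rfl⟩ w hw h1 h2
      rcases h.subx₁ hw with rfl | hw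
      · have := hxy' 0 (Nat.zero_le _) l hlm
        exact ⟨this.1.symm, fun h => this.2 h.symm⟩
      · refine ⟨(hAy₁ hw hlm).1.symm, fun h' => ?_⟩
        have := (hAy₁ hw hlm).2 h'.symm
        omega
    · rintro _ ⟨k, hk, hkm, rfl⟩ _ ⟨l, -, hl, rfl⟩ - -
      have := hxy' l (by omega) k hkm
      exact ⟨this.1.symm, fun h => this.2 h.symm⟩
    · rintro _ ⟨k, hk, hkm, rfl⟩ _ rfl h1 h2
      have := hdy k hkm (fun h => h2 (.inr h))
      exact ⟨this.1.symm, fun h => this.2 h.symm⟩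

/-- Two symmetries reduce everything to `theta_aux`. Exchanging `x` and `y` exchanges `d` and `e`,
so the one lying in `A₃` may be taken to be `e`; reversing both paths exchanges `p` with `q` and
`A₁` with `A₂`. -/
theorem theta (hG : NoTriangle G) (hA : Tri G A₁ A₂ A₃) (hx : Mid G A₁ A₂ A₃ n x)
    (hy : Mid G A₁ A₂ A₃ m y) (hxy : Anti G ∅ (seg x 0 n) (seg y 0 m))
    (h : Hub G A₁ A₂ A₃ n x m y p q X₁ Y₁ X₂ Y₂) : G.ContainsInducedTheta := by
  by_contra hth
  obtain ⟨d, e, a, b, a', b', hl⟩ := exists_link hG hth hA hx hy hxy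
  have hr : Anti G ∅ (seg (fun i => x (n - i)) 0 n) (seg (fun i => y (m - i)) 0 m) := by
    rwa [seg_zero_reverse, seg_zero_reverse]
  refine hth ?_
  have hc : (p = q ∨ (G.Adj p q ∧
      ∀ v ∈ seg x 0 n ∪ seg y 0 m ∪ X₁ ∪ Y₁, v ≠ p → q ≠ v ∧ ¬ G.Adj q v)) ∨
      (G.Adj p q ∧ ∀ v ∈ seg x 0 n ∪ seg y 0 m ∪ X₂ ∪ Y₂, v ≠ q → p ≠ v ∧ ¬ G.Adj p v) := by
    rw [or_assoc]
    exact h.cases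
  have key : ∀ S T U W : Set V, S ∪ T ∪ U ∪ W = T ∪ S ∪ W ∪ U := fun S T U W => by
    rw [Set.union_comm S T, Set.union_right_comm]
  rcases hl.mem with hd | he <;> rcases hc with hc | hc
  · rw [key] at hc
    exact theta_aux hA hy hx hxy.symm h.symm hl.symm hd hc
  · rw [key, ← seg_zero_reverse, ← seg_zero_reverse (f := x)] at hc
    exact theta_aux hA.swap₁₂ hy.reverse hx.reverse hr.symm h.symm.reverse hl.symm.reverse hd
      (.inr ⟨hc.1.symm, hc.2⟩)
  · exact theta_aux hA hx hy hxy h hl he hc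
  · rw [← seg_zero_reverse, ← seg_zero_reverse (f := y)] at hc
    exact theta_aux hA.swap₁₂ hx.reverse hy.reverse hr h.reverse hl.reverse he
      (.inr ⟨hc.1.symm, hc.2⟩)

end Hub

/-! ### Two short paths. -/

/-- At most one index deviates from the majority value `k`. In the application `k` selects the
vertex of a short path that becomes an end of the theta, and at most one route makes a detour
through the other vertex. -/
lemma exists_majority {ξ : Fin 3 → ℕ} (h : ∀ i, ξ i ≤ 1) :
    ∃ k, (∃ i, ξ i = k) ∧ ∀ i j, i ≠ j → ξ i = k ∨ ξ j = k := by
  have h0 := h 0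
  have h1 := h 1
  have h2 := h 2
  have key : ∀ k, (ξ 0 = k ∧ ξ 1 = k) ∨ (ξ 0 = k ∧ ξ 2 = k) ∨ (ξ 1 = k ∧ ξ 2 = k) →
      ∀ i j, i ≠ j → ξ i = k ∨ ξ j = k := by
    intro k hk i j hij
    fin_cases i <;> fin_cases j <;> first | exact absurd rfl hij | skip
    all_goals simp only [Fin.zero_eta, Fin.mk_one, Fin.reduceFinMk]; omega
  by_cases h01 : ξ 0 = ξ 1
  · exact ⟨ξ 0, ⟨0, rfl⟩, key _ (by omega)⟩
  · exact ⟨ξ 2, ⟨2, rfl⟩, key _ (by omega)⟩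

/-- Two paths with at most two vertices each that are joined through three pairwise anticomplete
connected sets give a theta. -/
theorem theta_of_two_small (hG : NoTriangle G) {A : Fin 3 → Set V} (hA : ∀ i, ConnSet G (A i))
    (hAA : ∀ i j, i ≠ j → Anti G ∅ (A i) (A j)) {n m : ℕ} {x y : ℕ → V} (hx : IPath G n x)
    (hy : IPath G m y) (hn : n ≤ 1) (hm : m ≤ 1) (hxA : ∀ i l, l ≤ n → x l ∉ A i)
    (hyA : ∀ i l, l ≤ m → y l ∉ A i) (hxt : ∀ i, ∃ l, l ≤ n ∧ Att G (A i) (x l))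
    (hyt : ∀ i, ∃ l, l ≤ m ∧ Att G (A i) (y l)) (hxy : Anti G ∅ (seg x 0 n) (seg y 0 m)) :
    G.ContainsInducedTheta := by
  have hp : ∀ i, ∃ h f, IPath G h f ∧ (∀ k, k ≤ h → f k ∈ A i) ∧
      (∃ l, l ≤ n ∧ G.Adj (f 0) (x l)) ∧ (∃ l, l ≤ m ∧ G.Adj (f h) (y l)) ∧
      (∀ k, k ≤ h → (∃ l, l ≤ n ∧ G.Adj (f k) (x l)) → k = 0) ∧
      (∀ k, k ≤ h → (∃ l, l ≤ m ∧ G.Adj (f k) (y l)) → k = h) := by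
    intro i
    obtain ⟨l, hl, s, hs, hsx⟩ := hxt i
    obtain ⟨l', hl', t, ht, hty⟩ := hyt i
    exact exists_path ((hA i).2 s hs t ht) (X := fun v => ∃ l, l ≤ n ∧ G.Adj v (x l))
      (Y := fun v => ∃ l, l ≤ m ∧ G.Adj v (y l)) ⟨l, hl, hsx⟩ ⟨l', hl', hty⟩
  choose h f hf hfA hf0 hfh hfX hfY using hp
  choose ξ hξ hξf using hf0
  choose η hη hηf using hfh
  -- A vertex adjacent to both vertices of a short path would close a triangle, so contacts with `x`
  -- and `y` have a well-defined position.
  have huniq : ∀ {r z}, IPath G r z → r ≤ 1 → ∀ v k l, k ≤ r → l ≤ r → G.Adj v (z k) →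
      G.Adj v (z l) → k = l := by
    intro r z hz hr v k l hk hl h1 h2
    by_contra hne
    have : (k = 0 ∧ l = 1) ∨ (k = 1 ∧ l = 0) := by omega
    rcases this with ⟨rfl, rfl⟩ | ⟨rfl, rfl⟩
    · exact hG _ _ _ h1 (hz.adj 0 (by omega)) h2
    · exact hG _ _ _ h2 (hz.adj 0 (by omega)) h1
  have hξ' : ∀ i k l, k ≤ h i → l ≤ n → G.Adj (f i k) (x l) → l = ξ i := by
    intro i k l hk hl hadj
    have := hfX i k hk ⟨l, hl, hadj⟩
    subst this
    exact huniq hx hn _ _ _ hl (hξ i) hadj (hξf i)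
  have hη' : ∀ i k l, k ≤ h i → l ≤ m → G.Adj (f i k) (y l) → l = η i := by
    intro i k l hk hl hadj
    have := hfY i k hk ⟨l, hl, hadj⟩
    subst this
    exact huniq hy hm _ _ _ hl (hη i) hadj (hηf i)
  -- The ends of the theta are the majority contacts `x k` and `y l` of the three paths `f i`.
  obtain ⟨k, ⟨ik, hik⟩, hk⟩ := exists_majority fun i => (hξ i).trans hn
  obtain ⟨l, ⟨il, hil⟩, hl⟩ := exists_majority fun i => (hη i).trans hm
  have hkn : k ≤ n := hik ▸ hξ ik
  have hlm : l ≤ m := hil ▸ hη il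
  have hxy' : ∀ k, k ≤ n → ∀ l, l ≤ m → x k ≠ y l ∧ ¬ G.Adj (x k) (y l) := fun k hk l hl =>
    hxy.apply (mem_seg (Nat.zero_le _) hk) (mem_seg (Nat.zero_le _) hl)
  have hstep : ∀ {r z}, IPath G r z → r ≤ 1 → ∀ {K : Set V} {i j}, i ≤ r → j ≤ r → z i ∈ K →
      z j ∈ K → Conn G K (z i) (z j) := by
    intro r z hz hr K i j hi hj h1 h2
    have : i = j ∨ (i = 0 ∧ j = 1) ∨ (i = 1 ∧ j = 0) := by omega
    rcases this with rfl | ⟨rfl, rfl⟩ | ⟨rfl, rfl⟩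
    · exact .refl h1
    · exact .of_adj h1 h2 (hz.adj 0 (by omega))
    · exact .of_adj h1 h2 (hz.adj 0 (by omega)).symm
  refine theta_of_conn (hxy' k hkn l hlm).1 (hxy' k hkn l hlm).2
    (K := fun i => {x k, y l} ∪ seg (f i) 0 (h i) ∪ {x (ξ i)} ∪ {y (η i)}) (fun i => ?_) ?_
  · have hx1 : x (ξ i) ∈ {x k, y l} ∪ seg (f i) 0 (h i) ∪ {x (ξ i)} ∪ {y (η i)} := .inl (.inr rfl)
    have hy1 : y (η i) ∈ {x k, y l} ∪ seg (f i) 0 (h i) ∪ {x (ξ i)} ∪ {y (η i)} := .inr rfl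
    have hc : Conn G ({x k, y l} ∪ seg (f i) 0 (h i) ∪ {x (ξ i)} ∪ {y (η i)}) (f i 0) (f i (h i)) :=
      ((hf i).conn le_rfl (Nat.zero_le _) (Nat.zero_le _) (Nat.zero_le _) le_rfl).mono
        fun v hv => .inl (.inl (.inr hv))
    exact (hstep hx hn hkn (hξ i) (.inl (.inl (.inl (.inl rfl)))) hx1).trans
      ((Conn.of_adj hx1 hc.left_mem (hξf i).symm).trans (hc.trans
        ((Conn.of_adj hc.right_mem hy1 (hηf i)).trans
          (hstep hy hm (hη i) hlm hy1 (.inl (.inl (.inl (.inr rfl))))))))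
  · have hfx : ∀ i j, i ≠ j → Anti G {x k, y l} (seg (f i) 0 (h i)) {x (ξ j)} := by
      rintro i j hij _ ⟨s, -, hs, rfl⟩ _ rfl - h2
      refine ⟨fun h => hxA i _ (hξ j) (h ▸ hfA i s hs), fun hadj => ?_⟩
      have := hξ' i s _ hs (hξ j) hadj
      rcases hk i j hij with h3 | h3
      · exact h2 (.inl (by rw [this, h3]))
      · exact h2 (.inl (by rw [h3]))
    have hfy : ∀ i j, i ≠ j → Anti G {x k, y l} (seg (f i) 0 (h i)) {y (η j)} := by
      rintro i j hij _ ⟨s, -, hs, rfl⟩ _ rfl - h2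
      refine ⟨fun h => hyA i _ (hη j) (h ▸ hfA i s hs), fun hadj => ?_⟩
      have := hη' i s _ hs (hη j) hadj
      rcases hl i j hij with h3 | h3
      · exact h2 (.inr (by rw [this, h3]; rfl))
      · exact h2 (.inr (by rw [h3]; rfl))
    have hxx : ∀ i j, i ≠ j → Anti G {x k, y l} {x (ξ i)} {x (ξ j)} := by
      rintro i j hij _ rfl _ rfl h1 h2
      rcases hk i j hij with h3 | h3
      · exact absurd (.inl (by rw [h3])) h1
      · exact absurd (.inl (by rw [h3])) h2
    have hyy : ∀ i j, i ≠ j → Anti G {x k, y l} {y (η i)} {y (η j)} := by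
      rintro i j hij _ rfl _ rfl h1 h2
      rcases hl i j hij with h3 | h3
      · exact absurd (.inr (by rw [h3]; rfl)) h1
      · exact absurd (.inr (by rw [h3]; rfl)) h2
    have hxη : ∀ i j, Anti G {x k, y l} {x (ξ i)} {y (η j)} := by
      rintro i j _ rfl _ rfl - -
      exact hxy' _ (hξ i) _ (hη j)
    have hff : ∀ i j, i ≠ j → Anti G {x k, y l} (seg (f i) 0 (h i)) (seg (f j) 0 (h j)) := by
      rintro i j hij _ ⟨s, -, hs, rfl⟩ _ ⟨t, -, ht, rfl⟩ - -
      exact (hAA i j hij).apply (hfA i s hs) (hfA j t ht)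
    intro i j hij
    refine .union_left (.union_left (.union_left (.left_subset subset_rfl) ?_) ?_) ?_ <;>
      refine .union_right (.union_right (.union_right (.right_subset subset_rfl) ?_) ?_) ?_
    exacts [hff i j hij, hfx i j hij, hfy i j hij, (hfx j i hij.symm).symm, hxx i j hij, hxη i j,
      (hfy j i hij.symm).symm, (hxη j i).symm, hyy i j hij]

/-! ### Long paths with a common middle set. -/

/-- If the centers of two tripods joined by three paths are close to each other, then they are close
to the ends of a short path. -/
lemma tripod_centers_cases {A₁ A₂ : Set V} (hA : Anti G ∅ A₁ A₂) {n : Fin 3 → ℕ}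
    {b : Fin 3 → ℕ → V} (hb : ∀ j, IPath G (n j) (b j))
    (hbb : ∀ i j, i ≠ j → Anti G ∅ (seg (b i) 0 (n i)) (seg (b j) 0 (n j)))
    (h1 : ∀ j l, l ≤ n j → b j l ∉ A₁) (h2 : ∀ j l, l ≤ n j → b j l ∉ A₂)
    (ha1 : ∀ j l, l ≤ n j → Att G A₁ (b j l) → l = 0)
    (ha2 : ∀ j l, l ≤ n j → Att G A₂ (b j l) → l = n j)
    {p q : V} {T₁ T₂ : Fin 3 → Set V} (hp : Tripod G A₁ (fun j => b j 0) p T₁)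
    (hq : Tripod G A₂ (fun j => b j (n j)) q T₂) (hth : ¬ G.ContainsInducedTheta) :
    ∃ j, n j ≤ 1 ∧ ((p = b j 0 ∧ q = b j (n j)) ∨ (n j = 0 ∧ p ∈ A₁ ∧ q = b j 0 ∧ G.Adj p q) ∨
      (n j = 0 ∧ p = b j 0 ∧ q ∈ A₂ ∧ G.Adj p q)) := by
  have hclose := tripod_centers_close hA hb hbb h1 h2 ha1 ha2 hp hq hth
  -- Closeness is restrictive here: `A₁` and `A₂` are anticomplete, `A₁` touches only first vertices
  -- of the paths, `A₂` only last ones, and different paths are anticomplete. If both centers are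
  -- ends of paths, then the path is the same and its ends are equal or adjacent.
  rcases hp.center with hpA | ⟨j, hj⟩ <;> rcases hq.center with hqA | ⟨k, hk⟩
  · have := hA.apply hpA hqA
    exact absurd hclose (by simp [this])
  · have hadj : G.Adj p q := hclose.resolve_left fun h =>
      h1 k (n k) le_rfl (hk ▸ h ▸ hpA)
    have := ha1 k (n k) le_rfl ⟨p, hpA, hk ▸ hadj⟩
    exact ⟨k, by omega, .inr (.inl ⟨this, hpA, by rw [hk, this], hadj⟩)⟩
  · have hadj : G.Adj p q := hclose.resolve_left fun h =>
      h2 j 0 (Nat.zero_le _) (hj ▸ h ▸ hqA)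
    have := ha2 j 0 (Nat.zero_le _) ⟨q, hqA, hj ▸ hadj.symm⟩
    exact ⟨j, by omega, .inr (.inr ⟨this.symm, hj, hqA, hadj⟩)⟩
  · have hjk : j = k := by
      by_contra hne
      have := (hbb j k hne).apply (mem_seg (i := 0) le_rfl (Nat.zero_le _))
        (mem_seg (i := n k) (Nat.zero_le _) le_rfl)
      rw [← hj, ← hk] at this
      exact absurd hclose (by simp [this])
    subst hjk
    refine ⟨j, ?_, .inl ⟨hj, hk⟩⟩
    rw [hj, hk] at hclose
    rcases hclose with h | h
    · have := (hb j).inj 0 (n j) (Nat.zero_le _) le_rfl h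
      omega
    · have := (hb j).nadj 0 (n j) (Nat.zero_le _) le_rfl h
      omega

section SameMiddle

variable [Finite V] {A₁ A₂ A₃ : Set V} {n m k : ℕ} {x y t : ℕ → V}

/-- Tripods in `A₁` and `A₂` attached to the ends of three paths. -/
lemma exists_two_tripods (hG : NoTriangle G) (h₁ : ConnSet G A₁) (h₂ : ConnSet G A₂)
    {n : Fin 3 → ℕ} {b : Fin 3 → ℕ → V}
    (hbb : ∀ i j, i ≠ j → Anti G ∅ (seg (b i) 0 (n i)) (seg (b j) 0 (n j)))
    (h1 : ∀ j l, l ≤ n j → b j l ∉ A₁) (h2 : ∀ j l, l ≤ n j → b j l ∉ A₂)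
    (ha1 : ∀ j, Att G A₁ (b j 0)) (ha2 : ∀ j, Att G A₂ (b j (n j))) :
    ∃ p q T₁ T₂, Tripod G A₁ (fun j => b j 0) p T₁ ∧ Tripod G A₂ (fun j => b j (n j)) q T₂ := by
  obtain ⟨p, T₁, hp⟩ := exists_tripod hG h₁ (z := fun j => b j 0)
    (fun j => h1 j 0 (Nat.zero_le _)) (fun i j hij => (hbb i j hij).apply
      (mem_seg le_rfl (Nat.zero_le _)) (mem_seg le_rfl (Nat.zero_le _))) ha1
  obtain ⟨q, T₂, hq⟩ := exists_tripod hG h₂ (z := fun j => b j (n j))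
    (fun j => h2 j (n j) le_rfl) (fun i j hij => (hbb i j hij).apply
      (mem_seg (Nat.zero_le _) le_rfl) (mem_seg (Nat.zero_le _) le_rfl)) ha2
  exact ⟨p, q, T₁, T₂, hp, hq⟩

/-- Without a theta, the centers of the tripods in `A₁` and `A₂` would be close, which requires a
short path among the three. -/
theorem theta_of_three_same_mid (hG : NoTriangle G) (hA : Tri G A₁ A₂ A₃)
    (hx : Mid G A₁ A₂ A₃ n x) (hy : Mid G A₁ A₂ A₃ m y) (ht : Mid G A₁ A₂ A₃ k t)
    (hn : 2 ≤ n) (hm : 2 ≤ m) (hk : 2 ≤ k) (hxy : Anti G ∅ (seg x 0 n) (seg y 0 m))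
    (hxt : Anti G ∅ (seg x 0 n) (seg t 0 k)) (hyt : Anti G ∅ (seg y 0 m) (seg t 0 k)) :
    G.ContainsInducedTheta := by
  by_contra hth
  have hM : ∀ j : Fin 3, Mid G A₁ A₂ A₃ (![n, m, k] j) (![x, y, t] j) := by
    intro j
    fin_cases j
    exacts [hx, hy, ht]
  have hbb : ∀ i j : Fin 3, i ≠ j → Anti G ∅ (seg (![x, y, t] i) 0 (![n, m, k] i))
      (seg (![x, y, t] j) 0 (![n, m, k] j)) := by
    intro i j hij
    fin_cases i <;> fin_cases j <;> first | exact absurd rfl hij | skip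
    exacts [hxy, hxt, hxy.symm, hyt, hxt.symm, hyt.symm]
  obtain ⟨p, q, T₁, T₂, hp, hq⟩ := exists_two_tripods hG hA.conn₁ hA.conn₂ hbb
    (fun j => (hM j).not_mem₁) (fun j => (hM j).not_mem₂) (fun j => (hM j).att₁)
    (fun j => (hM j).att₂)
  obtain ⟨j, hj, -⟩ := tripod_centers_cases hA.anti₁₂ (fun j => (hM j).path) hbb
    (fun j => (hM j).not_mem₁) (fun j => (hM j).not_mem₂) (fun j => (hM j).eq₁)
    (fun j => (hM j).eq₂) hp hq hth
  have : 2 ≤ ![n, m, k] j := by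
    fin_cases j
    exacts [hn, hm, hk]
  omega

/-- The vertex `t` plays the role of a third path, the only short one. Hence the tripod centers are
both `t`, or one is `t` and the other a neighbour of it in `A₁` or `A₂`. Neither center has contact
with `A₃`, so they form a hub for `x` and `y`, the legs towards `t` providing the required
non-adjacencies. -/
theorem theta_of_two_same_mid (hG : NoTriangle G) (hA : Tri G A₁ A₂ A₃)
    (hx : Mid G A₁ A₂ A₃ n x) (hy : Mid G A₁ A₂ A₃ m y) {t : V}
    (hn : 2 ≤ n) (hm : 2 ≤ m) (hxy : Anti G ∅ (seg x 0 n) (seg y 0 m))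
    (hxt : Anti G ∅ (seg x 0 n) {t}) (hyt : Anti G ∅ (seg y 0 m) {t})
    (ht₁ : t ∉ A₁) (ht₂ : t ∉ A₂) (ht₃ : t ∉ A₃) (hta₁ : Att G A₁ t) (hta₂ : Att G A₂ t)
    (hta₃ : ¬ Att G A₃ t) : G.ContainsInducedTheta := by
  by_contra hth
  have hseg : seg (fun _ => t) 0 0 = {t} := by
    ext v
    constructor
    · rintro ⟨-, -, -, rfl⟩
      rfl
    · rintro rfl
      exact ⟨0, le_rfl, le_rfl, rfl⟩
  let N : Fin 3 → ℕ := ![n, m, 0]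
  let b : Fin 3 → ℕ → V := ![x, y, fun _ => t]
  have hbb : ∀ i j : Fin 3, i ≠ j → Anti G ∅ (seg (b i) 0 (N i)) (seg (b j) 0 (N j)) := by
    intro i j hij
    rw [← hseg] at hxt hyt
    fin_cases i <;> fin_cases j <;> first | exact absurd rfl hij | skip
    exacts [hxy, hxt, hxy.symm, hyt, hxt.symm, hyt.symm]
  have hpath : ∀ j, IPath G (N j) (b j) := by
    intro j
    fin_cases j
    · exact hx.path
    · exact hy.path
    · exact ⟨fun i j hi hj _ => by simp [N] at hi hj; omega, fun i hi => by simp [N] at hi,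
        fun i j _ _ h => absurd h (G.loopless.irrefl t)⟩
  have h1 : ∀ j l, l ≤ N j → b j l ∉ A₁ := by
    intro j
    fin_cases j
    exacts [hx.not_mem₁, hy.not_mem₁, fun _ _ => ht₁]
  have h2 : ∀ j l, l ≤ N j → b j l ∉ A₂ := by
    intro j
    fin_cases j
    exacts [hx.not_mem₂, hy.not_mem₂, fun _ _ => ht₂]
  have ha1 : ∀ j l, l ≤ N j → Att G A₁ (b j l) → l = 0 := by
    intro j
    fin_cases j
    exacts [hx.eq₁, hy.eq₁, fun _ h _ => by simpa [N] using h]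
  have ha2 : ∀ j l, l ≤ N j → Att G A₂ (b j l) → l = N j := by
    intro j
    fin_cases j
    exacts [hx.eq₂, hy.eq₂, fun _ h _ => by simpa [N] using h]
  obtain ⟨p, q, T₁, T₂, hp, hq⟩ := exists_two_tripods hG hA.conn₁ hA.conn₂ hbb h1 h2
    (fun j => by fin_cases j; exacts [hx.att₁, hy.att₁, hta₁])
    (fun j => by fin_cases j; exacts [hx.att₂, hy.att₂, hta₂])
  obtain ⟨j, hj, hpq⟩ := tripod_centers_cases hA.anti₁₂ hpath hbb h1 h2 ha1 ha2 hp hq hth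
  have hj2 : j = 2 := by
    fin_cases j
    · simp [N] at hj; omega
    · simp [N] at hj; omega
    · rfl
  subst hj2
  replace hpq : (p = t ∧ q = t) ∨ (p ∈ A₁ ∧ q = t ∧ G.Adj p q) ∨
      (p = t ∧ q ∈ A₂ ∧ G.Adj p q) := by
    rcases hpq with h | h | h
    exacts [.inl h, .inr (.inl h.2), .inr (.inr h.2)]
  have e1 : p ∉ A₃ ∧ ¬ Att G A₃ p := by
    have : p ∈ A₁ ∨ p = t := by tauto
    rcases this with h | rfl
    · exact ⟨fun h' => (hA.anti₁₃.apply h h').1 rfl,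
        fun ⟨s, hs, hsp⟩ => (hA.anti₁₃.apply h hs).2 hsp.symm⟩
    · exact ⟨ht₃, hta₃⟩
  have e2 : q ∉ A₃ ∧ ¬ Att G A₃ q := by
    have : q ∈ A₂ ∨ q = t := by tauto
    rcases this with h | rfl
    · exact ⟨fun h' => (hA.anti₂₃.apply h h').1 rfl,
        fun ⟨s, hs, hsp⟩ => (hA.anti₂₃.apply h hs).2 hsp.symm⟩
    · exact ⟨ht₃, hta₃⟩
  have hsym : ∀ {u v : V}, u ≠ v ∧ ¬ G.Adj u v → v ≠ u ∧ ¬ G.Adj v u := fun h =>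
    ⟨h.1.symm, fun h' => h.2 h'.symm⟩
  refine hth (Hub.theta hG hA hx hy hxy (p := p) (q := q) (X₁ := T₁ 0) (Y₁ := T₁ 1) (X₂ := T₂ 0)
    (Y₂ := T₂ 1) ⟨hp.sub 0, hp.sub 1, hq.sub 0, hq.sub 1, hp.mem 0, hp.mem 1, hq.mem 0, hq.mem 1,
    hp.conn 0, hp.conn 1, hq.conn 0, hq.conn 1, (hp.anti 0 1 (by decide)).mono_off (by simp),
    (hq.anti 0 1 (by decide)).mono_off (by simp), e1, e2, ?_⟩)
  rcases hpq with ⟨rfl, rfl⟩ | ⟨hpA, rfl, hadj⟩ | ⟨rfl, hqA, hadj⟩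
  · exact .inl rfl
  · refine .inr (.inl ⟨hadj, ?_⟩)
    have hqp : q ≠ p := fun h => ht₁ (h ▸ hpA)
    rintro v (((hv | hv) | hv) | hv) hvp
    · exact hsym (hxt.apply hv rfl)
    · exact hsym (hyt.apply hv rfl)
    · exact hp.anti 2 0 (by decide) _ (hp.mem 2) v hv hqp hvp
    · exact hp.anti 2 1 (by decide) _ (hp.mem 2) v hv hqp hvp
  · refine .inr (.inr ⟨hadj, ?_⟩)
    have hpq : p ≠ q := fun h => ht₂ (h ▸ hqA)
    rintro v (((hv | hv) | hv) | hv) hvq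
    · exact hsym (hxt.apply hv rfl)
    · exact hsym (hyt.apply hv rfl)
    · exact hq.anti 2 0 (by decide) _ (hq.mem 2) v hv hpq hvq
    · exact hq.anti 2 1 (by decide) _ (hq.mem 2) v hv hpq hvq

end SameMiddle

/-! ### Legs, and pairs of paths with different middle sets. -/

lemma IPath.take {n : ℕ} {f : ℕ → V} (h : IPath G n f) {k : ℕ} (hk : k ≤ n) : IPath G k f where
  inj i j hi hj := h.inj i j (by omega) (by omega)
  adj i hi := h.adj i (by omega)
  nadj i j hi hj := h.nadj i j (by omega) (by omega)

/-- An induced path in `P` whose first vertex is the only one with a neighbour in `T` and whose last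
vertex is the only one adjacent to `z`. -/
structure Leg (G : SimpleGraph V) (P T : Set V) (z : V) (m : ℕ) (l : ℕ → V) : Prop where
  path : IPath G m l
  mem : ∀ i, i ≤ m → l i ∈ P
  att : Att G T (l 0)
  adj : G.Adj (l m) z
  eq_zero : ∀ i, i ≤ m → Att G T (l i) → i = 0
  eq_last : ∀ i, i ≤ m → G.Adj (l i) z → i = m

/-- The vertex `v` has two neighbours in `T`. -/
def Many (G : SimpleGraph V) (T : Set V) (v : V) : Prop :=
  ∃ a ∈ T, ∃ b ∈ T, a ≠ b ∧ G.Adj v a ∧ G.Adj v b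

lemma exists_leg_of_conn {S T : Set V} {z u w : V} (h : Conn G S u w) (hu : Att G T u)
    (hw : G.Adj w z) : ∃ m l, Leg G S T z m l := by
  obtain ⟨m, l, h1, h2, h3, h4, h5, h6⟩ := exists_path h (X := Att G T) (Y := fun v => G.Adj v z)
    hu hw
  exact ⟨m, l, h1, h2, h3, h4, h5, h6⟩

lemma exists_leg {P T : Set V} (hP : ConnSet G P) {s z : V} (hs : s ∈ T) (hsP : Att G P s)
    (hz : Att G P z) : ∃ m l, Leg G P T z m l := by
  obtain ⟨u, hu, hus⟩ := hsP
  obtain ⟨w, hw, hwz⟩ := hz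
  exact exists_leg_of_conn (hP.2 u hu w hw) ⟨s, hs, hus.symm⟩ hwz

lemma Leg.mono {P P' T : Set V} {z : V} {m : ℕ} {l : ℕ → V} (h : Leg G P T z m l) (hP : P ⊆ P') :
    Leg G P' T z m l :=
  ⟨h.path, fun i hi => hP (h.mem i hi), h.att, h.adj, h.eq_zero, h.eq_last⟩

lemma Leg.exists_take {P T : Set V} {z z' : V} {m : ℕ} {l : ℕ → V} (h : Leg G P T z m l)
    (hz' : ∃ i, i ≤ m ∧ G.Adj (l i) z') : ∃ i, i ≤ m ∧ Leg G P T z' i l := by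
  classical
  obtain ⟨h1, h2⟩ := Nat.find_spec hz'
  have hmin := fun k (hk : k < Nat.find hz') => Nat.find_min hz' hk
  set i := Nat.find hz'
  refine ⟨i, h1, h.path.take h1, fun j hj => h.mem j (by omega), h.att, h2,
    fun j hj => h.eq_zero j (by omega), fun j hj hadj => ?_⟩
  by_contra hne
  exact hmin j (by omega) ⟨by omega, hadj⟩

lemma not_many_of_small (hG : NoTriangle G) {n : ℕ} {x : ℕ → V} (hx : IPath G n x) (hn : n ≤ 1)
    {v : V} : ¬ Many G (seg x 0 n) v := by
  rintro ⟨_, ⟨i, -, hi, rfl⟩, _, ⟨j, -, hj, rfl⟩, hne, h1, h2⟩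
  have hij : i ≠ j := fun h => hne (h ▸ rfl)
  have : (i = 0 ∧ j = 1) ∨ (i = 1 ∧ j = 0) := by omega
  rcases this with ⟨rfl, rfl⟩ | ⟨rfl, rfl⟩
  · exact hG _ _ _ h1 (hx.adj 0 (by omega)) h2
  · exact hG _ _ _ h2 (hx.adj 0 (by omega)) h1

lemma Center.many {n : ℕ} {x : ℕ → V} {v c : V} {a b : ℕ} (h : Center G n x v c a b)
    (hab : a + 2 ≤ b) : Many G (seg x 0 n) v := by
  have h1 := h.le_len
  refine ⟨x a, mem_seg (Nat.zero_le _) (by omega), x b, mem_seg (Nat.zero_le _) h1, fun h2 => ?_,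
    h.adj_left, h.adj_right⟩
  have := h.path.inj a b (by omega) h1 h2
  omega

/-- Two paths with different middle sets, and connections from the middle set of each of them
towards the other one. -/
theorem legs_of_two_mid (hG : NoTriangle G) (hth : ¬ G.ContainsInducedTheta) {P Q R : Set V}
    (hA : Tri G P Q R) {n n' m m' : ℕ} {t r l l' : ℕ → V} (ht : Mid G Q R P n t)
    (hr : Mid G P R Q n' r) (htr : Anti G ∅ (seg t 0 n) (seg r 0 n'))
    (hl : Leg G P (seg t 0 n) (r 0) m l) (hl' : Leg G Q (seg r 0 n') (t 0) m' l') :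
    (m = 0 ∧ Many G (seg t 0 n) (l 0) ∧ ∀ b ∈ seg r 0 n', G.Adj (l' 0) b → b = r 0) ∨
    (m' = 0 ∧ Many G (seg r 0 n') (l' 0) ∧ ∀ b ∈ seg t 0 n, G.Adj (l 0) b → b = t 0) := by
  obtain ⟨_, ⟨i, -, hi, rfl⟩, hti⟩ := hl.att
  obtain ⟨_, ⟨j, -, hj, rfl⟩, hrj⟩ := hl'.att
  have htl : ∀ k, k ≤ n → ∀ i, i ≤ m → t k ≠ l i := fun k hk i hi h =>
    ht.not_mem₃ k hk (h ▸ hl.mem i hi)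
  have hrl : ∀ k, k ≤ n' → ∀ i, i ≤ m' → r k ≠ l' i := fun k hk i hi h =>
    hr.not_mem₃ k hk (h ▸ hl'.mem i hi)
  obtain ⟨c, a, b, hc⟩ := exists_center hG ht.path (fun k hk => htl k hk 0 (Nat.zero_le _)) hi
    hti.symm
  obtain ⟨c', a', b', hc'⟩ := exists_center hG hr.path (fun k hk => hrl k hk 0 (Nat.zero_le _)) hj
    hrj.symm
  have hab := hc.le
  have hbn := hc.le_len
  have hab' := hc'.le
  have hbn' := hc'.le_len
  have hca : a = b → t a = c := fun h => by
    rcases hc.cases with h1 | h1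
    · omega
    · exact h1.1.symm
  have hca' : a' = b' → r a' = c' := fun h => by
    rcases hc'.cases with h1 | h1
    · omega
    · exact h1.1.symm
  have htr' : ∀ k, k ≤ n → ∀ l, l ≤ n' → t k ≠ r l ∧ ¬ G.Adj (t k) (r l) := fun k hk l hl =>
    htr.apply (mem_seg (Nat.zero_le _) hk) (mem_seg (Nat.zero_le _) hl)
  have hlP : seg l 0 m ⊆ P := by
    rintro _ ⟨k, -, hk, rfl⟩
    exact hl.mem k hk
  have hlQ : seg l' 0 m' ⊆ Q := by
    rintro _ ⟨k, -, hk, rfl⟩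
    exact hl'.mem k hk
  -- Three routes join `c` and `c'`: along the ends of `t` and `r` through `R`; along `l` to `r 0`
  -- and then along `r`; and along `t` to `t 0` and then along `l'`.
  have hclose : c = c' ∨ G.Adj c c' := by
    by_contra! hcon
    have hlt : ∀ {i j}, j ≤ n → Anti G {c, c'} (seg l 0 m) (seg t i j) := by
      rintro i j hj _ ⟨k, -, hk, rfl⟩ _ ⟨k', -, hk', rfl⟩ h1 h2
      refine ⟨(htl k' (by omega) k hk).symm, fun hadj => ?_⟩
      have := hl.eq_zero k hk ⟨_, mem_seg (Nat.zero_le _) (by omega), hadj.symm⟩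
      subst this
      rcases hc.eq_of_adj (by omega) hadj with h | h
      exacts [h1 (.inl h), h2 (.inl h)]
    have hlr : ∀ {i j}, j ≤ n' → Anti G {c, c'} (seg l' 0 m') (seg r i j) := by
      rintro i j hj _ ⟨k, -, hk, rfl⟩ _ ⟨k', -, hk', rfl⟩ h1 h2
      refine ⟨(hrl k' (by omega) k hk).symm, fun hadj => ?_⟩
      have := hl'.eq_zero k hk ⟨_, mem_seg (Nat.zero_le _) (by omega), hadj.symm⟩
      subst this
      rcases hc'.eq_of_adj (by omega) hadj with h | h
      exacts [h1 (.inr h), h2 (.inr h)]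
    have htr'' : ∀ {i j i' j'}, j ≤ n → j' ≤ n' → Anti G {c, c'} (seg t i j) (seg r i' j') :=
      fun h1 h2 => htr.off.mono (seg_mono (Nat.zero_le _) h1) (seg_mono (Nat.zero_le _) h2)
    have hlA : seg l 0 m ⊆ {c, c'} ∪ seg l 0 m ∪ seg r 0 a' := fun v hv => .inl (.inr hv)
    have hrA : seg r 0 a' ⊆ {c, c'} ∪ seg l 0 m ∪ seg r 0 a' := fun v hv => .inr hv
    have hlA' : seg l' 0 m' ⊆ {c, c'} ∪ seg l' 0 m' ∪ seg t 0 a := fun v hv => .inl (.inr hv)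
    have htA : seg t 0 a ⊆ {c, c'} ∪ seg l' 0 m' ∪ seg t 0 a := fun v hv => .inr hv
    refine hth (theta_of_conn₃ hcon.1 hcon.2
      (K₁ := {c, c'} ∪ seg t b n ∪ R ∪ seg r b' n') (K₂ := {c, c'} ∪ seg l 0 m ∪ seg r 0 a')
      (K₃ := {c, c'} ∪ seg l' 0 m' ∪ seg t 0 a) ?_ ?_ ?_ ?_ ?_ ?_)
    · refine (hc.right.mono ?_).trans (Conn.trans ?_ (hc'.right.mono ?_).symm)
      · rintro v (hv | rfl)
        exacts [.inl (.inl (.inr hv)), .inl (.inl (.inl (.inl rfl)))]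
      · exact conn_through hA.conn₃ ht.att₂ hr.att₂
          (.inl (.inl (.inr (mem_seg hbn le_rfl))))
          (.inr (mem_seg hbn' le_rfl)) (fun v hv => .inl (.inr hv))
      · rintro v (hv | rfl)
        exacts [.inr hv, .inl (.inl (.inl (.inr rfl)))]
    · refine (hc.conn_stem (hlA (mem_seg le_rfl (Nat.zero_le _))) (.inl (.inl (.inl rfl)))).trans
        (((hl.path.connSet (Nat.zero_le _) le_rfl).2 (l 0) (mem_seg le_rfl (Nat.zero_le _)) (l m)
          (mem_seg (Nat.zero_le _) le_rfl)).mono hlA |>.trans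
        ((Conn.of_adj (hlA (mem_seg (Nat.zero_le _) le_rfl)) (hrA (mem_seg le_rfl (Nat.zero_le _)))
          hl.adj).trans (hc'.left.mono ?_).symm))
      rintro v (hv | rfl)
      exacts [hrA hv, .inl (.inl (.inr rfl))]
    · refine (hc.left.mono ?_).trans (Conn.trans ?_ (hc'.conn_stem
        (hlA' (mem_seg le_rfl (Nat.zero_le _))) (.inl (.inl (.inr rfl)))).symm)
      · rintro v (hv | rfl)
        exacts [htA hv, .inl (.inl (.inl rfl))]
      · exact (((hl'.path.connSet (Nat.zero_le _) le_rfl).2 (l' 0) (mem_seg le_rfl (Nat.zero_le _))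
          (l' m') (mem_seg (Nat.zero_le _) le_rfl)).mono hlA' |>.trans
          (.of_adj (hlA' (mem_seg (Nat.zero_le _) le_rfl)) (htA (mem_seg le_rfl (Nat.zero_le _)))
          hl'.adj)).symm
    · refine .union_left (.union_left (.union_left (.left_subset subset_rfl) ?_) ?_) ?_ <;>
        refine .union_right (.union_right (.right_subset subset_rfl) ?_) ?_
      · exact (hlt le_rfl).symm
      · exact htr'' le_rfl (hab'.trans hbn')
      · exact hA.anti₁₃.symm.off.mono subset_rfl hlP
      · rintro v hv _ ⟨k, -, hk, rfl⟩ - h2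
        refine ⟨fun h => hr.not_mem₂ k (by omega) (h ▸ hv), fun hadj => ?_⟩
        have := hr.eq₂ k (by omega) ⟨v, hv, hadj⟩
        exact h2 (.inr (by rw [show k = a' by omega]; exact hca' (by omega)))
      · rintro _ ⟨k, hk, hk', rfl⟩ v hv h1 -
        refine ⟨fun h => hr.not_mem₁ k (by omega) (h ▸ hlP hv), fun hadj => ?_⟩
        have := hr.eq₁ k (by omega) ⟨v, hlP hv, hadj.symm⟩
        exact h1 (.inr (by rw [show k = a' by omega]; exact hca' (by omega)))
      · rintro _ ⟨k, hk, hk', rfl⟩ _ ⟨k₂, -, hk₂, rfl⟩ h1 h2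
        have := hc'.anti' hk₂ hk hk' (fun h => h2 (.inr h)) (fun h => h1 (.inr h))
        exact ⟨this.1.symm, fun h => this.2 h.symm⟩
    · refine .union_left (.union_left (.union_left (.left_subset subset_rfl) ?_) ?_) ?_ <;>
        refine .union_right (.union_right (.right_subset subset_rfl) ?_) ?_
      · rintro _ ⟨k, hk, hk', rfl⟩ v hv h1 -
        refine ⟨fun h => ht.not_mem₁ k (by omega) (h ▸ hlQ hv), fun hadj => ?_⟩
        have := ht.eq₁ k (by omega) ⟨v, hlQ hv, hadj.symm⟩
        exact h1 (.inl (by rw [show k = a by omega]; exact hca (by omega)))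
      · rintro _ ⟨k, hk, hk', rfl⟩ _ ⟨k₂, -, hk₂, rfl⟩ h1 h2
        have := hc.anti' hk₂ hk hk' (fun h => h2 (.inl h)) (fun h => h1 (.inl h))
        exact ⟨this.1.symm, fun h => this.2 h.symm⟩
      · exact hA.anti₂₃.symm.off.mono subset_rfl hlQ
      · rintro v hv _ ⟨k, -, hk, rfl⟩ - h2
        refine ⟨fun h => ht.not_mem₂ k (by omega) (h ▸ hv), fun hadj => ?_⟩
        have := ht.eq₂ k (by omega) ⟨v, hv, hadj⟩
        exact h2 (.inl (by rw [show k = a by omega]; exact hca (by omega)))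
      · exact (hlr le_rfl).symm
      · exact (htr'' (hab.trans hbn) le_rfl).symm
    · refine .union_left (.union_left (.left_subset subset_rfl) ?_) ?_ <;>
        refine .union_right (.union_right (.right_subset subset_rfl) ?_) ?_
      · exact hA.anti₁₂.off.mono hlP hlQ
      · exact hlt (hab.trans hbn)
      · exact (hlr (hab'.trans hbn')).symm
      · exact (htr'' (hab.trans hbn) (hab'.trans hbn')).symm
  have hlP0 := hl.mem 0 (Nat.zero_le _)
  have hlQ0 := hl'.mem 0 (Nat.zero_le _)
  -- Exactly one of the centers lies on its path, since `P` and `Q`, and likewise `t` and `r`, are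
  -- anticomplete. If `l 0 ∈ P` is adjacent to `r a'`, then `a' = 0` because `P` touches `r` only at
  -- `r 0`, and `m = 0` because only the last vertex of the leg `l` is adjacent to `r 0`.
  rcases hc.cases with ⟨rfl, h1⟩ | ⟨rfl, h1⟩ <;> rcases hc'.cases with ⟨rfl, h2⟩ | ⟨rfl, h2⟩
  · have := hA.anti₁₂.apply hlP0 hlQ0
    exact absurd hclose (by simp [this])
  · have hadj : G.Adj (l 0) (r a') := hclose.resolve_left fun h =>
      hr.not_mem₁ a' (by omega) (h ▸ hlP0)
    have ha' := hr.eq₁ a' (by omega) ⟨_, hlP0, hadj⟩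
    subst ha'
    refine .inl ⟨(hl.eq_last 0 (Nat.zero_le _) hadj).symm, hc.many h1, ?_⟩
    rintro _ ⟨k, -, hk, rfl⟩ hadj'
    have := hc'.bound k hk hadj'
    rw [show k = 0 by omega]
  · have hadj : G.Adj (l' 0) (t a) := (hclose.resolve_left fun h =>
      ht.not_mem₁ a (by omega) (h ▸ hlQ0)).symm
    have ha := ht.eq₁ a (by omega) ⟨_, hlQ0, hadj⟩
    subst ha
    refine .inr ⟨(hl'.eq_last 0 (Nat.zero_le _) hadj).symm, hc'.many h2, ?_⟩
    rintro _ ⟨k, -, hk, rfl⟩ hadj'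
    have := hc.bound k hk hadj'
    rw [show k = 0 by omega]
  · have := htr' a (by omega) a' (by omega)
    exact absurd hclose (by simp [this])

/-- If `x` is short, then its connections inside `A₁` to a path `t` with middle set `A₁` are
trivial. -/
lemma leg_small (hG : NoTriangle G) (hth : ¬ G.ContainsInducedTheta) {A₁ A₂ A₃ : Set V}
    (hA : Tri G A₁ A₂ A₃) {n k m : ℕ} {x t l : ℕ → V} (hx : Mid G A₁ A₂ A₃ n x) (hn : n ≤ 1)
    (ht : Mid G A₂ A₃ A₁ k t) (hxt : Anti G ∅ (seg x 0 n) (seg t 0 k))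
    (hl : Leg G A₁ (seg t 0 k) (x 0) m l) : m = 0 ∧ Many G (seg t 0 k) (l 0) := by
  obtain ⟨m', l', hl'⟩ := exists_leg (T := seg x 0 n) hA.conn₃ (mem_seg le_rfl (Nat.zero_le _))
    hx.att₃ ht.att₂
  have htx : Anti G ∅ (seg (fun i => t (k - i)) 0 k) (seg x 0 n) := by
    rw [seg_zero_reverse]
    exact hxt.symm
  have := legs_of_two_mid hG hth hA.swap₂₃ ht.reverse hx htx (by rwa [seg_zero_reverse])
    (by simpa using hl')
  rw [seg_zero_reverse] at this
  rcases this with h | h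
  · exact ⟨h.1, h.2.1⟩
  · exact absurd h.2.1 (not_many_of_small hG hx.path hn)

lemma seg_zero_connSet {n : ℕ} {f : ℕ → V} (h : IPath G n f) : ConnSet G (seg f 0 n) :=
  h.connSet (Nat.zero_le _) le_rfl

/-- There is a path in `A₁` from `y 0` to `x 0` on which `t` has a neighbour. -/
lemma exists_touched_leg (hG : NoTriangle G) (hth : ¬ G.ContainsInducedTheta) {A₁ A₂ A₃ : Set V}
    (hA : Tri G A₁ A₂ A₃) {n m k : ℕ} {x y t : ℕ → V} (hx : Mid G A₁ A₂ A₃ n x) (hn : n ≤ 1)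
    (hy : Mid G A₁ A₂ A₃ m y) (ht : Mid G A₂ A₃ A₁ k t) (hxt : Anti G ∅ (seg x 0 n) (seg t 0 k))
    (hyt : Anti G ∅ (seg y 0 m) (seg t 0 k)) :
    ∃ N u, Leg G A₁ {y 0} (x 0) N u ∧ ∃ i, i ≤ N ∧ Att G (seg t 0 k) (u i) := by
  obtain ⟨h, l, hl⟩ := exists_leg (T := seg t 0 k) hA.conn₁ (mem_seg le_rfl (Nat.zero_le _)) ht.att₃
    hy.att₁
  -- If `l` meets the neighbourhood of `x 0`, an initial part of it is a leg towards `x 0`. By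
  -- `leg_small` that leg is the single vertex `l 0`, which has several neighbours on `t`. This
  -- excludes the second outcome of `legs_of_two_mid` for `t` and `y`, so `l` itself is a single
  -- vertex, adjacent to both `x 0` and `y 0`.
  by_cases htouch : ∃ i, i ≤ h ∧ G.Adj (l i) (x 0)
  · obtain ⟨i, hi, hli⟩ := hl.exists_take htouch
    obtain ⟨rfl, hmany⟩ := leg_small hG hth hA hx hn ht hxt hli
    obtain ⟨m', l', hl'⟩ := exists_leg (T := seg y 0 m) hA.conn₃ (mem_seg le_rfl (Nat.zero_le _))
      hy.att₃ ht.att₂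
    have hty : Anti G ∅ (seg (fun i => t (k - i)) 0 k) (seg y 0 m) := by
      rw [seg_zero_reverse]
      exact hyt.symm
    have hres := legs_of_two_mid hG hth hA.swap₂₃ ht.reverse hy hty (by rwa [seg_zero_reverse])
      (by simpa using hl')
    rw [seg_zero_reverse] at hres
    rcases hres with ⟨rfl, -, -⟩ | ⟨-, -, hone⟩
    · refine ⟨0, l, ⟨hl.path, hl.mem, ⟨y 0, rfl, hl.adj.symm⟩, hli.adj, fun i hi _ => by omega,
        fun i hi _ => by omega⟩, 0, le_rfl, hl.att⟩
    · obtain ⟨a, ha, b, hb, hab, ha', hb'⟩ := hmany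
      exact absurd ((hone a ha ha').trans (hone b hb hb').symm) hab
  · push Not at htouch
    -- Otherwise `l` is extended by a path `F` whose last vertex is the only neighbour of `x 0` in
    -- the union. By `leg_small` the leg from `t` to `x 0` inside the union is trivial, so that
    -- vertex touches `t`; every leg from `y 0` to `x 0` inside the union ends there.
    obtain ⟨s, hs, hsx⟩ := hx.att₁
    obtain ⟨f, F, hF, hFA, hF0, hFf, -, hFY⟩ := exists_path
      (hA.conn₁.2 (l 0) (hl.mem 0 (Nat.zero_le _)) s hs) (X := (· = l 0))
      (Y := fun v => G.Adj v (x 0)) rfl hsx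
    have hS : seg l 0 h ∪ seg F 0 f ⊆ A₁ := by
      rintro _ (⟨i, -, hi, rfl⟩ | ⟨i, -, hi, rfl⟩)
      exacts [hl.mem i hi, hFA i hi]
    have hSc : ConnSet G (seg l 0 h ∪ seg F 0 f) :=
      (seg_zero_connSet hl.path).union (seg_zero_connSet hF) (mem_seg le_rfl (Nat.zero_le _))
        (mem_seg le_rfl (Nat.zero_le _)) (.inl hF0.symm)
    have huniq : ∀ v ∈ seg l 0 h ∪ seg F 0 f, G.Adj v (x 0) → v = F f := by
      rintro _ (⟨i, -, hi, rfl⟩ | ⟨i, -, hi, rfl⟩) hadj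
      · exact absurd hadj (htouch i hi)
      · rw [hFY i hi hadj]
    have hFS : F f ∈ seg l 0 h ∪ seg F 0 f := .inr (mem_seg (Nat.zero_le _) le_rfl)
    obtain ⟨N, u, hu⟩ := exists_leg_of_conn (T := {y 0}) (hSc.2 (l h)
      (.inl (mem_seg (Nat.zero_le _) le_rfl)) (F f) hFS) ⟨y 0, rfl, hl.adj.symm⟩ hFf
    obtain ⟨m', v, hv⟩ := exists_leg_of_conn (hSc.2 (l 0)
      (.inl (mem_seg le_rfl (Nat.zero_le _))) (F f) hFS) hl.att hFf
    obtain ⟨rfl, -⟩ := leg_small hG hth hA hx hn ht hxt (hv.mono hS)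
    refine ⟨N, u, hu.mono hS, N, le_rfl, ?_⟩
    rw [huniq _ (hu.mem N le_rfl) hu.adj, ← huniq _ (hv.mem 0 le_rfl) hv.adj]
    exact hv.att

/-! ### The case of three long paths with distinct middle sets. -/

/-- Four pairwise anticomplete paths: a short one and a long one with the same middle set `A₃`, and
two long ones with middle sets `A₁` and `A₂`. -/
structure CrossConfig (G : SimpleGraph V) (A₁ A₂ A₃ : Set V) (n : ℕ) (x : ℕ → V) (m : ℕ)
    (y : ℕ → V) (k : ℕ) (t : ℕ → V) (k' : ℕ) (r : ℕ → V) : Prop where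
  tri : Tri G A₁ A₂ A₃
  midx : Mid G A₁ A₂ A₃ n x
  midy : Mid G A₁ A₂ A₃ m y
  midt : Mid G A₂ A₃ A₁ k t
  midr : Mid G A₁ A₃ A₂ k' r
  small : n ≤ 1
  bigy : 2 ≤ m
  bigt : 2 ≤ k
  bigr : 2 ≤ k'
  xy : Anti G ∅ (seg x 0 n) (seg y 0 m)
  xt : Anti G ∅ (seg x 0 n) (seg t 0 k)
  xr : Anti G ∅ (seg x 0 n) (seg r 0 k')
  yt : Anti G ∅ (seg y 0 m) (seg t 0 k)
  yr : Anti G ∅ (seg y 0 m) (seg r 0 k')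
  tr : Anti G ∅ (seg t 0 k) (seg r 0 k')

namespace CrossConfig

variable {A₁ A₂ A₃ : Set V} {n m k k' : ℕ} {x y t r : ℕ → V}

lemma reverse (h : CrossConfig G A₁ A₂ A₃ n x m y k t k' r) :
    CrossConfig G A₂ A₁ A₃ n (fun i => x (n - i)) m (fun i => y (m - i)) k' r k t where
  tri := h.tri.swap₁₂
  midx := h.midx.reverse
  midy := h.midy.reverse
  midt := h.midr
  midr := h.midt
  small := h.small
  bigy := h.bigy
  bigt := h.bigr
  bigr := h.bigt
  xy := by
    rw [seg_zero_reverse, seg_zero_reverse]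
    exact h.xy
  xt := by
    rw [seg_zero_reverse]
    exact h.xr
  xr := by
    rw [seg_zero_reverse]
    exact h.xt
  yt := by
    rw [seg_zero_reverse]
    exact h.yr
  yr := by
    rw [seg_zero_reverse]
    exact h.yt
  tr := h.tr.symm

/-- By `exists_touched_leg`, `t` touches a path `u` of `A₁` from `y 0` to `x 0`, and `r` touches a
path `v` of `A₂` from `y m` to `x n`. As `l` avoids the neighbours of `x 0`, the union of `t`, `l`
and `r` connects `u` and `v` without touching `x`. The centers `p` and `q` at the two ends of this
connection are joined by three routes, hence close, and they then form a hub for `x` and `y`. The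
vertex `y 0` is prepended to `u` because `l` may touch it. -/
lemma theta_of_untouched (hG : NoTriangle G) (hc : CrossConfig G A₁ A₂ A₃ n x m y k t k' r)
    {h : ℕ} {l : ℕ → V} (hl : Leg G A₁ (seg t 0 k) (r 0) h l)
    (hlx : ∀ i, i ≤ h → ¬ G.Adj (l i) (x 0)) : G.ContainsInducedTheta := by
  by_contra hth
  obtain ⟨hA, hx, hy, ht, hr, hn, hm, hk, hk', hxy, hxt, hxr, hyt, hyr, htr⟩ := id hc
  obtain ⟨N, u, hu, iu, hiu, _, ⟨it, -, hit, rfl⟩, hut⟩ :=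
    exists_touched_leg hG hth hA hx hn hy ht hxt hyt
  obtain ⟨M, v, hv, iv, hiv, _, ⟨ir, -, hir, rfl⟩, hvr⟩ := exists_touched_leg hG hth
    hc.reverse.tri hc.reverse.midx hn hc.reverse.midy hc.reverse.midt hc.reverse.xt hc.reverse.yt
  simp only [Nat.sub_zero] at hv
  have huy : ∀ i, i ≤ N → G.Adj (u i) (y 0) → i = 0 := fun i hi h =>
    hu.eq_zero i hi ⟨_, rfl, h.symm⟩
  have hvy : ∀ i, i ≤ M → G.Adj (v i) (y m) → i = 0 := fun i hi h =>
    hv.eq_zero i hi ⟨_, rfl, h.symm⟩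
  have huy0 : G.Adj (u 0) (y 0) := by
    obtain ⟨_, rfl, h⟩ := hu.att
    exact h.symm
  have hvy0 : G.Adj (v 0) (y m) := by
    obtain ⟨_, rfl, h⟩ := hv.att
    exact h.symm
  -- the path `u` preceded by `y 0`
  obtain ⟨w, hw0, hwS⟩ : ∃ w : ℕ → V, w 0 = y 0 ∧ ∀ i, w (i + 1) = u i :=
    ⟨fun i => Nat.casesOn i (y 0) u, rfl, fun _ => rfl⟩
  have hwpos : ∀ i, 0 < i → w i = u (i - 1) := fun i hi => by
    rw [← hwS, Nat.sub_add_cancel hi]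
  have hw : IPath G (N + 1) w := by
    refine ⟨fun i j hi hj hij => ?_, fun i hi => ?_, fun i j hi hj hij => ?_⟩
    · rcases i with _ | i <;> rcases j with _ | j
      · rfl
      · rw [hw0, hwS] at hij
        exact absurd (hij ▸ hu.mem j (by omega)) (hy.not_mem₁ 0 (Nat.zero_le _))
      · rw [hw0, hwS] at hij
        exact absurd (hij ▸ hu.mem i (by omega)) (hy.not_mem₁ 0 (Nat.zero_le _))
      · rw [hwS, hwS] at hij
        rw [hu.path.inj i j (by omega) (by omega) hij]
    · rcases i with _ | i
      · rw [hw0, hwS]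
        exact huy0.symm
      · rw [hwS, hwS]
        exact hu.path.adj i (by omega)
    · rcases i with _ | i <;> rcases j with _ | j
      · exact absurd hij (G.loopless.irrefl _)
      · rw [hw0, hwS] at hij
        have := huy j (by omega) hij.symm
        omega
      · rw [hw0, hwS] at hij
        have := huy i (by omega) hij
        omega
      · rw [hwS, hwS] at hij
        have := hu.path.nadj i j (by omega) (by omega) hij
        omega
  have hwA : ∀ i, i ≤ N + 1 → 0 < i → w i ∈ A₁ := fun i hi h0 => by
    rw [hwpos i h0]
    exact hu.mem _ (by omega)
  have hwA' : ∀ i, i ≤ N + 1 → w i = y 0 ∨ w i ∈ A₁ := fun i hi => by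
    rcases Nat.eq_zero_or_pos i with rfl | h0
    exacts [.inl hw0, .inr (hwA i hi h0)]
  have hwx : ∀ i, i ≤ N + 1 → ∀ j, j ≤ n → w i ≠ x j ∧ (G.Adj (w i) (x j) → i = N + 1) := by
    intro i hi j hj
    rcases Nat.eq_zero_or_pos i with rfl | h0
    · have := hxy.apply (mem_seg (Nat.zero_le _) hj) (mem_seg le_rfl (Nat.zero_le _))
      rw [hw0]
      exact ⟨this.1.symm, fun h => absurd h.symm this.2⟩
    · refine ⟨fun h => hx.not_mem₁ j hj (h ▸ hwA i hi h0), fun hadj => ?_⟩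
      have := hx.eq₁ j hj ⟨_, hwA i hi h0, hadj⟩
      subst this
      rw [hwpos i h0] at hadj
      have := hu.eq_last (i - 1) (by omega) hadj
      omega
  have hvx : ∀ i, i ≤ M → ∀ j, j ≤ n → v i ≠ x j ∧ (G.Adj (v i) (x j) → i = M) := by
    intro i hi j hj
    refine ⟨fun h => hx.not_mem₂ j hj (h ▸ hv.mem i hi), fun hadj => ?_⟩
    have := hx.eq₂ j hj ⟨_, hv.mem i hi, hadj⟩
    subst this
    exact hv.eq_last i hi hadj
  have hvy' : ∀ i, i ≤ M → ∀ j, j ≤ m → v i ≠ y j ∧ (G.Adj (v i) (y j) → i = 0) := by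
    intro i hi j hj
    refine ⟨fun h => hy.not_mem₂ j hj (h ▸ hv.mem i hi), fun hadj => ?_⟩
    have := hy.eq₂ j hj ⟨_, hv.mem i hi, hadj⟩
    subst this
    exact hvy i hi hadj
  have hwv : ∀ i, i ≤ N + 1 → ∀ j, j ≤ M → w i ≠ v j ∧ ¬ G.Adj (w i) (v j) := by
    intro i hi j hj
    rcases hwA' i hi with h1 | h1
    · rw [h1]
      refine ⟨fun h => hy.not_mem₂ 0 (Nat.zero_le _) (h ▸ hv.mem j hj), fun hadj => ?_⟩
      have := hy.eq₂ 0 (Nat.zero_le _) ⟨_, hv.mem j hj, hadj.symm⟩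
      omega
    · exact hA.anti₁₂.apply h1 (hv.mem j hj)
  -- a path from `w` to `v` through `t`, `l` and `r`
  have hS : ConnSet G (seg t 0 k ∪ seg l 0 h ∪ seg r 0 k') := by
    obtain ⟨s, hs, hsl⟩ := hl.att
    exact ((seg_zero_connSet ht.path).union (seg_zero_connSet hl.path) hs
      (mem_seg le_rfl (Nat.zero_le _)) (.inr hsl)).union (seg_zero_connSet hr.path)
      (.inr (mem_seg (Nat.zero_le _) le_rfl)) (mem_seg le_rfl (Nat.zero_le _)) (.inr hl.adj)
  have hrw : r ir ∉ seg w 0 (N + 1) := by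
    rintro ⟨i, -, hi, hwr⟩
    rcases hwA' i hi with h1 | h1
    · exact (hyr.apply (mem_seg le_rfl (Nat.zero_le _)) (mem_seg (Nat.zero_le _) hir)).1
        (h1.symm.trans hwr)
    · exact hr.not_mem₁ ir hir (hwr ▸ h1)
  -- Walking from the contact of `r` with `v` towards the contact of `t` with `u`, stop as soon as
  -- `w` is touched; the piece obtained avoids `w` itself.
  obtain ⟨a₀, ha₀, ha₀w⟩ := (hS.2 (r ir) (.inr (mem_seg (Nat.zero_le _) hir)) (t it)
    (.inl (.inl (mem_seg (Nat.zero_le _) hit)))).exists_touch hrw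
    (.inr ⟨u iu, ⟨iu + 1, by omega, by omega, hwS iu⟩, hut.symm⟩)
  obtain ⟨g, c, hcp, hcS, hc0, hcg, hcX, hcY⟩ := exists_path ha₀.symm
    (X := Att G (seg w 0 (N + 1))) (Y := Att G (seg v 0 M)) ha₀w
    ⟨v iv, mem_seg (Nat.zero_le _) hiv, hvr.symm⟩
  have hctype : ∀ i, i ≤ g → c i ∈ seg t 0 k ∨ c i ∈ seg r 0 k' ∨ c i ∈ seg l 0 h := by
    intro i hi
    rcases (hcS i hi).1 with (h1 | h1) | h1
    exacts [.inl h1, .inr (.inr h1), .inr (.inl h1)]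
  have hlA : seg l 0 h ⊆ A₁ := by
    rintro _ ⟨i, -, hi, rfl⟩
    exact hl.mem i hi
  have hcw : ∀ i, i ≤ g → ∀ j, j ≤ N + 1 → w j ≠ c i := fun i hi j hj h =>
    (hcS i hi).2 (h ▸ mem_seg (Nat.zero_le _) hj)
  have hcA₂ : ∀ i, i ≤ g → c i ∉ A₂ := by
    intro i hi hmem
    rcases hctype i hi with ⟨j, -, hj, h1⟩ | ⟨j, -, hj, h1⟩ | h1
    · exact ht.not_mem₁ j hj (h1 ▸ hmem)
    · exact hr.not_mem₃ j hj (h1 ▸ hmem)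
    · exact (hA.anti₁₂.apply (hlA h1) hmem).1 rfl
  have hcv : ∀ i, i ≤ g → ∀ j, j ≤ M → v j ≠ c i := fun i hi j hj h =>
    hcA₂ i hi (h ▸ hv.mem j hj)
  have hcx : ∀ i, i ≤ g → ∀ j, j ≤ n → c i ≠ x j ∧ ¬ G.Adj (c i) (x j) := by
    intro i hi j hj
    rcases hctype i hi with h1 | h1 | ⟨s, -, hs, h1⟩
    · exact hxt.symm.apply h1 (mem_seg (Nat.zero_le _) hj)
    · exact hxr.symm.apply h1 (mem_seg (Nat.zero_le _) hj)
    · rw [← h1]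
      refine ⟨fun h' => hx.not_mem₁ j hj (h' ▸ hl.mem s hs), fun hadj => ?_⟩
      have := hx.eq₁ j hj ⟨_, hl.mem s hs, hadj⟩
      subst this
      exact hlx s hs hadj
  have hcy : ∀ i, i ≤ g → ∀ j, j ≤ m → c i ≠ y j ∧ (G.Adj (c i) (y j) → j = 0) := by
    intro i hi j hj
    rcases hctype i hi with h1 | h1 | h1
    · have := hyt.symm.apply h1 (mem_seg (Nat.zero_le _) hj)
      exact ⟨this.1, fun h => absurd h this.2⟩
    · have := hyr.symm.apply h1 (mem_seg (Nat.zero_le _) hj)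
      exact ⟨this.1, fun h => absurd h this.2⟩
    · exact ⟨fun h' => hy.not_mem₁ j hj (h' ▸ hlA h1), fun hadj => hy.eq₁ j hj ⟨_, hlA h1, hadj⟩⟩
  obtain ⟨_, ⟨iw, -, hiw, rfl⟩, hiwc⟩ := hc0
  obtain ⟨_, ⟨jv, -, hjv, rfl⟩, hjvc⟩ := id hcg
  obtain ⟨p, a, b, hp⟩ := exists_center hG hw (hcw 0 (Nat.zero_le _)) hiw hiwc.symm
  obtain ⟨q, a', b', hq⟩ := exists_center hG hv.path (hcv g le_rfl) hjv hjvc.symm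
  have hab := hp.le
  have hbN := hp.le_len
  have hab' := hq.le
  have hbM := hq.le_len
  have hpeq : a = b → w a = p := fun h => by
    rcases hp.cases with h1 | h1
    · omega
    · exact h1.1.symm
  have hqeq : a' = b' → v a' = q := fun h => by
    rcases hq.cases with h1 | h1
    · omega
    · exact h1.1.symm
  -- the pieces of `w` and `v` against `x` and `y`
  have Hww : Anti G {p, q} (seg w b (N + 1)) (seg w 0 a) := by
    rintro _ ⟨i, hi, hi', rfl⟩ _ ⟨j, -, hj, rfl⟩ h1 h2
    have := hp.anti' hj hi hi' (fun h => h2 (.inl h)) (fun h => h1 (.inl h))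
    exact ⟨this.1.symm, fun h => this.2 h.symm⟩
  have Hvv : Anti G {p, q} (seg v b' M) (seg v 0 a') := by
    rintro _ ⟨i, hi, hi', rfl⟩ _ ⟨j, -, hj, rfl⟩ h1 h2
    have := hq.anti' hj hi hi' (fun h => h2 (.inr h)) (fun h => h1 (.inr h))
    exact ⟨this.1.symm, fun h => this.2 h.symm⟩
  have Hxw : Anti G {p, q} (seg x 0 n) (seg w 0 a) := by
    rintro _ ⟨j, -, hj, rfl⟩ _ ⟨i, -, hi, rfl⟩ - h2
    refine ⟨(hwx i (by omega) j hj).1.symm, fun hadj => ?_⟩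
    have := (hwx i (by omega) j hj).2 hadj.symm
    exact h2 (.inl (by rw [show i = a by omega]; exact hpeq (by omega)))
  have Hxv : Anti G {p, q} (seg x 0 n) (seg v 0 a') := by
    rintro _ ⟨j, -, hj, rfl⟩ _ ⟨i, -, hi, rfl⟩ - h2
    refine ⟨(hvx i (by omega) j hj).1.symm, fun hadj => ?_⟩
    have := (hvx i (by omega) j hj).2 hadj.symm
    exact h2 (.inr (by rw [show i = a' by omega]; exact hqeq (by omega)))
  have Hvy : Anti G {p, q} (seg v b' M) (seg y 0 m) := by
    rintro _ ⟨i, hi, hi', rfl⟩ _ ⟨j, -, hj, rfl⟩ h1 -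
    refine ⟨(hvy' i hi' j hj).1, fun hadj => ?_⟩
    have := (hvy' i hi' j hj).2 hadj
    exact h1 (.inr (by rw [show i = a' by omega]; exact hqeq (by omega)))
  have Hwy : Anti G {p, q} (seg w b (N + 1)) (seg y 0 m) := by
    rintro _ ⟨i, hi, hi', rfl⟩ _ ⟨j, -, hj, rfl⟩ h1 h2
    have hip : w i ≠ p := fun h => h1 (.inl h)
    rcases Nat.eq_zero_or_pos j with rfl | hj0
    · have := hp.anti' (Nat.zero_le a) hi hi' (fun h => h2 (.inl (hw0 ▸ h))) hip
      rw [hw0] at this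
      exact ⟨this.1.symm, fun h => this.2 h.symm⟩
    · rcases Nat.eq_zero_or_pos i with rfl | hi0
      · exact absurd (by rw [show 0 = a by omega]; exact hpeq (by omega)) hip
      · refine ⟨fun h => hy.not_mem₁ j hj (h ▸ hwA i hi' hi0), fun hadj => ?_⟩
        have := hy.eq₁ j hj ⟨_, hwA i hi' hi0, hadj⟩
        omega
  have hwuN : w (N + 1) = u N := hwS N
  -- The three routes from `p` to `q` run along `w`, `x` and `v`; along `w` back to `y 0`, then `y`
  -- and `v`; and along `c`.
  have hclose : p = q ∨ G.Adj p q := by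
    by_contra! hcon
    have Hcw : ∀ {i j}, j ≤ N + 1 → Anti G {p, q} (seg c 0 g) (seg w i j) := by
      rintro i j hj _ ⟨s, -, hs, rfl⟩ _ ⟨s', -, hs', rfl⟩ h1 h2
      refine ⟨(hcw s hs s' (by omega)).symm, fun hadj => ?_⟩
      have := hcX s hs ⟨_, mem_seg (Nat.zero_le _) (by omega), hadj.symm⟩
      subst this
      rcases hp.eq_of_adj (by omega) hadj with h | h
      exacts [h1 (.inl h), h2 (.inl h)]
    have Hcv : ∀ {i j}, j ≤ M → Anti G {p, q} (seg c 0 g) (seg v i j) := by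
      rintro i j hj _ ⟨s, -, hs, rfl⟩ _ ⟨s', -, hs', rfl⟩ h1 h2
      refine ⟨(hcv s hs s' (by omega)).symm, fun hadj => ?_⟩
      have := hcY s hs ⟨_, mem_seg (Nat.zero_le _) (by omega), hadj.symm⟩
      subst this
      rcases hq.eq_of_adj (by omega) hadj with h | h
      exacts [h1 (.inr h), h2 (.inr h)]
    have Hcx : Anti G {p, q} (seg c 0 g) (seg x 0 n) := by
      rintro _ ⟨s, -, hs, rfl⟩ _ ⟨s', -, hs', rfl⟩ - -
      exact hcx s hs s' hs'
    have Hcy : Anti G {p, q} (seg c 0 g) (seg y 0 m) := by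
      rintro _ ⟨s, -, hs, rfl⟩ _ ⟨s', -, hs', rfl⟩ h1 h2
      refine ⟨(hcy s hs s' hs').1, fun hadj => ?_⟩
      have := (hcy s hs s' hs').2 hadj
      subst this
      exact (Hcw (i := 0) le_rfl (c s) (mem_seg (Nat.zero_le _) hs) (w 0) (mem_seg le_rfl
        (Nat.zero_le _)) h1 (hw0 ▸ h2)).2 (hw0 ▸ hadj)
    have Hwv : ∀ {i j i' j'}, j ≤ N + 1 → j' ≤ M → Anti G {p, q} (seg w i j) (seg v i' j') := by
      rintro i j i' j' hj hj' _ ⟨s, -, hs, rfl⟩ _ ⟨s', -, hs', rfl⟩ - -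
      exact hwv s (by omega) s' (by omega)
    have hwK : seg w b (N + 1) ⊆ {p, q} ∪ seg w b (N + 1) ∪ seg x 0 n ∪ seg v b' M :=
      fun v hv => .inl (.inl (.inr hv))
    have hxK : seg x 0 n ⊆ {p, q} ∪ seg w b (N + 1) ∪ seg x 0 n ∪ seg v b' M :=
      fun v hv => .inl (.inr hv)
    have hvK : seg v b' M ⊆ {p, q} ∪ seg w b (N + 1) ∪ seg x 0 n ∪ seg v b' M :=
      fun v hv => .inr hv
    have hwK' : seg w 0 a ⊆ {p, q} ∪ seg w 0 a ∪ seg y 0 m ∪ seg v 0 a' :=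
      fun v hv => .inl (.inl (.inr hv))
    have hyK' : seg y 0 m ⊆ {p, q} ∪ seg w 0 a ∪ seg y 0 m ∪ seg v 0 a' :=
      fun v hv => .inl (.inr hv)
    have hvK' : seg v 0 a' ⊆ {p, q} ∪ seg w 0 a ∪ seg y 0 m ∪ seg v 0 a' :=
      fun v hv => .inr hv
    have hx0 : x 0 ∈ seg x 0 n := mem_seg le_rfl (Nat.zero_le _)
    have hxn : x n ∈ seg x 0 n := mem_seg (Nat.zero_le _) le_rfl
    have hy0 : y 0 ∈ seg y 0 m := mem_seg le_rfl (Nat.zero_le _)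
    have hym : y m ∈ seg y 0 m := mem_seg (Nat.zero_le _) le_rfl
    have hc0' : c 0 ∈ {p, q} ∪ seg c 0 g := .inr (mem_seg le_rfl (Nat.zero_le _))
    have hcg' : c g ∈ {p, q} ∪ seg c 0 g := .inr (mem_seg (Nat.zero_le _) le_rfl)
    refine hth (theta_of_conn₃ hcon.1 hcon.2
      (K₁ := {p, q} ∪ seg w b (N + 1) ∪ seg x 0 n ∪ seg v b' M)
      (K₂ := {p, q} ∪ seg w 0 a ∪ seg y 0 m ∪ seg v 0 a') (K₃ := {p, q} ∪ seg c 0 g)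
      ?_ ?_ ?_ ?_ ?_ ?_)
    · refine (hp.right.mono ?_).trans ((Conn.of_adj (hwK (mem_seg hbN le_rfl)) (hxK hx0)
        (hwuN ▸ hu.adj)).trans ((((seg_zero_connSet hx.path).2 _ hx0 _ hxn).mono hxK).trans
        ((Conn.of_adj (hxK hxn) (hvK (mem_seg hbM le_rfl)) hv.adj.symm).trans
        (hq.right.mono ?_).symm)))
      · rintro v (hv | rfl)
        exacts [hwK hv, .inl (.inl (.inl (.inl rfl)))]
      · rintro v (hv | rfl)
        exacts [hvK hv, .inl (.inl (.inl (.inr rfl)))]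
    · have h1 : Conn G ({p, q} ∪ seg w 0 a ∪ seg y 0 m ∪ seg v 0 a') p (y 0) := by
        rw [← hw0]
        refine hp.left.mono ?_
        rintro v (hv | rfl)
        exacts [hwK' hv, .inl (.inl (.inl (.inl rfl)))]
      refine h1.trans ((((seg_zero_connSet hy.path).2 _ hy0 _ hym).mono hyK').trans
        ((Conn.of_adj (hyK' hym) (hvK' (mem_seg le_rfl (Nat.zero_le _))) hvy0.symm).trans
        (hq.left.mono ?_).symm))
      rintro v (hv | rfl)
      exacts [hvK' hv, .inl (.inl (.inl (.inr rfl)))]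
    · exact (hp.conn_stem hc0' (.inl (.inl rfl))).trans ((((seg_zero_connSet hcp).2 _
        (mem_seg le_rfl (Nat.zero_le _)) _ (mem_seg (Nat.zero_le _) le_rfl)).mono
        Set.subset_union_right).trans (hq.conn_stem hcg' (.inl (.inr rfl))).symm)
    · refine .union_left (.union_left (.union_left (.left_subset subset_rfl) ?_) ?_) ?_ <;>
        refine .union_right (.union_right (.union_right (.right_subset subset_rfl) ?_) ?_) ?_
      exacts [Hww, Hwy, Hwv le_rfl (hab'.trans hbM), Hxw, hxy.off, Hxv,
        (Hwv (hab.trans hbN) le_rfl).symm, Hvy, Hvv]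
    · refine .union_right (.right_subset subset_rfl) (.union_left (.union_left (.union_left
        (.left_subset subset_rfl) ?_) ?_) ?_)
      exacts [(Hcw le_rfl).symm, Hcx.symm, (Hcv le_rfl).symm]
    · refine .union_right (.right_subset subset_rfl) (.union_left (.union_left (.union_left
        (.left_subset subset_rfl) ?_) ?_) ?_)
      exacts [(Hcw (hab.trans hbN)).symm, Hcy.symm, (Hcv (hab'.trans hbM)).symm]
  -- `c g` lies on `t` or `r`
  obtain ⟨sv, hsv, hsvc⟩ := hcg
  have hsvA : sv ∈ A₂ := by
    obtain ⟨i, -, hi, rfl⟩ := hsv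
    exact hv.mem i hi
  have hcgA₂ : Att G A₂ (c g) := ⟨sv, hsvA, hsvc⟩
  have hcgtype : c g ∈ seg t 0 k ∨ c g ∈ seg r 0 k' := by
    rcases hctype g le_rfl with h1 | h1 | h1
    · exact .inl h1
    · exact .inr h1
    · exact absurd hsvc.symm (hA.anti₁₂.apply (hlA h1) hsvA).2
  have hcgx : ∀ z ∈ seg x 0 n, c g ≠ z ∧ ¬ G.Adj (c g) z := by
    rintro _ ⟨j, -, hj, rfl⟩
    exact hcx g le_rfl j hj
  have hcgy : ∀ z ∈ seg y 0 m, c g ≠ z ∧ ¬ G.Adj (c g) z := by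
    intro z hz
    rcases hcgtype with h1 | h1
    exacts [hyt.symm.apply h1 hz, hyr.symm.apply h1 hz]
  have hcgA₁ : c g ∉ A₁ := by
    intro hmem
    exact (hA.anti₁₂.apply hmem hsvA).2 hsvc.symm
  have hpA₁ : p = c 0 → p ≠ w a → Att G A₁ (c 0) := by
    intro h1 h2
    rcases hp.cases with h3 | h3
    · exact ⟨w b, hwA b hbN (by omega), hp.adj_right.symm⟩
    · exact absurd h3.1 h2
  -- If `q` lies on `v`, then `p` is not on `w`, which is anticomplete to `v`. So `p = c 0`, and its
  -- adjacency to `q` forces `g = 0`, since only the last vertex of `c` touches `v`.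
  have hq_cases : q = c g ∨ (q = v a' ∧ p = c 0 ∧ g = 0 ∧ p ≠ w a ∧ p ≠ q) := by
    rcases hq.cases with h1 | h1
    · exact .inl h1.1
    refine .inr ⟨h1.1, ?_⟩
    have hwq : p ≠ w a := by
      intro h2
      have := hwv a (by omega) a' (by omega)
      rw [← h1.1, ← h2] at this
      exact absurd hclose (by simp [this])
    have hpc : p = c 0 := by
      rcases hp.cases with h2 | h2
      · exact h2.1
      · exact absurd h2.1 hwq
    have hne : p ≠ q := fun h2 => hcA₂ 0 (Nat.zero_le _) (by
      rw [← hpc, h2, h1.1]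
      exact hv.mem a' (by omega))
    have hadj := hclose.resolve_left hne
    rw [hpc, h1.1] at hadj
    exact ⟨hpc, (hcY 0 (Nat.zero_le _) ⟨_, mem_seg (Nat.zero_le _) (by omega), hadj.symm⟩).symm,
      hwq, hne⟩
  have hq_cases' : q = c g → p = q ∨ (G.Adj p q ∧ (p = c 0 ∨ p ∈ A₁)) := by
    intro h1
    rcases hclose with h2 | h2
    · exact .inl h2
    refine .inr ⟨h2, ?_⟩
    rcases hp.cases with h3 | h3
    · exact .inl h3.1
    · rcases hwA' a (by omega) with h4 | h4
      · rw [h3.1, h4, h1] at h2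
        exact absurd h2.symm (hcgy _ (mem_seg le_rfl (Nat.zero_le _))).2
      · exact .inr (h3.1 ▸ h4)
  have hpy : p ≠ y 0 := by
    intro h1
    rcases hq_cases with h2 | h2
    · have h3 := hcgy _ (mem_seg (i := 0) le_rfl (Nat.zero_le _))
      rw [h1, h2] at hclose
      rcases hclose with h4 | h4
      exacts [h3.1 h4.symm, h3.2 h4.symm]
    · have h3 := hcgy _ (mem_seg (i := 0) le_rfl (Nat.zero_le _))
      rw [h2.2.2.1, ← h2.2.1] at h3
      exact h3.1 h1
  have hb0 : 0 < b := by
    by_contra h0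
    exact hpy (by rw [← hw0, ← hpeq (by omega), show a = 0 by omega])
  have hnA : ∀ {z}, z ∈ A₁ → z ∉ A₃ ∧ ¬ Att G A₃ z := fun hz =>
    ⟨fun h' => (hA.anti₁₃.apply hz h').1 rfl, fun ⟨s, hs, hsz⟩ => (hA.anti₁₃.apply hz hs).2 hsz.symm⟩
  have htk : ∀ z ∈ seg t 0 k, Att G A₃ z → z = t k := by
    rintro _ ⟨j, -, hj, rfl⟩ h1
    rw [ht.eq₂ j hj h1]
  have hrk : ∀ z ∈ seg r 0 k', Att G A₃ z → z = r k' := by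
    rintro _ ⟨j, -, hj, rfl⟩ h1
    rw [hr.eq₂ j hj h1]
  have htkA : ∀ z ∈ seg t 0 k, z = t k ∨ G.Adj z (t k) → ¬ Att G A₂ z := by
    rintro _ ⟨j, -, hj, rfl⟩ h1 h2
    have := ht.eq₁ j hj h2
    subst this
    rcases h1 with h1 | h1
    · have := ht.path.inj 0 k (by omega) le_rfl h1
      omega
    · have := ht.path.nadj 0 k (by omega) le_rfl h1
      omega
  have hrkA : ∀ z ∈ seg r 0 k', z = r k' ∨ G.Adj z (r k') → ¬ Att G A₁ z := by
    rintro _ ⟨j, -, hj, rfl⟩ h1 h2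
    have := hr.eq₁ j hj h2
    subst this
    rcases h1 with h1 | h1
    · have := hr.path.inj 0 k' (by omega) le_rfl h1
      omega
    · have := hr.path.nadj 0 k' (by omega) le_rfl h1
      omega
  have htk_mem : t k ∈ seg t 0 k := mem_seg (Nat.zero_le _) le_rfl
  have hrk_mem : r k' ∈ seg r 0 k' := mem_seg (Nat.zero_le _) le_rfl
  have hrkA₁ : ∀ z ∈ A₁, ¬ G.Adj z (r k') := fun z hz hadj => by
    have := hr.eq₁ k' le_rfl ⟨z, hz, hadj⟩
    omega
  have hseg₃ : ∀ z, z ∈ seg t 0 k ∨ z ∈ seg r 0 k' → z ∉ A₃ := by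
    rintro z (⟨j, -, hj, rfl⟩ | ⟨j, -, hj, rfl⟩)
    exacts [ht.not_mem₂ j hj, hr.not_mem₂ j hj]
  have hpw : p ≠ w a → p = c 0 := fun h1 => by
    rcases hp.cases with h2 | h2
    · exact h2.1
    · exact absurd h2.1 h1
  have hwaA : p = w a → p ∈ A₁ := fun h1 => by
    rcases hwA' a (by omega) with h2 | h2
    · exact absurd (h1.trans h2) hpy
    · exact h1 ▸ h2
  -- On `t` and `r`, only `t k` and `r k'` touch `A₃`. Since `c g` touches `A₂`, it can lie on `t`
  -- only as `t 0`; and if `p = c 0` is not on `w`, it touches `A₁`, so it can lie on `r` only as `r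
  -- 0`. As `t` and `r` are long, these ends are neither equal nor adjacent to `t k` and `r k'`.
  have hp₃ : p ∉ A₃ ∧ ¬ Att G A₃ p := by
    by_cases h1 : p = w a
    · exact hnA (hwaA h1)
    have hpc := hpw h1
    have hatt := hpA₁ hpc h1
    rcases hctype 0 (Nat.zero_le _) with h2 | h2 | h2
    · rw [hpc]
      refine ⟨hseg₃ _ (.inl h2), fun h3 => ?_⟩
      have h4 := htk _ h2 h3
      rcases hq_cases with h5 | h5
      · rw [hpc, h4, h5] at hclose
        rcases hcgtype with h6 | h6
        · exact htkA _ h6 (hclose.imp Eq.symm Adj.symm) hcgA₂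
        · have := htr.apply htk_mem h6
          exact absurd hclose (by simp [this])
      · have := htkA _ h2 (.inl h4)
        rw [← h5.2.2.1] at this
        exact this hcgA₂
    · rw [hpc]
      exact ⟨hseg₃ _ (.inr h2), fun h3 => hrkA _ h2 (.inl (hrk _ h2 h3)) hatt⟩
    · rw [hpc]
      exact hnA (hlA h2)
  have hq₃ : q ∉ A₃ ∧ ¬ Att G A₃ q := by
    rcases hq_cases with h1 | h1
    · rw [h1]
      refine ⟨hseg₃ _ hcgtype, fun h2 => ?_⟩
      rcases hcgtype with h3 | h3
      · exact htkA _ h3 (.inl (htk _ h3 h2)) hcgA₂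
      · have h4 := hrk _ h3 h2
        rw [h1, h4] at hclose
        by_cases h5 : p = w a
        · rcases hclose with h6 | h6
          · exact hr.not_mem₁ k' le_rfl (h6 ▸ hwaA h5)
          · exact hrkA₁ _ (hwaA h5) h6
        · have hpc := hpw h5
          have hatt := hpA₁ hpc h5
          rw [hpc] at hclose
          rcases hctype 0 (Nat.zero_le _) with h7 | h7 | h7
          · have := htr.apply h7 hrk_mem
            exact absurd hclose (by simp [this])
          · exact hrkA _ h7 hclose hatt
          · rcases hclose with h6 | h6
            · exact hr.not_mem₁ k' le_rfl (h6 ▸ hlA h7)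
            · exact hrkA₁ _ (hlA h7) h6
    · have hqA : q ∈ A₂ := h1.1 ▸ hv.mem a' (by omega)
      exact ⟨fun h' => (hA.anti₂₃.apply hqA h').1 rfl,
        fun ⟨s, hs, hsz⟩ => (hA.anti₂₃.apply hqA hs).2 hsz.symm⟩
  have hx0 : x 0 ∈ seg x 0 n := mem_seg le_rfl (Nat.zero_le _)
  have hxn : x n ∈ seg x 0 n := mem_seg (Nat.zero_le _) le_rfl
  have hym : y m ∈ seg y 0 m := mem_seg (Nat.zero_le _) le_rfl
  refine hth (Hub.theta hG hA hx hy hxy (p := p) (q := q) (X₁ := seg w b (N + 1) ∪ {x 0})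
    (Y₁ := seg w 0 a) (X₂ := seg v b' M ∪ {x n}) (Y₂ := seg v 0 a' ∪ {y m})
    ⟨?_, ?_, ?_, ?_, .inr rfl, ?_, .inr rfl, .inr rfl, ?_, ?_, ?_, ?_, ?_, ?_, hp₃, hq₃, ?_⟩)
  · rintro _ (⟨i, hi, hi', rfl⟩ | rfl)
    exacts [.inr (hwA i hi' (by omega)), .inl rfl]
  · rintro _ ⟨i, hi, hi', rfl⟩
    exact hwA' i (by omega)
  · rintro _ (⟨i, hi, hi', rfl⟩ | rfl)
    exacts [.inr (hv.mem i hi'), .inl rfl]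
  · rintro _ (⟨i, hi, hi', rfl⟩ | rfl)
    exacts [.inr (hv.mem i (by omega)), .inl rfl]
  · exact ⟨0, le_rfl, Nat.zero_le _, hw0⟩
  · refine (hp.right.mono ?_).trans (.of_adj (.inl (.inl (mem_seg hbN le_rfl))) (.inl (.inr rfl))
      (hwuN ▸ hu.adj))
    exact Set.union_subset_union_left _ Set.subset_union_left
  · exact hw0 ▸ hp.left
  · refine (hq.right.mono ?_).trans (.of_adj (.inl (.inl (mem_seg hbM le_rfl))) (.inl (.inr rfl))
      hv.adj)
    exact Set.union_subset_union_left _ Set.subset_union_left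
  · refine (hq.left.mono ?_).trans (.of_adj (.inl (.inl (mem_seg le_rfl (Nat.zero_le _))))
      (.inl (.inr rfl)) hvy0)
    exact Set.union_subset_union_left _ Set.subset_union_left
  · exact Hww.union_left (Hxw.mono (Set.singleton_subset_iff.2 hx0) subset_rfl)
  · refine .union_left (.union_right Hvv (Hvy.mono subset_rfl (Set.singleton_subset_iff.2 hym)))
      ((Hxv.union_right ?_).mono (Set.singleton_subset_iff.2 hxn) subset_rfl)
    exact hxy.off.mono subset_rfl (Set.singleton_subset_iff.2 hym)
  · rcases hq_cases with h1 | h1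
    · rcases hq_cases' h1 with h2 | ⟨h2, -⟩
      · exact .inl h2
      refine .inr (.inl ⟨h2, ?_⟩)
      have hcgw : ∀ {i j}, j ≤ N + 1 → ∀ z ∈ seg w i j, z ≠ p → c g ≠ z ∧ ¬ G.Adj (c g) z := by
        rintro i j hj _ ⟨s, -, hs, rfl⟩ hzp
        refine ⟨(hcw g le_rfl s (by omega)).symm, fun hadj => ?_⟩
        have h0 := hcX g le_rfl ⟨_, mem_seg (Nat.zero_le _) (by omega), hadj.symm⟩
        rw [h0] at hadj h1
        rcases hp.eq_of_adj (by omega) hadj with h3 | h3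
        · exact h2.ne (h3.symm.trans h1.symm)
        · exact hzp h3
      rw [h1]
      rintro z (((hz | hz) | (hz | rfl)) | hz) hzp
      exacts [hcgx z hz, hcgy z hz, hcgw le_rfl z hz hzp, hcgx _ hx0,
        hcgw (hab.trans hbN) z hz hzp]
    · obtain ⟨-, hpc, hg0, -, hne⟩ := h1
      refine .inr (.inr ⟨hclose.resolve_left hne, ?_⟩)
      have hpc' : p = c g := by rw [hpc, hg0]
      have hcgv : ∀ {i j}, j ≤ M → ∀ z ∈ seg v i j, z ≠ q → c g ≠ z ∧ ¬ G.Adj (c g) z := by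
        rintro i j hj _ ⟨s, -, hs, rfl⟩ hzq
        refine ⟨(hcv g le_rfl s (by omega)).symm, fun hadj => ?_⟩
        rcases hq.eq_of_adj (by omega) hadj with h3 | h3
        · exact hne (hpc'.trans h3)
        · exact hzq h3
      rw [hpc']
      rintro z (((hz | hz) | (hz | rfl)) | (hz | rfl)) hzq
      exacts [hcgx z hz, hcgy z hz, hcgv le_rfl z hz hzq, hcgx _ hxn,
        hcgv (hab'.trans hbM) z hz hzq, hcgy _ hym]

/-- If the leg `l` misses the neighbours of `x 0`, or `l'` those of `x n`, then `theta_of_untouched`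
applies. Otherwise both contain legs towards `x`, so by `leg_small` `l 0` has several neighbours on
`t` and `l' 0` several on `r`, whereas `legs_of_two_mid` allows one of them only a single neighbour.
-/
theorem theta (hG : NoTriangle G) (hc : CrossConfig G A₁ A₂ A₃ n x m y k t k' r) :
    G.ContainsInducedTheta := by
  by_contra hth
  obtain ⟨h, l, hl⟩ := exists_leg (T := seg t 0 k) hc.tri.conn₁ (mem_seg le_rfl (Nat.zero_le _))
    hc.midt.att₃ hc.midr.att₁
  obtain ⟨h', l', hl'⟩ := exists_leg (T := seg r 0 k') hc.tri.conn₂ (mem_seg le_rfl (Nat.zero_le _))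
    hc.midr.att₃ hc.midt.att₁
  by_cases h1 : ∃ i, i ≤ h ∧ G.Adj (l i) (x 0)
  swap
  · push Not at h1
    exact hth (theta_of_untouched hG hc hl h1)
  by_cases h2 : ∃ i, i ≤ h' ∧ G.Adj (l' i) (x n)
  swap
  · push Not at h2
    exact hth (theta_of_untouched hG hc.reverse hl' (by simpa using h2))
  obtain ⟨i, -, hi⟩ := hl.exists_take h1
  obtain ⟨i', -, hi'⟩ := hl'.exists_take h2
  obtain ⟨-, a, ha, b, hb, hab, ha', hb'⟩ := leg_small hG hth hc.tri hc.midx hc.small hc.midt hc.xt hi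
  obtain ⟨-, c, hc', d, hd, hcd, hc'', hd'⟩ := leg_small hG hth hc.reverse.tri hc.reverse.midx
    hc.small hc.reverse.midt hc.reverse.xt (by simpa using hi')
  rcases legs_of_two_mid hG hth hc.tri hc.midt hc.midr hc.tr hl hl' with h3 | h3
  · exact hcd ((h3.2.2 c hc' hc'').trans (h3.2.2 d hd hd').symm)
  · exact hab ((h3.2.2 a ha ha').trans (h3.2.2 b hb hb').symm)

end CrossConfig

/-! ### Branch sets of an induced minor. -/

lemma Conn.map {V V' : Type*} {G : SimpleGraph V} {G' : SimpleGraph V'} {φ : V' → V}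
    (hφ : ∀ a b, G'.Adj a b → G.Adj (φ a) (φ b)) {S : Set V'} {a b : V'} (h : Conn G' S a b) :
    Conn G (φ '' S) (φ a) (φ b) := by
  obtain ⟨ha, h⟩ := h
  induction h with
  | refl => exact .refl ⟨a, ha, rfl⟩
  | tail _ huv ih => exact ih.trans (.of_adj ih.right_mem ⟨_, huv.2, rfl⟩ (hφ _ _ huv.1))

/-- Each step lifts to an edge between two fibres, and successive lifted edges are joined inside the
connected fibre between them. -/
lemma Conn.preimage {V V' : Type*} {G : SimpleGraph V} {G' : SimpleGraph V'} {π : V → V'}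
    (hπ : ∀ x, ConnSet G (π ⁻¹' {x}))
    (hadj : ∀ x y, G'.Adj x y → ∃ a b, π a = x ∧ π b = y ∧ G.Adj a b) {S : Set V'} {x y : V'}
    (h : Conn G' S x y) {a b : V} (ha : π a = x) (hb : π b = y) : Conn G (π ⁻¹' S) a b := by
  have hfib : ∀ {z a b}, z ∈ S → π a = z → π b = z → Conn G (π ⁻¹' S) a b := fun hz ha hb =>
    ((hπ _).2 _ ha _ hb).mono (Set.preimage_mono (Set.singleton_subset_iff.2 hz))
  obtain ⟨hxS, h⟩ := h
  induction h generalizing b with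
  | refl => exact hfib hxS ha hb
  | @tail u v _ huv ih =>
    obtain ⟨c, d, hc, hd, hcd⟩ := hadj _ _ huv.1
    have h1 := ih hc
    exact h1.trans ((Conn.of_adj h1.right_mem (by simpa [hd] using huv.2) hcd).trans
      (hfib huv.2 hd hb))

universe u in
/-- An induced minor has a model by branch sets. -/
theorem exists_branch_sets {V W : Type u} {G : SimpleGraph V} {H : SimpleGraph W}
    (h : ReducesTo G H) : ∃ f : W → Set V, (∀ w, ConnSet G (f w)) ∧
      (∀ w w', w ≠ w' → ∀ a ∈ f w, a ∉ f w') ∧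
      ∀ w w', w ≠ w' → (H.Adj w w' ↔ ∃ a ∈ f w, ∃ b ∈ f w', G.Adj a b) := by
  induction h with
  | refl G =>
    exact ⟨fun w => {w}, fun w => .singleton w, fun w w' hww a ha ha' => hww (ha.symm.trans ha'),
      fun w w' _ => by simp⟩
  | @delete V W G H v _ ih =>
    obtain ⟨f, h1, h2, h3⟩ := ih
    refine ⟨fun w => Subtype.val '' f w, fun w => ⟨(h1 w).1.image _, ?_⟩, ?_, ?_⟩
    · rintro _ ⟨a, ha, rfl⟩ _ ⟨b, hb, rfl⟩
      exact ((h1 w).2 a ha b hb).map (φ := Subtype.val) (fun _ _ h => h)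
    · rintro w w' hww _ ⟨a, ha, rfl⟩ ⟨b, hb, hab⟩
      exact h2 w w' hww a ha (Subtype.ext hab ▸ hb)
    · intro w w' hww
      rw [h3 w w' hww]
      constructor
      · rintro ⟨a, ha, b, hb, hab⟩
        exact ⟨a, ⟨a, ha, rfl⟩, b, ⟨b, hb, rfl⟩, hab⟩
      · rintro ⟨_, ⟨a, ha, rfl⟩, _, ⟨b, hb, rfl⟩, hab⟩
        exact ⟨a, ha, b, hb, hab⟩
  | @contract V W G H u v huv _ ih =>
    classical
    obtain ⟨f, h1, h2, h3⟩ := ih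
    -- The quotient map of the contraction: its fibres are connected, so branch sets can be pulled
    -- back along it.
    let π : V → {x : V // x ≠ v} := fun x => if hx : x = v then ⟨u, huv.ne⟩ else ⟨x, hx⟩
    have hπv : π v = ⟨u, huv.ne⟩ := by simp [π]
    have hπ : ∀ x : {x : V // x ≠ v}, π x = x := fun x => by simp [π, x.2]
    have hπ' : ∀ a, a = (π a : V) ∨ (a = v ∧ (π a : V) = u) := fun a => by
      by_cases ha : a = v
      · subst ha
        exact .inr ⟨rfl, by rw [hπv]⟩
      · exact .inl (by simp [π, ha])
    have hfib : ∀ x, ConnSet G (π ⁻¹' {x}) := by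
      intro x
      have key : ∀ a, π a = x → Conn G (π ⁻¹' {x}) a x := by
        rintro a rfl
        rcases hπ' a with ha | ⟨rfl, ha⟩
        · have h : a ∈ π ⁻¹' {π a} := rfl
          exact ha ▸ Conn.refl h
        · have hmem : ((π a : {x : V // x ≠ a}) : V) ∈ π ⁻¹' {π a} := hπ _
          exact .of_adj rfl hmem (by rw [ha]; exact huv.symm)
      exact ⟨⟨x, hπ x⟩, fun a ha b hb => (key a ha).trans (key b hb).symm⟩
    have hadj : ∀ x y, (G.contractEdge u v).Adj x y → ∃ a b, π a = x ∧ π b = y ∧ G.Adj a b := by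
      rintro x y ⟨hne, h | ⟨hx, h⟩ | ⟨hy, h⟩⟩
      · exact ⟨x, y, hπ x, hπ y, h⟩
      · exact ⟨v, y, hπv.trans (Subtype.ext hx.symm), hπ y, h⟩
      · exact ⟨x, v, hπ x, hπv.trans (Subtype.ext hy.symm), h⟩
    have hadj' : ∀ a b, π a ≠ π b → G.Adj a b → (G.contractEdge u v).Adj (π a) (π b) := by
      intro a b hne hab
      refine ⟨hne, ?_⟩
      rcases hπ' a with ha | ⟨ha, ha'⟩ <;> rcases hπ' b with hb | ⟨hb, hb'⟩
      · exact .inl (by rwa [← ha, ← hb])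
      · exact .inr (.inr ⟨hb', by rwa [← ha, ← hb]⟩)
      · exact .inr (.inl ⟨ha', by rw [← hb]; rwa [ha] at hab⟩)
      · exact absurd (Subtype.ext (ha'.trans hb'.symm)) hne
    refine ⟨fun w => π ⁻¹' f w, fun w => ⟨?_, ?_⟩, fun w w' hww a ha ha' => h2 w w' hww _ ha ha', ?_⟩
    · obtain ⟨x, hx⟩ := (h1 w).1
      exact ⟨x, by rwa [Set.mem_preimage, hπ]⟩
    · intro a ha b hb
      exact ((h1 w).2 _ ha _ hb).preimage hfib hadj rfl rfl
    · intro w w' hww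
      rw [h3 w w' hww]
      constructor
      · rintro ⟨x, hx, y, hy, hxy⟩
        obtain ⟨a, b, rfl, rfl, hab⟩ := hadj x y hxy
        exact ⟨a, hx, b, hy, hab⟩
      · rintro ⟨a, ha, b, hb, hab⟩
        exact ⟨π a, ha, π b, hb, hadj' a b (fun h => h2 w w' hww _ ha (h ▸ hb)) hab⟩


/-- An induced minor model of `K_{3,4}`. -/
structure Model (G : SimpleGraph V) (A : Fin 3 → Set V) (B : Fin 4 → Set V) : Prop where
  connA : ∀ i, ConnSet G (A i)
  connB : ∀ j, ConnSet G (B j)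
  antiA : ∀ i i', i ≠ i' → Anti G ∅ (A i) (A i')
  antiB : ∀ j j', j ≠ j' → Anti G ∅ (B j) (B j')
  disj : ∀ i j, ∀ v ∈ A i, v ∉ B j
  touch : ∀ i j, ∃ b ∈ B j, Att G (A i) b

theorem exists_model (hG : (completeBipartiteGraph (Fin 3) (Fin 4)).IsInducedMinor G) :
    ∃ A B, Model G A B := by
  obtain ⟨U, K, hK, ⟨e⟩⟩ := hG
  obtain ⟨f, h1, h2, h3⟩ := exists_branch_sets hK
  have hne : ∀ {c d}, c ≠ d → e.symm c ≠ e.symm d := fun h h' => h (e.symm.injective h')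
  have hadj : ∀ c d, K.Adj (e.symm c) (e.symm d) ↔
      (completeBipartiteGraph (Fin 3) (Fin 4)).Adj c d := fun c d => e.symm.map_adj_iff
  have hanti : ∀ c d, c ≠ d → ¬ (completeBipartiteGraph (Fin 3) (Fin 4)).Adj c d →
      Anti G ∅ (f (e.symm c)) (f (e.symm d)) := by
    rintro c d hcd hn a ha b hb - -
    refine ⟨fun h => h2 _ _ (hne hcd) a ha (h ▸ hb), fun hab => hn ?_⟩
    rw [← hadj, h3 _ _ (hne hcd)]
    exact ⟨a, ha, b, hb, hab⟩
  refine ⟨fun i => f (e.symm (.inl i)), fun j => f (e.symm (.inr j)), fun i => h1 _, fun j => h1 _,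
    fun i i' hii => hanti _ _ (by simpa using hii) (by simp),
    fun j j' hjj => hanti _ _ (by simpa using hjj) (by simp),
    fun i j v hv => h2 _ _ (hne (by simp)) v hv, fun i j => ?_⟩
  have : K.Adj (e.symm (.inl i)) (e.symm (.inr j)) := by
    rw [hadj]
    simp
  rw [h3 _ _ (hne (by simp))] at this
  obtain ⟨a, ha, b, hb, hab⟩ := this
  exact ⟨b, hb, a, ha, hab⟩

/-! ### Minimal models: the four branch sets become paths. -/

namespace Model

variable {A : Fin 3 → Set V} {B : Fin 4 → Set V}

/-- Covers the two operations that shrink a `B j`: deleting a vertex, and moving a vertex from `B j`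
into some `A i`. -/
lemma replace (h : Model G A B) {i : Fin 3} {j : Fin 4} {A' B' : Set V} (hA' : ConnSet G A')
    (hB' : ConnSet G B') (hAA : ∀ i', i' ≠ i → Anti G ∅ A' (A i')) (hBB : B' ⊆ B j)
    (hsub : A i ⊆ A') (hd : ∀ v ∈ A', v ∉ B') (hd' : ∀ j', j' ≠ j → ∀ v ∈ A', v ∉ B j')
    (ht : ∃ b ∈ B', Att G A' b) (ht' : ∀ i', i' ≠ i → ∃ b ∈ B', Att G (A i') b) :
    Model G (Function.update A i A') (Function.update B j B') where
  connA i' := by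
    by_cases hi : i' = i
    · subst hi
      simpa using hA'
    · simpa [hi] using h.connA i'
  connB j' := by
    by_cases hj : j' = j
    · subst hj
      simpa using hB'
    · simpa [hj] using h.connB j'
  antiA i₁ i₂ hne := by
    by_cases h1 : i₁ = i
    · subst h1
      simpa [hne.symm] using hAA i₂ hne.symm
    · by_cases h2 : i₂ = i
      · subst h2
        simpa [h1] using (hAA i₁ hne).symm
      · simpa [h1, h2] using h.antiA i₁ i₂ hne
  antiB j₁ j₂ hne := by
    by_cases h1 : j₁ = j
    · subst h1
      simpa [hne.symm] using (h.antiB j₁ j₂ hne).mono hBB subset_rfl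
    · by_cases h2 : j₂ = j
      · subst h2
        simpa [h1] using (h.antiB j₁ j₂ hne).mono subset_rfl hBB
      · simpa [h1, h2] using h.antiB j₁ j₂ hne
  disj i' j' v hv hv' := by
    by_cases h1 : i' = i
    · subst h1
      rw [Function.update_self] at hv
      by_cases h2 : j' = j
      · subst h2
        rw [Function.update_self] at hv'
        exact hd v hv hv'
      · rw [Function.update_of_ne h2] at hv'
        exact hd' j' h2 v hv hv'
    · rw [Function.update_of_ne h1] at hv
      by_cases h2 : j' = j
      · subst h2
        rw [Function.update_self] at hv'
        exact h.disj i' j' v hv (hBB hv')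
      · rw [Function.update_of_ne h2] at hv'
        exact h.disj i' j' v hv hv'
  touch i' j' := by
    by_cases h1 : i' = i
    · subst h1
      rw [Function.update_self]
      by_cases h2 : j' = j
      · subst h2
        rwa [Function.update_self]
      · rw [Function.update_of_ne h2]
        obtain ⟨b, hb, a, ha, hab⟩ := h.touch i' j'
        exact ⟨b, hb, a, hsub ha, hab⟩
    · rw [Function.update_of_ne h1]
      by_cases h2 : j' = j
      · subst h2
        rw [Function.update_self]
        exact ht' i' h1
      · rw [Function.update_of_ne h2]
        exact h.touch i' j'

/-- A model in which the total size of the four branch sets is as small as possible. -/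
def Minimal (G : SimpleGraph V) (A : Fin 3 → Set V) (B : Fin 4 → Set V) : Prop :=
  Model G A B ∧ ∀ A' B', Model G A' B' → ∑ j, (B j).ncard ≤ ∑ j, (B' j).ncard

lemma exists_minimal (h : Model G A B) : ∃ A B, Minimal G A B := by
  classical
  have hex : ∃ s A B, Model G A B ∧ ∑ j, (B j).ncard = s := ⟨_, A, B, h, rfl⟩
  obtain ⟨A', B', h1, h2⟩ := Nat.find_spec hex
  exact ⟨A', B', h1, fun A'' B'' h'' => h2 ▸ Nat.find_min' hex ⟨A'', B'', h'', rfl⟩⟩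

section Finite

variable [Finite V]

lemma Minimal.false_of_remove (h : Minimal G A B) {j : Fin 4} {v : V} (hv : v ∈ B j)
    {A' : Fin 3 → Set V} (hM : Model G A' (Function.update B j (B j \ {v}))) : False := by
  have hlt : ∑ j', (Function.update B j (B j \ {v}) j').ncard < ∑ j', (B j').ncard := by
    refine Finset.sum_lt_sum (fun j' _ => ?_) ⟨j, Finset.mem_univ _, ?_⟩
    · by_cases hj : j' = j
      · subst hj
        rw [Function.update_self]
        exact Set.ncard_le_ncard Set.sdiff_subset (Set.toFinite _)
      · rw [Function.update_of_ne hj]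
    · rw [Function.update_self]
      exact Set.ncard_sdiff_singleton_lt_of_mem hv (Set.toFinite _)
  exact absurd (h.2 _ _ hM) (not_le.2 hlt)

/-- If every `A i` still touched `B j \ {v}`, then `v` could be deleted. If `A i` touches `B j` only
at `v` and no other `A k` touches `v`, then `v` could be moved into `A i`, which still touches `B j`
through a neighbour of `v` there. Both contradict minimality. -/
lemma Minimal.exists_private (h : Minimal G A B) {j : Fin 4} {v : V} (hv : v ∈ B j)
    (hc : ConnSet G (B j \ {v})) :
    ∃ i, (∀ b ∈ B j, Att G (A i) b → b = v) ∧ ∃ k, k ≠ i ∧ Att G (A k) v := by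
  have hM := h.1
  obtain ⟨i, hi⟩ : ∃ i, ∀ b ∈ B j, Att G (A i) b → b = v := by
    by_contra! hcon
    have ht : ∀ i, ∃ b ∈ B j \ {v}, Att G (A i) b := fun i => by
      obtain ⟨b, hb, hatt, hbv⟩ := hcon i
      exact ⟨b, ⟨hb, hbv⟩, hatt⟩
    refine h.false_of_remove hv (hM.replace (i := 0) (hM.connA 0) hc
      (fun i' hi' => hM.antiA 0 i' hi'.symm) Set.sdiff_subset subset_rfl
      (fun w hw hw' => hM.disj 0 j w hw hw'.1) (fun j' _ => hM.disj 0 j') (ht 0) (fun i' _ => ht i'))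
  refine ⟨i, hi, ?_⟩
  by_contra! hcon
  have hiv : Att G (A i) v := by
    obtain ⟨b, hb, hatt⟩ := hM.touch i j
    exact hi b hb hatt ▸ hatt
  obtain ⟨w, hw, hwv⟩ := hc.1
  obtain ⟨a, ha, _, rfl, hva⟩ := ((hM.connB j).2 w hw v hv).exists_touch (Q := {v}) hwv (.inl rfl)
  refine h.false_of_remove hv (hM.replace (i := i) ((hM.connA i).insert_vertex hiv) hc ?_
    Set.sdiff_subset (Set.subset_insert _ _) ?_ ?_ ⟨a, ha.right_mem, _, .inl rfl, hva⟩ ?_)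
  · rintro i' hi' u (rfl | hu) b hb - -
    · exact ⟨fun h => hM.disj i' j b hb (h ▸ hv), fun hadj => hcon i' hi' ⟨b, hb, hadj.symm⟩⟩
    · exact (hM.antiA i i' hi'.symm).apply hu hb
  · rintro u (rfl | hu) hu'
    · exact hu'.2 rfl
    · exact hM.disj i j u hu hu'.1
  · rintro j' hj' u (rfl | hu) hu'
    · exact ((hM.antiB j j' hj'.symm).apply hv hu').1 rfl
    · exact hM.disj i j' u hu hu'
  · intro i' hi'
    obtain ⟨b, hb, hatt⟩ := hM.touch i' j
    exact ⟨b, ⟨hb, fun h => hcon i' hi' (h ▸ hatt)⟩, hatt⟩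

/-- In a minimal model, each of the four branch sets is a path with a middle set. -/
theorem Minimal.exists_mid (h : Minimal G A B) (j : Fin 4) :
    ∃ n t i₁ i₂ i₃, i₁ ≠ i₂ ∧ i₁ ≠ i₃ ∧ i₂ ≠ i₃ ∧ seg t 0 n = B j ∧
      Mid G (A i₁) (A i₂) (A i₃) n t := by
  have hM := h.1
  have hB := hM.connB j
  obtain ⟨v, hv⟩ := hB.1
  by_cases hsing : B j = {v}
  · have hatt : ∀ i, Att G (A i) v := fun i => by
      obtain ⟨b, hb, hatt⟩ := hM.touch i j
      rw [hsing] at hb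
      exact hb ▸ hatt
    have hn : ∀ i, v ∉ A i := fun i hvi => hM.disj i j v hvi hv
    -- A single vertex touches all three sets, so any of them can serve as the middle set.
    refine ⟨0, fun _ => v, 0, 1, 2, by decide, by decide, by decide, ?_,
      ⟨⟨fun i j hi hj _ => by omega, fun i hi => by omega,
        fun i j _ _ h => absurd h (G.loopless.irrefl v)⟩, fun _ _ => hn 0, fun _ _ => hn 1,
        fun _ _ => hn 2, fun l hl _ => by omega, fun l hl _ => by omega, hatt 0, hatt 1, hatt 2,
        hatt 2⟩⟩
    rw [hsing]
    ext w
    constructor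
    · rintro ⟨-, -, -, rfl⟩
      rfl
    · rintro rfl
      exact ⟨0, le_rfl, le_rfl, rfl⟩
  have hss : ∀ u ∈ B j, ({u} : Set V) ⊂ B j := by
    intro u hu
    refine ⟨Set.singleton_subset_iff.2 hu, fun hle => hsing ?_⟩
    have : v = u := hle hv
    subst this
    exact hle.antisymm (Set.singleton_subset_iff.2 hu)
  obtain ⟨v₁, hv₁, hc₁⟩ := hB.exists_diff (.singleton v) (hss v hv)
  obtain ⟨v₂, hv₂, hc₂⟩ := hB.exists_diff (.singleton v₁) (hss v₁ hv₁.1)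
  have hv₁₂ : v₂ ≠ v₁ := hv₂.2
  -- The removable vertices `v₁` and `v₂` have different private sets, and each is touched by a
  -- further set. That set cannot be the private one of the other vertex, so it is the same third
  -- set for both: the middle set.
  obtain ⟨i₁, hp₁, k₁, hk₁, hatt₁⟩ := h.exists_private hv₁.1 hc₁
  obtain ⟨i₂, hp₂, k₂, hk₂, hatt₂⟩ := h.exists_private hv₂.1 hc₂
  have hown : ∀ {i v}, (∀ b ∈ B j, Att G (A i) b → b = v) → Att G (A i) v := fun {i v} hp => by
    obtain ⟨b, hb, hatt⟩ := hM.touch i j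
    exact hp b hb hatt ▸ hatt
  have hi₁₂ : i₁ ≠ i₂ := by
    rintro rfl
    exact hv₁₂ (hp₁ v₂ hv₂.1 (hown hp₂))
  have hk₁i₂ : k₁ ≠ i₂ := fun h => hv₁₂ (hp₂ v₁ hv₁.1 (h ▸ hatt₁)).symm
  have hk₂i₁ : k₂ ≠ i₁ := fun h => hv₁₂ (hp₁ v₂ hv₂.1 (h ▸ hatt₂))
  have hthird : ∀ a b : Fin 3, a ≠ b → ∀ c d, c ≠ a → c ≠ b → d ≠ a → d ≠ b → d = c := by decide
  have hk : k₂ = k₁ := hthird i₁ i₂ hi₁₂ _ _ hk₁ hk₁i₂ hk₂i₁ hk₂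
  subst hk
  obtain ⟨n, t, ht, htB, ht0, htn, -, -⟩ := exists_path (hB.2 v₁ hv₁.1 v₂ hv₂.1) (X := (· = v₁))
    (Y := (· = v₂)) rfl rfl
  have hsub : seg t 0 n ⊆ B j := by
    rintro _ ⟨i, -, hi, rfl⟩
    exact htB i hi
  have hv₁P : v₁ ∈ seg t 0 n := ⟨0, le_rfl, Nat.zero_le _, ht0⟩
  have hv₂P : v₂ ∈ seg t 0 n := ⟨n, Nat.zero_le _, le_rfl, htn⟩
  -- A removable vertex off the path would be the only contact of some `A i` with `B j`, but each of
  -- the three sets already touches `v₁` or `v₂`.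
  have heq : seg t 0 n = B j := by
    by_contra hne
    obtain ⟨v₃, hv₃, hc₃⟩ := hB.exists_diff (seg_zero_connSet ht)
      ⟨hsub, fun hle => hne (hsub.antisymm hle)⟩
    obtain ⟨i, hp, -⟩ := h.exists_private hv₃.1 hc₃
    have h1 : ¬ Att G (A i) v₁ := fun hatt => hv₃.2 (hp v₁ hv₁.1 hatt ▸ hv₁P)
    have h2 : ¬ Att G (A i) v₂ := fun hatt => hv₃.2 (hp v₂ hv₂.1 hatt ▸ hv₂P)
    have hi : i = k₂ := hthird i₁ i₂ hi₁₂ _ _ hk₁ hk₁i₂ (fun h => h1 (h ▸ hown hp₁))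
      (fun h => h2 (h ▸ hown hp₂))
    exact h1 (hi ▸ hatt₁)
  have hnm : ∀ i l, l ≤ n → t l ∉ A i := fun i l hl hmem => hM.disj i j _ hmem (htB l hl)
  exact ⟨n, t, i₁, i₂, k₂, hi₁₂, hk₁.symm, hk₁i₂.symm, heq, ht, hnm i₁, hnm i₂, hnm k₂,
    fun l hl hatt => ht.inj l 0 hl (Nat.zero_le _) ((hp₁ _ (htB l hl) hatt).trans ht0.symm),
    fun l hl hatt => ht.inj l n hl le_rfl ((hp₂ _ (htB l hl) hatt).trans htn.symm),
    ht0 ▸ hown hp₁, htn ▸ hown hp₂, ht0 ▸ hatt₁, htn ▸ hatt₂⟩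

end Finite

end Model

/-! ### Distinguishing the lengths and middle sets of the four paths. -/

lemma noTriangle_of_not_isIndContained (h : ¬ (⊤ : SimpleGraph (Fin 3)).IsIndContained G) :
    NoTriangle G := by
  intro a b c hab hbc hac
  refine h ⟨⟨⟨![a, b, c], ?_⟩, ?_⟩⟩
  · intro i j hij
    fin_cases i <;> fin_cases j <;>
      simp_all [hab.ne, hbc.ne, hac.ne, hab.ne.symm, hbc.ne.symm, hac.ne.symm]
  · intro i j
    change G.Adj (![a, b, c] i) (![a, b, c] j) ↔ _
    fin_cases i <;> fin_cases j <;> simp [hab, hbc, hac, hab.symm, hbc.symm, hac.symm]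

lemma Model.tri {A : Fin 3 → Set V} {B : Fin 4 → Set V} (h : Model G A B) {a b c : Fin 3}
    (hab : a ≠ b) (hac : a ≠ c) (hbc : b ≠ c) : Tri G (A a) (A b) (A c) :=
  ⟨h.connA a, h.connA b, h.connA c, h.antiA a b hab, h.antiA a c hac, h.antiA b c hbc⟩

theorem theta_of_model [Finite V] (hG : NoTriangle G) {A : Fin 3 → Set V} {B : Fin 4 → Set V}
    (h : Model G A B) : G.ContainsInducedTheta := by
  obtain ⟨A, B, h⟩ := h.exists_minimal
  have hM := h.1
  -- Only the length and the middle set are fixed; reversing the path puts the two outer sets in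
  -- either order.
  have hmid : ∀ j, ∃ n c, ∀ a b, a ≠ b → a ≠ c → b ≠ c →
      ∃ t, seg t 0 n = B j ∧ Mid G (A a) (A b) (A c) n t := by
    intro j
    obtain ⟨n, t, a, b, c, hab, hac, hbc, hB, ht⟩ := h.exists_mid j
    refine ⟨n, c, fun a' b' hab' hac' hbc' => ?_⟩
    have key : ∀ a b c a' b' : Fin 3, a ≠ b → a ≠ c → b ≠ c → a' ≠ b' → a' ≠ c → b' ≠ c →
        (a' = a ∧ b' = b) ∨ (a' = b ∧ b' = a) := by decide
    rcases key a b c a' b' hab hac hbc hab' hac' hbc' with ⟨rfl, rfl⟩ | ⟨rfl, rfl⟩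
    · exact ⟨t, hB, ht⟩
    · exact ⟨_, seg_zero_reverse.trans hB, ht.reverse⟩
  choose N M hN using hmid
  have hother : ∀ c : Fin 3, ∃ a b, a ≠ b ∧ a ≠ c ∧ b ≠ c := by decide
  have hthird : ∀ a b : Fin 3, a ≠ b → ∃ c, c ≠ a ∧ c ≠ b := by decide
  by_contra hth
  -- two long paths with the same middle set
  have hsame : ∀ j₁ j₂ j₃, j₁ ≠ j₂ → j₁ ≠ j₃ → j₂ ≠ j₃ → 2 ≤ N j₁ → 2 ≤ N j₂ → 2 ≤ N j₃ →
      M j₁ ≠ M j₂ := by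
    intro j₁ j₂ j₃ h₁₂ h₁₃ h₂₃ hn₁ hn₂ hn₃ heq
    by_cases hc : M j₃ = M j₁
    · obtain ⟨a, b, hab, hac, hbc⟩ := hother (M j₁)
      obtain ⟨x, hxB, hx⟩ := hN j₁ a b hab hac hbc
      obtain ⟨y, hyB, hy⟩ := hN j₂ a b hab (heq ▸ hac) (heq ▸ hbc)
      obtain ⟨t, htB, ht⟩ := hN j₃ a b hab (hc ▸ hac) (hc ▸ hbc)
      rw [← heq] at hy
      rw [hc] at ht
      refine hth (theta_of_three_same_mid hG (hM.tri hab hac hbc) hx hy ht hn₁ hn₂ hn₃ ?_ ?_ ?_)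
      · exact hxB ▸ hyB ▸ hM.antiB _ _ h₁₂
      · exact hxB ▸ htB ▸ hM.antiB _ _ h₁₃
      · exact hyB ▸ htB ▸ hM.antiB _ _ h₂₃
    -- The first vertex of the third path touches `A b` and the path's own middle set `A (M j₃)`. It
    -- does not touch the common middle set `A (M j₁)`, whose only contact is the last vertex of
    -- this long path.
    · obtain ⟨b, hba, hbc⟩ := hthird _ _ hc
      obtain ⟨x, hxB, hx⟩ := hN j₁ (M j₃) b hba.symm hc hbc
      obtain ⟨y, hyB, hy⟩ := hN j₂ (M j₃) b hba.symm (heq ▸ hc) (heq ▸ hbc)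
      obtain ⟨t, htB, ht⟩ := hN j₃ b (M j₁) hbc hba (Ne.symm hc)
      rw [← heq] at hy
      have ht0 : t 0 ∈ B j₃ := htB ▸ mem_seg le_rfl (Nat.zero_le _)
      refine hth (theta_of_two_same_mid hG (hM.tri hba.symm hc hbc) hx hy (t := t 0) hn₁ hn₂ ?_ ?_ ?_
        (ht.not_mem₃ 0 (Nat.zero_le _)) (ht.not_mem₁ 0 (Nat.zero_le _))
        (ht.not_mem₂ 0 (Nat.zero_le _)) ht.att₃ ht.att₁ fun hatt => ?_)
      · exact hxB ▸ hyB ▸ hM.antiB _ _ h₁₂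
      · exact hxB ▸ (hM.antiB _ _ h₁₃).mono subset_rfl (Set.singleton_subset_iff.2 ht0)
      · exact hyB ▸ (hM.antiB _ _ h₂₃).mono subset_rfl (Set.singleton_subset_iff.2 ht0)
      · have := ht.eq₂ 0 (Nat.zero_le _) hatt
        omega
  -- two short paths
  have hsmall : ∀ j j', j ≠ j' → N j ≤ 1 → 2 ≤ N j' := by
    intro j j' hjj hn
    by_contra! hn'
    obtain ⟨a, b, hab, hac, hbc⟩ := hother (M j)
    obtain ⟨a', b', hab', hac', hbc'⟩ := hother (M j')
    obtain ⟨x, hxB, hx⟩ := hN j a b hab hac hbc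
    obtain ⟨y, hyB, hy⟩ := hN j' a' b' hab' hac' hbc'
    have hmem : ∀ {j t}, seg t 0 (N j) = B j → ∀ i l, l ≤ N j → t l ∉ A i := fun hB i l hl hmem =>
      hM.disj i _ _ hmem (hB ▸ mem_seg (Nat.zero_le _) hl)
    have htouch : ∀ {j t}, seg t 0 (N j) = B j → ∀ i, ∃ l, l ≤ N j ∧ Att G (A i) (t l) := by
      intro j t hB i
      obtain ⟨b, hb, hatt⟩ := hM.touch i j
      rw [← hB] at hb
      obtain ⟨l, -, hl, rfl⟩ := hb
      exact ⟨l, hl, hatt⟩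
    exact hth (theta_of_two_small hG hM.connA hM.antiA hx.path hy.path hn (by omega) (hmem hxB)
      (hmem hyB) (htouch hxB) (htouch hyB) (hxB ▸ hyB ▸ hM.antiB _ _ hjj))
  -- a short path whose middle set is that of one of the three long ones
  have hcross : ∀ j₀ j₁ j₂ j₃, j₀ ≠ j₁ → j₀ ≠ j₂ → j₀ ≠ j₃ → j₁ ≠ j₂ → j₁ ≠ j₃ → j₂ ≠ j₃ →
      2 ≤ N j₁ → 2 ≤ N j₂ → 2 ≤ N j₃ → M j₁ ≠ M j₂ → M j₁ ≠ M j₃ → M j₂ ≠ M j₃ →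
      M j₀ ≠ M j₃ := by
    intro j₀ j₁ j₂ j₃ h₀₁ h₀₂ h₀₃ h₁₂ h₁₃ h₂₃ hn₁ hn₂ hn₃ hm₁₂ hm₁₃ hm₂₃ heq
    by_cases hn₀ : 2 ≤ N j₀
    · exact hsame j₀ j₃ j₁ h₀₃ h₀₁ h₁₃.symm hn₀ hn₃ hn₁ heq
    obtain ⟨x, hxB, hx⟩ := hN j₀ (M j₁) (M j₂) hm₁₂ (heq ▸ hm₁₃) (heq ▸ hm₂₃)
    obtain ⟨y, hyB, hy⟩ := hN j₃ (M j₁) (M j₂) hm₁₂ hm₁₃ hm₂₃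
    obtain ⟨t, htB, ht⟩ := hN j₁ (M j₂) (M j₃) hm₂₃ hm₁₂.symm hm₁₃.symm
    obtain ⟨r, hrB, hr⟩ := hN j₂ (M j₁) (M j₃) hm₁₃ hm₁₂ hm₂₃.symm
    rw [heq] at hx
    refine hth (CrossConfig.theta hG ⟨hM.tri hm₁₂ hm₁₃ hm₂₃, hx, hy, ht, hr, by omega, hn₃, hn₁, hn₂,
      ?_, ?_, ?_, ?_, ?_, ?_⟩)
    · exact hxB ▸ hyB ▸ hM.antiB _ _ h₀₃
    · exact hxB ▸ htB ▸ hM.antiB _ _ h₀₁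
    · exact hxB ▸ hrB ▸ hM.antiB _ _ h₀₂
    · exact hyB ▸ htB ▸ hM.antiB _ _ h₁₃.symm
    · exact hyB ▸ hrB ▸ hM.antiB _ _ h₂₃.symm
    · exact htB ▸ hrB ▸ hM.antiB _ _ h₁₂
  -- At most one path is short. The other three are long with distinct middle sets, so the middle
  -- set of `j₀` is one of theirs.
  obtain ⟨j₀, hj₀⟩ : ∃ j₀, ∀ j, j₀ ≠ j → 2 ≤ N j := by
    by_cases hex : ∃ j₀, N j₀ ≤ 1
    · obtain ⟨j₀, hj₀⟩ := hex
      exact ⟨j₀, fun j hj => hsmall j₀ j hj hj₀⟩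
    · push Not at hex
      exact ⟨0, fun j _ => hex j⟩
  obtain ⟨j₁, j₂, j₃, h₀₁, h₀₂, h₀₃, h₁₂, h₁₃, h₂₃⟩ : ∃ j₁ j₂ j₃, j₀ ≠ j₁ ∧ j₀ ≠ j₂ ∧ j₀ ≠ j₃ ∧
      j₁ ≠ j₂ ∧ j₁ ≠ j₃ ∧ j₂ ≠ j₃ := by
    have : ∀ j₀ : Fin 4, ∃ j₁ j₂ j₃, j₀ ≠ j₁ ∧ j₀ ≠ j₂ ∧ j₀ ≠ j₃ ∧ j₁ ≠ j₂ ∧ j₁ ≠ j₃ ∧ j₂ ≠ j₃ := by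
      decide
    exact this j₀
  have hn₁ := hj₀ j₁ h₀₁
  have hn₂ := hj₀ j₂ h₀₂
  have hn₃ := hj₀ j₃ h₀₃
  have hm₁₂ := hsame j₁ j₂ j₃ h₁₂ h₁₃ h₂₃ hn₁ hn₂ hn₃
  have hm₁₃ := hsame j₁ j₃ j₂ h₁₃ h₁₂ h₂₃.symm hn₁ hn₃ hn₂
  have hm₂₃ := hsame j₂ j₃ j₁ h₂₃ h₁₂.symm h₁₃.symm hn₂ hn₃ hn₁
  have hcover : ∀ a b c : Fin 3, a ≠ b → a ≠ c → b ≠ c → ∀ d, d = a ∨ d = b ∨ d = c := by decide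
  rcases hcover _ _ _ hm₁₂ hm₁₃ hm₂₃ (M j₀) with heq | heq | heq
  · exact hcross j₀ j₂ j₃ j₁ h₀₂ h₀₃ h₀₁ h₂₃ h₁₂.symm h₁₃.symm hn₂ hn₃ hn₁ hm₂₃ hm₁₂.symm hm₁₃.symm
      heq
  · exact hcross j₀ j₁ j₃ j₂ h₀₁ h₀₃ h₀₂ h₁₃ h₁₂ h₂₃.symm hn₁ hn₃ hn₂ hm₁₃ hm₁₂ hm₂₃.symm heq
  · exact hcross j₀ j₁ j₂ j₃ h₀₁ h₀₂ h₀₃ h₁₂ h₁₃ h₂₃ hn₁ hn₂ hn₃ hm₁₂ hm₁₃ hm₂₃ heq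

end InducedTheta
end SimpleGraph

theorem theorem2 {V : Type*} [Finite V] (G : SimpleGraph V)
    (hG : (completeBipartiteGraph (Fin 3) (Fin 4)).IsInducedMinor G) :
    (⊤ : SimpleGraph (Fin 3)).IsIndContained G ∨ G.ContainsInducedTheta := by
  by_cases h : (⊤ : SimpleGraph (Fin 3)).IsIndContained G
  · exact .inl h
  · obtain ⟨A, B, hM⟩ := SimpleGraph.InducedTheta.exists_model hG
    exact .inr (SimpleGraph.InducedTheta.theta_of_model
      (SimpleGraph.InducedTheta.noTriangle_of_not_isIndContained h) hM)
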